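/- Let $S^3=\{s\in\mathbb R^4: s_1^2+s_2^2+s_3^2+s_4^2=1\}$, $J_{jk}=s_j\partial_{s_k}-s_k\partial_{s_j}$, $\Delta_S=\sum_{j<k}J_{jk}^2$ (the Laplace–Beltrami operator), $\{A,B\}=AB+BA$ and $\rho=\sqrt{s_1^2+s_2^2+s_3^2}$. All operators act on smooth complex-valued functions on an open subset $U$ of $S^3$; all parameters are complex. For $a=(a_0,\dots,a_4)$ and $U\subseteq\{s_1s_2s_3\neq0\}$ put $$H'_a=\Delta_S+\frac{a_0s_4}{\rho}+\frac{a_1}{s_1^2}+\frac{a_2}{s_2^2}+\frac{a_3}{s_3^2}+a_4,$$ $$L_{12}=J_{12}^2+\frac{a_2s_1^2}{s_2^2}+\frac{a_1s_2^2}{s_1^2},\quad L_{13}=J_{13}^2+\frac{a_1s_3^2}{s_1^2}+\frac{a_3s_1^2}{s_3^2},\quad L_{23}=J_{23}^2+\frac{a_2s_3^2}{s_2^2}+\frac{a_3s_2^2}{s_3^2},$$ $$M_1=\tfrac12\left(\{J_{23},J_{42}\}+\{J_{13},J_{41}\}\right)-\frac{a_0}{2}\frac{s_3}{\rho}-a_1\frac{s_3s_4}{s_1^2}-a_2\frac{s_3s_4}{s_2^2}-a_3\frac{s_4}{s_3},$$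 $$M_3=\tfrac12\left(\{J_{21},J_{42}\}+\{J_{31},J_{43}\}\right)-\frac{a_0}{2}\frac{s_1}{\rho}-a_3\frac{s_1s_4}{s_3^2}-a_2\frac{s_1s_4}{s_2^2}-a_1\frac{s_4}{s_1},$$ $$X=\{s_1,J_{41}\}+\{s_2,J_{42}\}+\{s_3,J_{43}\},$$ $$K_1=-4M_1^2-\tfrac12\left\{X^2,\frac{a_3}{s_3^2}\right\}+a_3\frac{5-7(s_1^2+s_2^2)}{s_3^2},\qquad K_3=-4M_3^2-\tfrac12\left\{X^2,\frac{a_1}{s_1^2}\right\}+a_1\frac{5-7(s_3^2+s_2^2)}{s_1^2}.$$ For $b=(b_1,\dots,b_4)$ and $U\subseteq\{s_1s_2\ne0\}$ put $H_b=\Delta_S+\dfrac{b_1s_4}{\rho}+\dfrac{b_2}{s_1^2}+\dfrac{b_3}{s_2^2}+b_4$, and $$L^0_{12}=J_{12}^2+\frac{b_3s_1^2}{s_2^2}+\frac{b_2s_2^2}{s_1^2},\quad L^0_{13}=J_{13}^2+\frac{b_2s_3^2}{s_1^2},\quad L^0_{23}=J_{23}^2+\frac{b_3s_3^2}{s_2^2},$$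 $$L=\{J_{13},J_{41}\}+\{J_{23},J_{42}\}-\frac{b_1s_3}{\rho}-2s_3s_4\left(\frac{b_2}{s_1^2}+\frac{b_3}{s_2^2}\right).$$ A symmetry of an operator is a linear differential operator with smooth complex coefficients commuting with it. An operator on $U$ is $n$-th order superintegrable if it has five symmetries of order at most $n$, one of them the operator itself, that are functionally independent: the differentials of their principal symbols are linearly independent on a dense subset of $T^*U$. A 3-parameter system $\Delta_S+b_1V_1+b_2V_2+b_3V_3$ is semidegenerate if it is 2nd order superintegrable for all $b$, the functions $V_1,V_2,V_3$ are functionally independent, and it is not the case that for all $b$ it has six symmetries of order at most two which together with the identity operator are linearly independent. The following hold. 1. For every open $U\subseteq\{s_1s_2s_3\ne0\}$ and every $a$, the operators $L_{12},L_{13},L_{23}$ (of order 2) and $K_1,K_3$ (of order 4) commute with $H'_a$. Each of the sets $\{H'_a,L_{12},L_{13},L_{23},K_1\}$ and $\{H'_a,L_{12},L_{13},L_{23},K_3\}$ is functionally independent, so $H'_a$ is 4th order superintegrable. If $U\neq\emptyset$, the operators $1,H'_a,L_{12},L_{13},L_{23},K_1,K_3$ are linearly independent. If $U$ is connected and non-empty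 and $a_0a_1a_2a_3\ne0$, every symmetry of $H'_a$ of order at most two is a linear combination of $1,H'_a,L_{12},L_{13},L_{23}$. 2. $H'$ extends $H$: for $a=(b_1,b_2,b_3,0,b_4)$ and $U\subseteq\{s_1s_2s_3\ne0\}$ one has $H'_a=H_b$, $L_{12}=L^0_{12}$, $L_{13}=L^0_{13}$, $L_{23}=L^0_{23}$ and $K_1=-L^2$. 3. $H$ is semidegenerate: for every connected non-empty open $U\subseteq\{s_1s_2\neq0\}$ the system with $V_1=s_4/\rho$, $V_2=1/s_1^2$, $V_3=1/s_2^2$ is semidegenerate. Moreover, for every open $U\subseteq\{s_1s_2\ne0\}$ and every $b$, $\{H_b,L^0_{12},L^0_{13},L^0_{23},L\}$ are functionally independent symmetries of $H_b$ of order at most two; and if $U$ is connected and non-empty and $b_1b_2b_3\ne0$, every symmetry of $H_b$ of order at most two is a linear combination of $1,H_b,L^0_{12},L^0_{13},L^0_{23},L$. 4. $H'$ is Stäckel equivalent to the flat system $$H'_{\mathrm{flat},a}=\partial_x^2+\partial_y^2+\partial_z^2+\frac{2a_0(1-r^2)}{r(r^2+1)^2}+\frac{a_1}{x^2}+\frac{a_2}{y^2}+\frac{a_3}{z^2}+\frac{4a_4}{(r^2+1)^2},\qquad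 r^2=x^2+y^2+z^2.$$ The map $\sigma(x,y,z)=\frac{1}{r^2+1}(2x,2y,2z,1-r^2)$ is a bijection from $\{xyz\neq0\}\subset\mathbb R^3$ onto $\{s\in S^3: s_1s_2s_3\ne0\}$ with inverse $s\mapsto\frac{1}{1+s_4}(s_1,s_2,s_3)$. With $u=4/(r^2+1)^2$, the coefficient function of $a_4$ in $H'_{\mathrm{flat}}$, the Stäckel transform of $H'_{\mathrm{flat}}$ by $u$, in self-adjoint form, is $H'$ up to the constant shift $a_4\mapsto a_4+\frac34$ of the last parameter (the scalar curvature term): for all $a$, all open $U\subseteq\{s_1s_2s_3\neq0\}$ and all $f\in C^\infty(U,\mathbb C)$, on $\sigma^{-1}(U)$ $$u^{-1/4}\,u^{-1}\,H'_{\mathrm{flat},(a_0,a_1,a_2,a_3,a_4+3/4)}\left(u^{1/4}\,(f\circ\sigma)\right)=(H'_af)\circ\sigma .$$ -/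

import Mathlib

open scoped Manifold ContDiff Laplacian

noncomputable section

namespace CoulombSphere

/-- `ℝ⁴`, with Cartesian coordinates `s₁, s₂, s₃, s₄` (indices `0, 1, 2, 3`). -/
abbrev E4 : Type := EuclideanSpace ℝ (Fin 4)

/-- `ℝ³`, with Cartesian coordinates `x, y, z` (indices `0, 1, 2`). -/
abbrev E3 : Type := EuclideanSpace ℝ (Fin 3)

/-- The unit 3-sphere in `ℝ⁴`. -/
abbrev S3 : Type := Metric.sphere (0 : E4) 1

instance factE4 : Fact (Module.finrank ℝ E4 = 3 + 1) := ⟨finrank_euclideanSpace_fin⟩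

/-! ### Smooth functions on an open subset of the sphere -/

/-- The algebra `C^∞(U, ℂ)` of smooth complex functions on an open subset `U` of the 3-sphere. -/
def Smooth (U : TopologicalSpace.Opens S3) : Subalgebra ℂ (U → ℂ) where
  carrier := {f | ContMDiff (𝓡 3) 𝓘(ℝ, ℂ) ∞ f}
  mul_mem' {f g} hf hg := by
    have hf' : ContMDiff (𝓡 3) 𝓘(ℝ, ℂ) ∞ f := hf
    have hg' : ContMDiff (𝓡 3) 𝓘(ℝ, ℂ) ∞ g := hg
    have h : ContDiff ℝ ∞ fun z : ℂ × ℂ => z.1 * z.2 := contDiff_mul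
    exact h.contMDiff.comp (hf'.prodMk_space hg')
  add_mem' {f g} hf hg := by
    have hf' : ContMDiff (𝓡 3) 𝓘(ℝ, ℂ) ∞ f := hf
    have hg' : ContMDiff (𝓡 3) 𝓘(ℝ, ℂ) ∞ g := hg
    exact hf'.add hg'
  algebraMap_mem' c := contMDiff_const

open Classical in
/-- The extension of a function on `U ⊆ S³` to the open cone over `U`, constant along rays
(and zero off the cone). -/
def radialExt {U : TopologicalSpace.Opens S3} (f : U → ℂ) (x : E4) : ℂ :=
  if h : ∃ p : U, (p : E4) = ‖x‖⁻¹ • x then f h.choose else 0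

/-- The open cone over `U ⊆ S³`. -/
def cone (U : TopologicalSpace.Opens S3) : Set E4 := {x | ∃ p : U, (p : E4) = ‖x‖⁻¹ • x}

theorem radialExt_eq {U : TopologicalSpace.Opens S3} (f : U → ℂ) (p : U) (x : E4)
    (h : (p : E4) = ‖x‖⁻¹ • x) : radialExt f x = f p := by
  have h' : ∃ p : U, (p : E4) = ‖x‖⁻¹ • x := ⟨p, h⟩
  have e : h'.choose = p := by
    apply Subtype.ext; apply Subtype.ext; rw [h'.choose_spec, h]
  simp only [radialExt, dif_pos h', e]

theorem norm_coe {U : TopologicalSpace.Opens S3} (p : U) : ‖(p : E4)‖ = 1 :=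
  norm_eq_of_mem_sphere (p : S3)

theorem coe_eq {U : TopologicalSpace.Opens S3} (p : U) :
    (p : E4) = ‖(p : E4)‖⁻¹ • (p : E4) := by
  rw [norm_coe, inv_one, one_smul]

theorem radialExt_coe {U : TopologicalSpace.Opens S3} (f : U → ℂ) (p : U) :
    radialExt f (p : E4) = f p := radialExt_eq f p _ (coe_eq p)

theorem ne_zero_of_mem_cone {U : TopologicalSpace.Opens S3} {x : E4} (hx : x ∈ cone U) :
    x ≠ 0 := by
  rintro rfl
  obtain ⟨p, hp⟩ := hx
  have := norm_coe p
  rw [hp] at this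
  simp at this

/-- The punctured space `ℝ⁴ ∖ {0}`. -/
def punctured : TopologicalSpace.Opens E4 := ⟨{0}ᶜ, isOpen_compl_singleton⟩

theorem normalize_mem (x : punctured) : ‖(x : E4)‖⁻¹ • (x : E4) ∈ Metric.sphere (0 : E4) 1 := by
  have : (x : E4) ≠ 0 := x.2
  simp [norm_smul, this]

/-- The radial projection `ℝ⁴ ∖ {0} → S³`. -/
def radialProj : punctured → S3 :=
  Set.codRestrict (fun x : punctured => ‖(x : E4)‖⁻¹ • (x : E4)) _ normalize_mem

theorem contMDiff_radialProj : ContMDiff 𝓘(ℝ, E4) (𝓡 3) ∞ radialProj := by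
  apply ContMDiff.codRestrict_sphere
  intro x
  have hx : (x : E4) ≠ 0 := x.2
  have h : ContDiffAt ℝ ∞ (fun y : E4 => ‖y‖⁻¹ • y) (x : E4) :=
    ((contDiffAt_norm ℝ hx).inv (norm_ne_zero_iff.2 hx)).smul contDiffAt_id
  exact contMDiffAt_subtype_iff.2 h.contMDiffAt

theorem isOpen_cone (U : TopologicalSpace.Opens S3) : IsOpen (cone U) := by
  have h : cone U = (Subtype.val : punctured → E4) '' (radialProj ⁻¹' (U : Set S3)) := by
    ext x
    constructor
    · intro hx
      obtain ⟨p, hp⟩ := hx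
      refine ⟨⟨x, ne_zero_of_mem_cone ⟨p, hp⟩⟩, ?_, rfl⟩
      have : radialProj ⟨x, ne_zero_of_mem_cone ⟨p, hp⟩⟩ = (p : S3) := Subtype.ext hp.symm
      simp only [Set.mem_preimage, this]
      exact p.2
    · rintro ⟨y, hy, rfl⟩
      exact ⟨⟨radialProj y, hy⟩, rfl⟩
  rw [h]
  exact punctured.isOpen.isOpenMap_subtype_val _
    (U.isOpen.preimage contMDiff_radialProj.continuous)

/-- A function on `U` is smooth iff its extension constant along rays is smooth. -/
theorem mem_Smooth_iff {U : TopologicalSpace.Opens S3} (f : U → ℂ) :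
    f ∈ Smooth U ↔ ContDiffOn ℝ ∞ (radialExt f) (cone U) := by
  constructor
  · intro hf x hx
    have hf' : ContMDiff (𝓡 3) 𝓘(ℝ, ℂ) ∞ f := hf
    have hx0 : x ≠ 0 := ne_zero_of_mem_cone hx
    obtain ⟨p, hp⟩ := hx
    let g : S3 → ℂ := fun q => radialExt f (q : E4)
    have hg : ContMDiffAt (𝓡 3) 𝓘(ℝ, ℂ) ∞ g (p : S3) := by
      rw [← contMDiffAt_subtype_iff]
      have : (fun q : U => g q) = f := funext fun q => radialExt_coe f q
      rw [this]
      exact hf' p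
    have hpx : radialProj ⟨x, hx0⟩ = (p : S3) := Subtype.ext hp.symm
    have hcomp : ContMDiffAt 𝓘(ℝ, E4) 𝓘(ℝ, ℂ) ∞ (g ∘ radialProj) ⟨x, hx0⟩ := by
      refine ContMDiffAt.comp (I' := 𝓡 3) _ ?_ (contMDiff_radialProj _)
      rw [hpx]; exact hg
    have heq : (g ∘ radialProj) = fun y : punctured => radialExt f (y : E4) := by
      funext y
      have hn : ‖(radialProj y : E4)‖⁻¹ • (radialProj y : E4) = ‖(y : E4)‖⁻¹ • (y : E4) := by
        have : ‖(radialProj y : E4)‖ = 1 := norm_eq_of_mem_sphere (radialProj y)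
        rw [this, inv_one, one_smul]; rfl
      change radialExt f (radialProj y : E4) = radialExt f (y : E4)
      by_cases h : ∃ p : U, (p : E4) = ‖(y : E4)‖⁻¹ • (y : E4)
      · obtain ⟨q, hq⟩ := h
        rw [radialExt_eq f q _ hq, radialExt_eq f q _ (hq.trans hn.symm)]
      · have h' : ¬ ∃ p : U, (p : E4) = ‖(radialProj y : E4)‖⁻¹ • (radialProj y : E4) := by
          rw [hn]; exact h
        simp only [radialExt, dif_neg h, dif_neg h']
    rw [heq] at hcomp
    exact (contMDiffAt_iff_contDiffAt.1 (contMDiffAt_subtype_iff.1 hcomp)).contDiffWithinAt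
  · intro hf p
    have hp : (p : E4) ∈ cone U := ⟨p, coe_eq p⟩
    have h1 : ContMDiffAt 𝓘(ℝ, E4) 𝓘(ℝ, ℂ) ∞ (radialExt f) (p : E4) :=
      (hf.contDiffAt ((isOpen_cone U).mem_nhds hp)).contMDiffAt
    have h2 : ContMDiff (𝓡 3) 𝓘(ℝ, E4) ∞ (fun q : U => (q : E4)) :=
      (contMDiff_coe_sphere (E := E4) (n := 3)).comp contMDiff_subtype_val
    have h3 := ContMDiffAt.comp p h1 (h2 p)
    have : (radialExt f ∘ fun q : U => (q : E4)) = f := funext fun q => radialExt_coe f q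
    rw [this] at h3
    exact h3

/-! ### Operators on `C^∞(U, ℂ)` -/

/-- The associative algebra of linear operators on `C^∞(U, ℂ)`. -/
abbrev Op (U : TopologicalSpace.Opens S3) : Type := Module.End ℂ (Smooth U)

/-- Multiplication by a smooth function. -/
def mulOp {U : TopologicalSpace.Opens S3} : Smooth U →ₗ[ℂ] Op U := LinearMap.mul ℂ (Smooth U)

/-- The tangent vector `x_j e_k - x_k e_j` of the sphere at `x`. -/
def rotVec (j k : Fin 4) (x : E4) : E4 :=
  x j • EuclideanSpace.single k (1 : ℝ) - x k • EuclideanSpace.single j (1 : ℝ)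

theorem rotDeriv_mem {U : TopologicalSpace.Opens S3} (j k : Fin 4) {f : U → ℂ}
    (hf : f ∈ Smooth U) :
    (fun p : U => fderiv ℝ (radialExt f) (p : E4) (rotVec j k p)) ∈ Smooth U := by
  rw [mem_Smooth_iff] at hf ⊢
  have hd : ContDiffOn ℝ ∞ (fun x => fderiv ℝ (radialExt f) x) (cone U) :=
    hf.fderiv_of_isOpen (isOpen_cone U) (by simp)
  have hn : ContDiffOn ℝ ∞ (fun y : E4 => ‖y‖⁻¹ • y) (cone U) := by
    intro x hx
    have hx0 := ne_zero_of_mem_cone hx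
    exact (((contDiffAt_norm ℝ hx0).inv (norm_ne_zero_iff.2 hx0)).smul
      contDiffAt_id).contDiffWithinAt
  have hmaps : Set.MapsTo (fun y : E4 => ‖y‖⁻¹ • y) (cone U) (cone U) := by
    rintro x ⟨p, hp⟩
    refine ⟨p, ?_⟩
    change (p : E4) = ‖‖x‖⁻¹ • x‖⁻¹ • (‖x‖⁻¹ • x)
    rw [← hp]; exact coe_eq p
  have hrot : ContDiff ℝ ∞ (rotVec j k) := by
    unfold rotVec
    fun_prop
  have h := (hd.comp hn hmaps).clm_apply (hrot.comp_contDiffOn hn)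
  refine h.congr ?_
  rintro x ⟨p, hp⟩
  rw [radialExt_eq _ p x hp, hp]
  rfl

theorem radialExt_add {U : TopologicalSpace.Opens S3} (f g : U → ℂ) :
    radialExt (f + g) = radialExt f + radialExt g := by
  funext x
  by_cases h : ∃ p : U, (p : E4) = ‖x‖⁻¹ • x <;> simp [radialExt, h]

theorem radialExt_smul {U : TopologicalSpace.Opens S3} (c : ℂ) (f : U → ℂ) :
    radialExt (c • f) = c • radialExt f := by
  funext x
  by_cases h : ∃ p : U, (p : E4) = ‖x‖⁻¹ • x <;> simp [radialExt, h]

theorem differentiableAt_radialExt {U : TopologicalSpace.Opens S3} {f : U → ℂ}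
    (hf : f ∈ Smooth U) (p : U) : DifferentiableAt ℝ (radialExt f) (p : E4) :=
  (((mem_Smooth_iff f).1 hf).contDiffAt
    ((isOpen_cone U).mem_nhds ⟨p, coe_eq p⟩)).differentiableAt (by simp)

/-- The rotation generator `J_{jk} = s_j ∂_{s_k} - s_k ∂_{s_j}` on functions on `U ⊆ S³`. -/
def J {U : TopologicalSpace.Opens S3} (j k : Fin 4) : Op U where
  toFun f := ⟨fun p => fderiv ℝ (radialExt f.1) (p : E4) (rotVec j k p), rotDeriv_mem j k f.2⟩
  map_add' f g := by
    apply Subtype.ext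
    funext p
    change fderiv ℝ (radialExt (f.1 + g.1)) (p : E4) (rotVec j k p) = _
    rw [radialExt_add, fderiv_add (differentiableAt_radialExt f.2 p)
      (differentiableAt_radialExt g.2 p)]
    rfl
  map_smul' c f := by
    apply Subtype.ext
    funext p
    change fderiv ℝ (radialExt (c • f.1)) (p : E4) (rotVec j k p) = _
    rw [radialExt_smul, fderiv_const_smul (differentiableAt_radialExt f.2 p)]
    rfl

/-- `diffOp U n` is the space of linear differential operators of order at most `n` with smooth
complex coefficients on `U`: the operators built from multiplications and at most `n` of the
vector fields `J_{jk}`, which generate all smooth vector fields over `C^∞(U, ℂ)`. -/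
def diffOp (U : TopologicalSpace.Opens S3) : ℕ → Submodule ℂ (Op U)
  | 0 => LinearMap.range mulOp
  | n + 1 => diffOp U n ⊔ ⨆ (j : Fin 4) (k : Fin 4),
      (diffOp U n).map (LinearMap.mulLeft ℂ (J j k))

/-- The symmetrizer `{A, B} = AB + BA`. -/
def symm {U : TopologicalSpace.Opens S3} (A B : Op U) : Op U := A * B + B * A

/-! ### Superintegrability -/

/-- The coordinate function `s_i`. -/
def coord {U : TopologicalSpace.Opens S3} (i : Fin 4) : Smooth U :=
  ⟨fun p => (((p : E4) i : ℝ) : ℂ), by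
    have h : ContDiff ℝ ∞ (fun x : E4 => ((x i : ℝ) : ℂ)) :=
      Complex.ofRealCLM.contDiff.comp (by fun_prop)
    have h2 : ContMDiff (𝓡 3) 𝓘(ℝ, E4) ∞ (fun q : U => (q : E4)) :=
      (contMDiff_coe_sphere (E := E4) (n := 3)).comp contMDiff_subtype_val
    exact h.contMDiff.comp h2⟩

/-- The symbol of order `n` of an operator `D` of order at most `n`: at the point `p` and the
covector `ξ` (the restriction to `T_p S³` of the linear form `⟨ξ, ·⟩` on `ℝ⁴`) it is
`(1 / n!) [… [[D, ℓ], ℓ] …, ℓ] 1 (p)`, with `n` commutators and `ℓ = ∑ ξ_i s_i`. -/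
def symbol {U : TopologicalSpace.Opens S3} (n : ℕ) (D : Op U) (p : U) (ξ : E4) : ℂ :=
  let l : Op U := mulOp (∑ i, ((ξ i : ℝ) : ℂ) • coord i)
  ((n.factorial : ℂ))⁻¹ * ((fun B : Op U => B * l - l * B)^[n] D 1).1 p

/-- Functional independence of the symbols of the operators `S i` (of orders `d i`) as functions
on phase space: their differentials are linearly independent on a dense set. The phase space
`T^*U` is the quotient of `U × ℝ⁴` by `(p, ξ) ∼ (p, ξ + t p)`, and the symbols are pulled back to
`U × ℝ⁴` and extended in `p` to be constant along rays; this pullback along a submersion does not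
affect the linear independence of differentials. -/
def SymbolsIndependent {U : TopologicalSpace.Opens S3} {m : ℕ} (d : Fin m → ℕ)
    (S : Fin m → Op U) : Prop :=
  Dense {z : U × E4 | LinearIndependent ℂ fun i : Fin m =>
    fderiv ℝ (fun y : E4 × E4 => radialExt (fun p => symbol (d i) (S i) p y.2) y.1)
      ((z.1 : E4), z.2)}

/-- `S 0 = H, S 1, …, S 4` are five functionally independent symmetries of `H` (differential
operators of orders `d i ≤ n` commuting with `H`), so that they make `H` superintegrable of
order `n`; here `5 = 2 · 3 - 1` is the maximal number. -/
structure IsSuperintegrable {U : TopologicalSpace.Opens S3} (n : ℕ) (H : Op U)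
    (d : Fin 5 → ℕ) (S : Fin 5 → Op U) : Prop where
  first : S 0 = H
  order_le : ∀ i, d i ≤ n
  mem_diffOp : ∀ i, S i ∈ diffOp U (d i)
  commute : ∀ i, Commute (S i) H
  independent : SymbolsIndependent d S

/-- The Laplace–Beltrami operator `∑_{j < k} J_{jk}²` of the 3-sphere. -/
def laplaceBeltrami {U : TopologicalSpace.Opens S3} : Op U :=
  J 0 1 ^ 2 + J 0 2 ^ 2 + J 0 3 ^ 2 + J 1 2 ^ 2 + J 1 3 ^ 2 + J 2 3 ^ 2

/-- The system with the 3-parameter potential `b₁ V₁ + b₂ V₂ + b₃ V₃` is semidegenerate: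
it is 2nd order superintegrable for all values of the parameters, the functions `V₁, V₂, V₃` are
functionally independent, and it does not admit six 2nd order symmetries which are linearly
independent modulo constants. -/
structure IsSemidegenerate {U : TopologicalSpace.Opens S3} (V : Fin 3 → Smooth U) : Prop where
  superintegrable : ∀ b : Fin 3 → ℂ, ∃ (d : Fin 5 → ℕ) (S : Fin 5 → Op U),
    IsSuperintegrable 2 (laplaceBeltrami + mulOp (∑ i, b i • V i)) d S
  independent : Dense {p : U | LinearIndependent ℂ fun i => fderiv ℝ (radialExt (V i).1) (p : E4)}
  not_nondegenerate : ¬ ∀ b : Fin 3 → ℂ, ∃ S : Fin 6 → Op U,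
    (∀ i, S i ∈ diffOp U 2 ∧ Commute (S i) (laplaceBeltrami + mulOp (∑ i, b i • V i))) ∧
    LinearIndependent ℂ (Fin.cons 1 S : Fin 7 → Op U)

/-! ### The two systems on the sphere -/

/-- The part of the sphere where `s₁ s₂ ≠ 0`. -/
def region2 : TopologicalSpace.Opens S3 :=
  ⟨{p | (p : E4) 0 ≠ 0 ∧ (p : E4) 1 ≠ 0}, by
    apply IsOpen.inter <;> exact isOpen_ne_fun (by fun_prop) continuous_const⟩

/-- The part of the sphere where `s₁ s₂ s₃ ≠ 0`. -/
def region3 : TopologicalSpace.Opens S3 :=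
  ⟨{p | ((p : E4) 0 ≠ 0 ∧ (p : E4) 1 ≠ 0) ∧ (p : E4) 2 ≠ 0}, by
    apply IsOpen.inter
    · exact region2.isOpen
    · exact isOpen_ne_fun (by fun_prop) continuous_const⟩

theorem region3_le : region3 ≤ region2 := fun _ h => h.1

theorem coord_ne {U : TopologicalSpace.Opens S3} (i : Fin 4)
    (h : ∀ p : U, (p : E4) i ≠ 0) (p : U) : (coord i : Smooth U).1 p ≠ 0 :=
  Complex.ofReal_ne_zero.2 (h p)

/-- The reciprocal of a nowhere vanishing smooth function. -/
def recip {U : TopologicalSpace.Opens S3} (f : Smooth U) (h : ∀ p, f.1 p ≠ 0) : Smooth U :=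
  ⟨fun p => (f.1 p)⁻¹, by
    intro p
    have hf : ContMDiff (𝓡 3) 𝓘(ℝ, ℂ) ∞ f.1 := f.2
    have hi : ContDiffAt ℝ ∞ (fun z : ℂ => z⁻¹) (f.1 p) := contDiffAt_inv ℝ (h p)
    exact ContMDiffAt.comp p hi.contMDiffAt (hf p)⟩

theorem radiusSq_pos {U : TopologicalSpace.Opens S3} (hU : U ≤ region2) (p : U) :
    0 < (p : E4) 0 ^ 2 + (p : E4) 1 ^ 2 + (p : E4) 2 ^ 2 := by
  have h : (p : E4) 0 ≠ 0 := (hU p.2).1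
  positivity

/-- The function `√(s₁² + s₂² + s₃²)`. -/
def radius {U : TopologicalSpace.Opens S3} (hU : U ≤ region2) : Smooth U :=
  ⟨fun p => ((√((p : E4) 0 ^ 2 + (p : E4) 1 ^ 2 + (p : E4) 2 ^ 2) : ℝ) : ℂ), by
    intro p
    have h0 : ContDiff ℝ ∞ (fun x : E4 => x 0 ^ 2 + x 1 ^ 2 + x 2 ^ 2) := by fun_prop
    have h1 : ContDiffAt ℝ ∞
        (fun x : E4 => ((√(x 0 ^ 2 + x 1 ^ 2 + x 2 ^ 2) : ℝ) : ℂ)) (p : E4) :=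
      Complex.ofRealCLM.contDiff.contDiffAt.comp _
        (h0.contDiffAt.sqrt (radiusSq_pos hU p).ne')
    have h2 : ContMDiff (𝓡 3) 𝓘(ℝ, E4) ∞ (fun q : U => (q : E4)) :=
      (contMDiff_coe_sphere (E := E4) (n := 3)).comp contMDiff_subtype_val
    exact ContMDiffAt.comp p h1.contMDiffAt (h2 p)⟩

theorem radius_ne {U : TopologicalSpace.Opens S3} (hU : U ≤ region2) (p : U) :
    (radius hU).1 p ≠ 0 :=
  Complex.ofReal_ne_zero.2 (Real.sqrt_pos.2 (radiusSq_pos hU p)).ne'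

/-- `1 / √(s₁² + s₂² + s₃²)`. -/
def rinv {U : TopologicalSpace.Opens S3} (hU : U ≤ region2) : Smooth U :=
  recip (radius hU) (radius_ne hU)

/-- `1 / s₁`. -/
def inv1 {U : TopologicalSpace.Opens S3} (hU : U ≤ region2) : Smooth U :=
  recip (coord 0) (coord_ne 0 fun p => (hU p.2).1)

/-- `1 / s₂`. -/
def inv2 {U : TopologicalSpace.Opens S3} (hU : U ≤ region2) : Smooth U :=
  recip (coord 1) (coord_ne 1 fun p => (hU p.2).2)

/-- `1 / s₃`. -/
def inv3 {U : TopologicalSpace.Opens S3} (hU : U ≤ region3) : Smooth U :=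
  recip (coord 2) (coord_ne 2 fun p => (hU p.2).2)

/-- The functions `s₄ / √(s₁² + s₂² + s₃²)`, `1 / s₁²`, `1 / s₂²`. -/
def potential3 {U : TopologicalSpace.Opens S3} (hU : U ≤ region2) : Fin 3 → Smooth U :=
  ![coord 3 * rinv hU, inv1 hU ^ 2, inv2 hU ^ 2]

/-- `H_coulsphere = Δ_S + b₁ s₄ / √(s₁² + s₂² + s₃²) + b₂ / s₁² + b₃ / s₂² + b₄`, where
`b₁, …, b₄` are `b 0, …, b 3`. -/
def Hcoul {U : TopologicalSpace.Opens S3} (hU : U ≤ region2) (b : Fin 4 → ℂ) : Op U :=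
  laplaceBeltrami + mulOp (b 0 • (coord 3 * rinv hU) + b 1 • inv1 hU ^ 2 + b 2 • inv2 hU ^ 2 +
    b 3 • 1)

/-- `J₁₂² + b₃ s₁² / s₂² + b₂ s₂² / s₁²`. -/
def Lc12 {U : TopologicalSpace.Opens S3} (hU : U ≤ region2) (b : Fin 4 → ℂ) : Op U :=
  J 0 1 ^ 2 + mulOp (b 2 • (coord 0 ^ 2 * inv2 hU ^ 2) + b 1 • (coord 1 ^ 2 * inv1 hU ^ 2))

/-- `J₁₃² + b₂ s₃² / s₁²`. -/
def Lc13 {U : TopologicalSpace.Opens S3} (hU : U ≤ region2) (b : Fin 4 → ℂ) : Op U :=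
  J 0 2 ^ 2 + mulOp (b 1 • (coord 2 ^ 2 * inv1 hU ^ 2))

/-- `J₂₃² + b₃ s₃² / s₂²`. -/
def Lc23 {U : TopologicalSpace.Opens S3} (hU : U ≤ region2) (b : Fin 4 → ℂ) : Op U :=
  J 1 2 ^ 2 + mulOp (b 2 • (coord 2 ^ 2 * inv2 hU ^ 2))

/-- `{J₁₃, J₄₁} + {J₂₃, J₄₂} - b₁ s₃ / √(s₁² + s₂² + s₃²) - 2 s₃ s₄ (b₂ / s₁² + b₃ / s₂²)`. -/
def Lc {U : TopologicalSpace.Opens S3} (hU : U ≤ region2) (b : Fin 4 → ℂ) : Op U :=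
  symm (J 0 2) (J 3 0) + symm (J 1 2) (J 3 1) -
    mulOp (b 0 • (coord 2 * rinv hU)) -
    mulOp ((2 : ℂ) • (coord 2 * coord 3 * (b 1 • inv1 hU ^ 2 + b 2 • inv2 hU ^ 2)))

/-- `H'_coulsphere = Δ_S + a₀ s₄ / √(s₁² + s₂² + s₃²) + a₁ / s₁² + a₂ / s₂² + a₃ / s₃² + a₄`. -/
def Hext {U : TopologicalSpace.Opens S3} (hU : U ≤ region3) (a : Fin 5 → ℂ) : Op U :=
  laplaceBeltrami + mulOp (a 0 • (coord 3 * rinv (hU.trans region3_le)) +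
    a 1 • inv1 (hU.trans region3_le) ^ 2 + a 2 • inv2 (hU.trans region3_le) ^ 2 +
    a 3 • inv3 hU ^ 2 + a 4 • 1)

/-- `L₁₂ = J₁₂² + a₂ s₁² / s₂² + a₁ s₂² / s₁²`. -/
def L12 {U : TopologicalSpace.Opens S3} (hU : U ≤ region3) (a : Fin 5 → ℂ) : Op U :=
  J 0 1 ^ 2 + mulOp (a 2 • (coord 0 ^ 2 * inv2 (hU.trans region3_le) ^ 2) +
    a 1 • (coord 1 ^ 2 * inv1 (hU.trans region3_le) ^ 2))

/-- `L₁₃ = J₁₃² + a₁ s₃² / s₁² + a₃ s₁² / s₃²`. -/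
def L13 {U : TopologicalSpace.Opens S3} (hU : U ≤ region3) (a : Fin 5 → ℂ) : Op U :=
  J 0 2 ^ 2 + mulOp (a 1 • (coord 2 ^ 2 * inv1 (hU.trans region3_le) ^ 2) +
    a 3 • (coord 0 ^ 2 * inv3 hU ^ 2))

/-- `L₂₃ = J₂₃² + a₂ s₃² / s₂² + a₃ s₂² / s₃²`. -/
def L23 {U : TopologicalSpace.Opens S3} (hU : U ≤ region3) (a : Fin 5 → ℂ) : Op U :=
  J 1 2 ^ 2 + mulOp (a 2 • (coord 2 ^ 2 * inv2 (hU.trans region3_le) ^ 2) +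
    a 3 • (coord 1 ^ 2 * inv3 hU ^ 2))

/-- `M₁ = ½({J₂₃, J₄₂} + {J₁₃, J₄₁}) - (a₀/2) s₃ / √(s₁² + s₂² + s₃²) - a₁ s₃ s₄ / s₁²
- a₂ s₃ s₄ / s₂² - a₃ s₄ / s₃`. -/
def M1 {U : TopologicalSpace.Opens S3} (hU : U ≤ region3) (a : Fin 5 → ℂ) : Op U :=
  (1 / 2 : ℂ) • (symm (U := U) (J 1 2) (J 3 1) + symm (J 0 2) (J 3 0)) -
    mulOp ((a 0 / 2) • (coord 2 * rinv (hU.trans region3_le)) +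
      a 1 • (coord 2 * coord 3 * inv1 (hU.trans region3_le) ^ 2) +
      a 2 • (coord 2 * coord 3 * inv2 (hU.trans region3_le) ^ 2) +
      a 3 • (coord 3 * inv3 hU))

/-- `M₃ = ½({J₂₁, J₄₂} + {J₃₁, J₄₃}) - (a₀/2) s₁ / √(s₁² + s₂² + s₃²) - a₃ s₁ s₄ / s₃²
- a₂ s₁ s₄ / s₂² - a₁ s₄ / s₁`. -/
def M3 {U : TopologicalSpace.Opens S3} (hU : U ≤ region3) (a : Fin 5 → ℂ) : Op U :=
  (1 / 2 : ℂ) • (symm (U := U) (J 1 0) (J 3 1) + symm (J 2 0) (J 3 2)) -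
    mulOp ((a 0 / 2) • (coord 0 * rinv (hU.trans region3_le)) +
      a 3 • (coord 0 * coord 3 * inv3 hU ^ 2) +
      a 2 • (coord 0 * coord 3 * inv2 (hU.trans region3_le) ^ 2) +
      a 1 • (coord 3 * inv1 (hU.trans region3_le)))

/-- `X = {s₁, J₄₁} + {s₂, J₄₂} + {s₃, J₄₃}`. -/
def X {U : TopologicalSpace.Opens S3} : Op U :=
  symm (mulOp (coord 0)) (J 3 0) + symm (mulOp (coord 1)) (J 3 1) +
    symm (mulOp (coord 2)) (J 3 2)

/-- `K₁ = -4 M₁² - ½{X², a₃ / s₃²} + a₃ (5 - 7 (s₁² + s₂²)) / s₃²`. -/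
def K1 {U : TopologicalSpace.Opens S3} (hU : U ≤ region3) (a : Fin 5 → ℂ) : Op U :=
  -((4 : ℂ) • M1 hU a ^ 2) - (1 / 2 : ℂ) • symm (U := U) (X ^ 2) (mulOp (a 3 • inv3 hU ^ 2)) +
    mulOp (a 3 • ((5 - 7 * (coord 0 ^ 2 + coord 1 ^ 2)) * inv3 hU ^ 2))

/-- `K₃ = -4 M₃² - ½{X², a₁ / s₁²} + a₁ (5 - 7 (s₃² + s₂²)) / s₁²`. -/
def K3 {U : TopologicalSpace.Opens S3} (hU : U ≤ region3) (a : Fin 5 → ℂ) : Op U :=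
  -((4 : ℂ) • M3 hU a ^ 2) -
    (1 / 2 : ℂ) • symm (U := U) (X ^ 2) (mulOp (a 1 • inv1 (hU.trans region3_le) ^ 2)) +
    mulOp (a 1 • ((5 - 7 * (coord 2 ^ 2 + coord 1 ^ 2)) * inv1 (hU.trans region3_le) ^ 2))

/-! ### The flat system and the Stäckel transform -/

/-- `4 / (r² + 1)²` with `r² = x² + y² + z²`. -/
def confFactor (x : E3) : ℝ := 4 / (‖x‖ ^ 2 + 1) ^ 2

/-- `H'_flat = ∂_x² + ∂_y² + ∂_z² + 2 a₀ (1 - r²) / (r (r² + 1)²) + a₁ / x² + a₂ / y² + a₃ / z²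
+ 4 a₄ / (r² + 1)²`, acting on functions on `ℝ³`. -/
def Hflat (a : Fin 5 → ℂ) (g : E3 → ℂ) (x : E3) : ℂ :=
  (Δ g) x + (2 * a 0 * ((1 - ‖x‖ ^ 2) / (‖x‖ * (‖x‖ ^ 2 + 1) ^ 2) : ℝ) +
    a 1 / (x 0 : ℂ) ^ 2 + a 2 / (x 1 : ℂ) ^ 2 + a 3 / (x 2 : ℂ) ^ 2 +
    a 4 * (confFactor x : ℂ)) * g x

/-- The conformal Stäckel transform of an operator `H` on `ℝ³` by a positive function `u`, in
self-adjoint form: `u^{-1/4} (u^{-1} H) u^{1/4}`. -/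
def stackel (u : E3 → ℝ) (H : (E3 → ℂ) → E3 → ℂ) (g : E3 → ℂ) (x : E3) : ℂ :=
  ((u x ^ (-(1 / 4) : ℝ) : ℝ) : ℂ) * (((u x)⁻¹ : ℝ) : ℂ) *
    H (fun y => ((u y ^ (1 / 4 : ℝ) : ℝ) : ℂ) * g y) x

/-- The vector `(2x, 2y, 2z, 1 - r²) / (r² + 1)`. -/
def stereoVec (x : E3) : E4 :=
  (‖x‖ ^ 2 + 1)⁻¹ • !₂[2 * x 0, 2 * x 1, 2 * x 2, 1 - ‖x‖ ^ 2]

theorem stereoVec_mem (x : E3) : stereoVec x ∈ Metric.sphere (0 : E4) 1 := by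
  have h : ‖x‖ ^ 2 = x 0 ^ 2 + x 1 ^ 2 + x 2 ^ 2 := by
    rw [EuclideanSpace.real_norm_sq_eq, Fin.sum_univ_three]
  have hp : 0 < ‖x‖ ^ 2 + 1 := by positivity
  rw [mem_sphere_zero_iff_norm, ← sq_eq_sq₀ (norm_nonneg _) zero_le_one,
    EuclideanSpace.real_norm_sq_eq, Fin.sum_univ_four]
  simp [stereoVec]
  field_simp
  rw [h]
  ring

/-- The parametrization `s₁ = 2x/(r²+1)`, `s₂ = 2y/(r²+1)`, `s₃ = 2z/(r²+1)`,
`s₄ = (1-r²)/(r²+1)` of the sphere (without the point `s₄ = -1`) by `ℝ³`. -/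
def stereo (x : E3) : S3 := ⟨stereoVec x, stereoVec_mem x⟩

/-- The inverse `x = s₁/(1+s₄)`, `y = s₂/(1+s₄)`, `z = s₃/(1+s₄)`. -/
def stereoInv (s : S3) : E3 :=
  (1 + (s : E4) 3)⁻¹ • !₂[(s : E4) 0, (s : E4) 1, (s : E4) 2]

open Classical in
/-- A function on `U ⊆ S³` in the coordinates `x, y, z` (zero off the image of `U`). -/
def pullback {U : TopologicalSpace.Opens S3} (f : Smooth U) (x : E3) : ℂ :=
  if h : stereo x ∈ U then f.1 ⟨stereo x, h⟩ else 0

end CoulombSphere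

end

open CoulombSphere

noncomputable section

namespace CoulombSphere

/-! ### Radial extensions and their homogeneity. -/

variable {U : TopologicalSpace.Opens S3}

/-! All computations use the tangential gradients `E i` of the coordinates. They satisfy E_i s_j =
δ_ij - s_i s_j, ∑ s_i E_i = 0 and [E_i, E_j] = s_i E_j - s_j E_i, while J_jk = s_j E_k - s_k E_j and
Δ_S = ∑ E_i². Commutation of operators thus becomes algebra in a `GradientCalculus`. The Lean index
3 is the coordinate s₄.

Symmetries. If A commutes with Δ and [A, V] = [Δ, W], then A + W commutes with Δ + V
(`BracketEq.commute`). The condition is linear in (V, W), so each term of the potential is treated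
alone. This settles the operators built on J₁₂², J₁₃², J₂₃² and the Laplace-Runge-Lenz operator of
the Coulomb system. A pole α/s_c² in the distinguished direction c of a Laplace-Runge-Lenz operator
L leaves a defect: [H, L] = -4α s_c⁻³ E_4. Hence [H, -L²] = 4α (s_c⁻³ E_4 L + L s_c⁻³ E_4), and the
terms with X² in K₁ and K₃ are what cancels it (`quartic_commute`, `quartic_symmetry`).

Functional independence. Two directions in phase space annihilate the symbols of J₁₂, J₁₃, J₂₃. A
2×2 Jacobian of the Hamiltonian and the Laplace-Runge-Lenz symbol therefore splits off, and the
three angular momenta are handled separately (`linearIndependent_symbols`). Regularity is the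
nonvanishing of polynomials in the covector, hence dense (`dense_regular`).

All symmetries of order two. Iterated commutators with coordinates turn [S, H] = 0 into the Killing
equations for the leading coefficients. Extended to the cone with the right degree of homogeneity
these are the flat equations, whose solutions are polynomials (`exists_isKilling`,
`exists_killing_vector`). So S is a quadratic expression in rotations plus a rotation plus a
function g (`exists_symmetry_form`), and 2 E_i g = ∑ k_ia E_a V must be integrable. The
integrability condition, cleared of denominators, is homogeneous and analytic in the coordinates and
the radius. It therefore continues from the cone over U to a half space that meets the hyperplanes
x₁ = 0 and x₂ = 0 (`obsC_symm`). There a single polar term survives and kills most components of the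
Killing tensor; what remains is determined by four components, or five if there is no pole at s₃ = 0
(`IsKilling.eq_zero_of_obsC`). The known symmetries realize all values of these components, so
subtracting a combination of them leaves a constant (`mem_of_tens_eq`). Semidegeneracy follows by
counting dimensions.

Stäckel equivalence. Stereographic projection is conformal with factor u, and the Laplacian of
u^{1/4} (f ∘ σ) is computed from second partial derivatives (`laplacian_confFactor_mul_pullback`).
The result is Δ_S - 3/4 up to the factor u^{5/4}, which accounts for the shift of the last
parameter. -/

theorem smul_mem_cone {x : E4} (hx : x ∈ cone U) {c : ℝ} (hc : 0 < c) : c • x ∈ cone U := by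
  obtain ⟨p, hp⟩ := hx
  refine ⟨p, ?_⟩
  rw [hp, norm_smul, smul_smul, Real.norm_of_nonneg hc.le, mul_inv_rev, mul_assoc,
    inv_mul_cancel₀ hc.ne', mul_one]

theorem coe_mem_cone (p : U) : (p : E4) ∈ cone U := ⟨p, coe_eq p⟩

theorem radialExt_smul_arg (f : U → ℂ) {c : ℝ} (hc : 0 < c) (x : E4) :
    radialExt f (c • x) = radialExt f x := by
  have e : ‖c • x‖⁻¹ • (c • x) = ‖x‖⁻¹ • x := by
    rw [norm_smul, smul_smul, Real.norm_of_nonneg hc.le, mul_inv_rev, mul_assoc,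
      inv_mul_cancel₀ hc.ne', mul_one]
  by_cases h : ∃ p : U, (p : E4) = ‖x‖⁻¹ • x
  · obtain ⟨p, hp⟩ := h
    rw [radialExt_eq f p _ hp, radialExt_eq f p _ (hp.trans e.symm)]
  · have h' : ¬ ∃ p : U, (p : E4) = ‖c • x‖⁻¹ • (c • x) := by rwa [e]
    simp only [radialExt, dif_neg h, dif_neg h']

/-- The point of `U` below a point of the cone. -/
def conePoint {x : E4} (hx : x ∈ cone U) : U := hx.choose

theorem conePoint_eq {x : E4} (hx : x ∈ cone U) : (conePoint hx : E4) = ‖x‖⁻¹ • x :=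
  hx.choose_spec

theorem norm_smul_conePoint {x : E4} (hx : x ∈ cone U) : ‖x‖ • (conePoint hx : E4) = x := by
  rw [conePoint_eq, smul_smul, mul_inv_cancel₀ (norm_ne_zero_iff.2 (ne_zero_of_mem_cone hx)),
    one_smul]

theorem radialExt_eq_conePoint (f : U → ℂ) {x : E4} (hx : x ∈ cone U) :
    radialExt f x = f (conePoint hx) := radialExt_eq f _ x (conePoint_eq hx)

theorem contDiffAt_radialExt (f : Smooth U) {x : E4} (hx : x ∈ cone U) :
    ContDiffAt ℝ ∞ (radialExt f.1) x :=
  ((mem_Smooth_iff f.1).1 f.2).contDiffAt ((isOpen_cone U).mem_nhds hx)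

theorem differentiableAt_radialExt' (f : Smooth U) {x : E4} (hx : x ∈ cone U) :
    DifferentiableAt ℝ (radialExt f.1) x :=
  (contDiffAt_radialExt f hx).differentiableAt (by simp)

/-- The basis vectors of `ℝ⁴`. -/
abbrev ev (i : Fin 4) : E4 := EuclideanSpace.single i (1 : ℝ)

/-- The derivative of the radial extension is homogeneous of degree `-1`. -/
theorem fderiv_radialExt_smul (f : U → ℂ) {c : ℝ} (hc : 0 < c) (x v : E4) :
    fderiv ℝ (radialExt f) (c • x) v = c⁻¹ • fderiv ℝ (radialExt f) x v := by
  have h1 : (fun y => radialExt f (c • y)) = radialExt f :=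
    funext fun y => radialExt_smul_arg f hc y
  have h2 := fderiv_comp_smul (𝕜 := ℝ) (f := radialExt f) (x := x) c
  rw [h1] at h2
  rw [h2, smul_apply, smul_smul, inv_mul_cancel₀ hc.ne', one_smul]

/-- The extension is constant along the ray through `x`: Euler's identity in degree 0. -/
theorem fderiv_radialExt_self (f : Smooth U) {x : E4} (hx : x ∈ cone U) :
    fderiv ℝ (radialExt f.1) x x = 0 := by
  have h1 : HasDerivAt (fun t : ℝ => radialExt f.1 (t • x)) (fderiv ℝ (radialExt f.1) x x) 1 := by
    have hd : HasFDerivAt (radialExt f.1) (fderiv ℝ (radialExt f.1) x) ((1 : ℝ) • x) := by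
      rw [one_smul]; exact (differentiableAt_radialExt' f hx).hasFDerivAt
    have hl : HasDerivAt (fun t : ℝ => t • x) x 1 := by
      simpa using (hasDerivAt_id (1 : ℝ)).smul_const x
    exact hd.comp_hasDerivAt 1 hl
  have h2 : HasDerivAt (fun t : ℝ => radialExt f.1 (t • x)) 0 1 := by
    refine (hasDerivAt_const 1 (radialExt f.1 x)).congr_of_eventuallyEq ?_
    filter_upwards [lt_mem_nhds (zero_lt_one' ℝ)] with t ht
    exact radialExt_smul_arg f.1 ht x
  exact h1.unique h2

theorem eq_sum_ev (x : E4) : x = ∑ i, x i • ev i := by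
  ext j
  simp [Fin.sum_univ_four]
  fin_cases j <;> simp

theorem fderiv_euler (f : Smooth U) {x : E4} (hx : x ∈ cone U) :
    ∑ i, (x i : ℂ) * fderiv ℝ (radialExt f.1) x (ev i) = 0 := by
  have h := fderiv_radialExt_self f hx
  conv at h => lhs; rhs; rw [eq_sum_ev x]
  rw [map_sum] at h
  simpa using h

theorem J_apply (j k : Fin 4) (f : Smooth U) (p : U) :
    (J j k f).1 p = ((p : E4) j : ℂ) * fderiv ℝ (radialExt f.1) p (ev k) -
      ((p : E4) k : ℂ) * fderiv ℝ (radialExt f.1) p (ev j) := by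
  change fderiv ℝ (radialExt f.1) (p : E4) (rotVec j k p) = _
  simp [rotVec]

/-! ### Gradient fields of the coordinates and their relations. -/

/-- The gradient field of the coordinate function `s_i`. -/
def E (i : Fin 4) : Op U := ∑ j, mulOp (coord j) * J j i

theorem coord_apply (i : Fin 4) (p : U) : (coord i : Smooth U).1 p = ((p : E4) i : ℂ) := rfl

theorem sum_sq (p : U) : ((p : E4) 0 : ℂ) ^ 2 + ((p : E4) 1 : ℂ) ^ 2 + ((p : E4) 2 : ℂ) ^ 2 +
    ((p : E4) 3 : ℂ) ^ 2 = 1 := by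
  have h : ‖(p : E4)‖ ^ 2 = 1 := by rw [norm_coe]; norm_num
  rw [EuclideanSpace.real_norm_sq_eq, Fin.sum_univ_four] at h
  exact_mod_cast h

theorem mulOp_apply (f g : Smooth U) : mulOp f g = f * g := rfl

/-- In ∑ s_j (s_j ∂_i - s_i ∂_j) the second sum vanishes by Euler's identity and ∑ s_j² = 1 on the
sphere. So the gradient field is simply the ambient partial derivative of the radial extension. -/
theorem E_apply (i : Fin 4) (f : Smooth U) (p : U) :
    (E i f).1 p = fderiv ℝ (radialExt f.1) p (ev i) := by
  have h1 := fderiv_euler f (coe_mem_cone p)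
  have h2 := sum_sq p
  have h3 : (E i f).1 p = ∑ j, ((p : E4) j : ℂ) * (J j i f).1 p := by
    simp [E, Fin.sum_univ_four, mulOp_apply]; rfl
  rw [h3]
  simp only [J_apply, Fin.sum_univ_four] at *
  linear_combination (fderiv ℝ (radialExt f.1) p (ev i)) * h2 - ((p : E4) i : ℂ) * h1

theorem J_eq (j k : Fin 4) (f : Smooth U) : J j k f = coord j * E k f - coord k * E j f := by
  apply Subtype.ext; funext p
  rw [J_apply]
  change _ = (coord j).1 p * (E k f).1 p - (coord k).1 p * (E j f).1 p
  simp only [E_apply, coord_apply]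

theorem sum_coord_sq : ∑ i, (coord i : Smooth U) ^ 2 = 1 := by
  apply Subtype.ext; funext p
  simp only [Fin.sum_univ_four]
  exact sum_sq p

theorem sum_coord_mul_E (f : Smooth U) : ∑ i, coord i * E i f = 0 := by
  apply Subtype.ext; funext p
  have h1 := fderiv_euler f (coe_mem_cone p)
  simp only [Fin.sum_univ_four] at *
  simp only [← E_apply] at h1
  exact h1

theorem radialExt_mul (f g : U → ℂ) : radialExt (f * g) = radialExt f * radialExt g := by
  funext x
  by_cases h : ∃ p : U, (p : E4) = ‖x‖⁻¹ • x <;> simp [radialExt, h]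

theorem E_mul (i : Fin 4) (f g : Smooth U) : E i (f * g) = f * E i g + g * E i f := by
  apply Subtype.ext; funext p
  change _ = f.1 p * (E i g).1 p + g.1 p * (E i f).1 p
  simp only [E_apply]
  change fderiv ℝ (radialExt (f.1 * g.1)) p _ = _
  rw [radialExt_mul, fderiv_mul (differentiableAt_radialExt f.2 p)
    (differentiableAt_radialExt g.2 p)]
  simp [radialExt_coe]

/-- `E i` as a derivation. -/
def derE (i : Fin 4) : Derivation ℂ (Smooth U) (Smooth U) :=
  Derivation.mk' (E i) fun f g => by simpa using E_mul i f g

theorem radialExt_E (i : Fin 4) (f : Smooth U) {x : E4} (hx : x ∈ cone U) :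
    radialExt (E i f).1 x = (‖x‖ : ℂ) * fderiv ℝ (radialExt f.1) x (ev i) := by
  have h0 : 0 < ‖x‖ := norm_pos_iff.2 (ne_zero_of_mem_cone hx)
  rw [radialExt_eq_conePoint _ hx, E_apply, conePoint_eq, fderiv_radialExt_smul _ (inv_pos.2 h0)]
  simp

theorem hasFDerivAt_norm_coe (p : U) :
    HasFDerivAt (fun x : E4 => (‖x‖ : ℂ))
      (Complex.ofRealCLM.comp (innerSL ℝ (p : E4))) (p : E4) := by
  have hp : (p : E4) ≠ 0 := ne_zero_of_mem_cone (coe_mem_cone p)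
  have h := (hasStrictFDerivAt_norm_sq (p : E4)).hasFDerivAt.sqrt
    (by simp)
  have h2 : (fun y : E4 => √(‖y‖ ^ 2)) = fun y => ‖y‖ := by
    funext y; exact Real.sqrt_sq (norm_nonneg y)
  rw [h2, norm_coe] at h
  refine (Complex.ofRealCLM.hasFDerivAt.comp _ h).congr_fderiv ?_
  ext v
  simp

theorem differentiableAt_fderiv_radialExt (f : Smooth U) {x : E4} (hx : x ∈ cone U) :
    DifferentiableAt ℝ (fderiv ℝ (radialExt f.1)) x :=
  ((contDiffAt_radialExt f hx).fderiv_right (m := 1) (by norm_cast)).differentiableAt (by simp)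

/-- The partial derivative of a function of degree 0 has degree -1, so its values on the sphere
extend radially as ‖x‖ ∂_j f. Differentiating the factor ‖x‖ gives the extra term. The Hessian being
symmetric, this term is the whole commutator in `E_comm`. -/
theorem E_E_apply (i j : Fin 4) (f : Smooth U) (p : U) :
    (E i (E j f)).1 p = ((p : E4) i : ℂ) * (E j f).1 p +
      fderiv ℝ (fderiv ℝ (radialExt f.1)) p (ev i) (ev j) := by
  rw [E_apply]
  have h : radialExt (E j f).1 =ᶠ[nhds (p : E4)]
      fun x => (‖x‖ : ℂ) * fderiv ℝ (radialExt f.1) x (ev j) := by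
    filter_upwards [(isOpen_cone U).mem_nhds (coe_mem_cone p)] with x hx
    exact radialExt_E j f hx
  have hd := differentiableAt_fderiv_radialExt f (coe_mem_cone p)
  have hd2 : HasFDerivAt (fun x => fderiv ℝ (radialExt f.1) x (ev j))
      ((fderiv ℝ (fderiv ℝ (radialExt f.1)) p).flip (ev j)) (p : E4) :=
    ((ContinuousLinearMap.apply ℝ ℂ (ev j)).hasFDerivAt.comp _ hd.hasFDerivAt).congr_fderiv rfl
  rw [h.fderiv_eq, ((hasFDerivAt_norm_coe p).fun_mul hd2).fderiv, E_apply]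
  simp [EuclideanSpace.inner_single_right]
  ring

theorem E_comm (i j : Fin 4) (f : Smooth U) :
    E i (E j f) = E j (E i f) + coord i * E j f - coord j * E i f := by
  apply Subtype.ext; funext p
  change _ = (E j (E i f)).1 p + (coord i).1 p * (E j f).1 p - (coord j).1 p * (E i f).1 p
  have hs : IsSymmSndFDerivAt ℝ (radialExt f.1) (p : E4) :=
    (contDiffAt_radialExt f (coe_mem_cone p)).isSymmSndFDerivAt
      (by
        simp only [minSmoothness_of_isRCLikeNormedField]
        exact WithTop.coe_le_coe.2 (OrderTop.le_top (2 : ℕ∞)))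
  rw [E_E_apply, E_E_apply, hs (ev i) (ev j)]
  simp only [coord_apply]
  ring

theorem radialExt_coord (i : Fin 4) {x : E4} (hx : x ∈ cone U) :
    radialExt (coord i : Smooth U).1 x = (‖x‖ : ℂ)⁻¹ * (x i : ℂ) := by
  rw [radialExt_eq_conePoint _ hx, coord_apply, conePoint_eq]
  simp

/-- Near the sphere ‖x‖ times the radial extension of s_j is the linear function x_j; compare the
derivatives of both at a point of norm 1. -/
theorem E_coord (i j : Fin 4) :
    E i (coord j : Smooth U) = (if i = j then 1 else 0) - coord i * coord j := by
  apply Subtype.ext; funext p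
  have h : (fun x => (‖x‖ : ℂ) * radialExt (coord j : Smooth U).1 x) =ᶠ[nhds (p : E4)]
      fun x => (x j : ℂ) := by
    filter_upwards [(isOpen_cone U).mem_nhds (coe_mem_cone p)] with x hx
    have : (‖x‖ : ℂ) ≠ 0 := by simpa using ne_zero_of_mem_cone hx
    rw [radialExt_coord j hx, mul_inv_cancel_left₀ this]
  have h1 : HasFDerivAt (fun x : E4 => (x j : ℂ))
      (Complex.ofRealCLM.comp (EuclideanSpace.proj j : E4 →L[ℝ] ℝ)) (p : E4) :=
    (Complex.ofRealCLM.comp (EuclideanSpace.proj j : E4 →L[ℝ] ℝ)).hasFDerivAt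
  have h2 := h.fderiv_eq (𝕜 := ℝ)
  rw [h1.fderiv, ((hasFDerivAt_norm_coe p).fun_mul
    (differentiableAt_radialExt (coord j : Smooth U).2 p).hasFDerivAt).fderiv] at h2
  have h3 := DFunLike.congr_fun h2 (ev i)
  simp [EuclideanSpace.inner_single_right, radialExt_coe, ← E_apply] at h3
  change _ = ((if i = j then 1 else 0 : Smooth U)).1 p - (coord i).1 p * (coord j).1 p
  rw [coord_apply] at h3 ⊢
  have h4 : ((if i = j then 1 else 0 : Smooth U)).1 p = if i = j then 1 else 0 := by
    split_ifs <;> rfl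
  rw [h4, coord_apply]
  have h5 : (((if j = i then 1 else 0 : ℝ)) : ℂ) = if i = j then 1 else 0 := by
    by_cases hij : i = j
    · simp [hij]
    · simp [hij, Ne.symm hij]
  rw [h5] at h3
  linear_combination h3

theorem E_of_mul_eq_one (i : Fin 4) {s t : Smooth U} (h : s * t = 1) :
    E i t = -(t ^ 2 * E i s) := by
  have h1 := E_mul i s t
  have h0 : E i (1 : Smooth U) = 0 := (derE i).map_one_eq_zero
  rw [h, h0] at h1
  linear_combination (-t) * h1 - (E i t) * h

theorem mul_recip (f : Smooth U) (h : ∀ p, f.1 p ≠ 0) : f * recip f h = 1 := by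
  apply Subtype.ext; funext p
  exact mul_inv_cancel₀ (h p)

theorem coord0_mul_inv1 (hU : U ≤ region2) : coord 0 * inv1 hU = 1 := mul_recip _ _
theorem coord1_mul_inv2 (hU : U ≤ region2) : coord 1 * inv2 hU = 1 := mul_recip _ _
theorem coord2_mul_inv3 (hU : U ≤ region3) : coord 2 * inv3 hU = 1 := mul_recip _ _
theorem radius_mul_rinv (hU : U ≤ region2) : radius hU * rinv hU = 1 := mul_recip _ _

theorem rinv_sq (hU : U ≤ region2) : (1 - coord 3 ^ 2) * rinv hU ^ 2 = 1 := by
  have h1 := radius_mul_rinv hU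
  have h2 : radius hU ^ 2 = coord 0 ^ 2 + coord 1 ^ 2 + coord 2 ^ 2 := by
    apply Subtype.ext; funext p
    have := Real.sq_sqrt (radiusSq_pos hU p).le
    change ((√((p : E4) 0 ^ 2 + (p : E4) 1 ^ 2 + (p : E4) 2 ^ 2) : ℝ) : ℂ) ^ 2 =
      ((p : E4) 0 : ℂ) ^ 2 + ((p : E4) 1 : ℂ) ^ 2 + ((p : E4) 2 : ℂ) ^ 2
    exact_mod_cast this
  have h3 := sum_coord_sq (U := U)
  rw [Fin.sum_univ_four] at h3
  linear_combination (radius hU * rinv hU + 1) * h1 - rinv hU ^ 2 * h2 - rinv hU ^ 2 * h3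

/-- `E_i (1 / ρ)` for `ρ = √(1 - s₄²)`. -/
theorem E_rinv (hU : U ≤ region2) (i : Fin 4) :
    E i (rinv hU) = coord 3 * rinv hU ^ 3 * E i (coord 3) := by
  have h := rinv_sq hU
  have h0 : E i (1 : Smooth U) = 0 := (derE i).map_one_eq_zero
  have h1 := congrArg (E i) h
  simp only [pow_two, E_mul, map_sub, h0] at h1
  have h2 : (2 : Smooth U) * (E i (rinv hU) - coord 3 * rinv hU ^ 3 * E i (coord 3)) = 0 := by
    linear_combination rinv hU * h1 - 2 * E i (rinv hU) * h
  have h3 : ((2 : ℂ)⁻¹ • (2 : Smooth U)) = 1 := by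
    apply Subtype.ext; funext p
    change (2 : ℂ)⁻¹ * 2 = 1
    norm_num
  have h4 := congrArg (fun y => (2 : ℂ)⁻¹ • y) h2
  simp only [smul_zero, ← smul_mul_assoc, h3, one_mul] at h4
  exact sub_eq_zero.1 h4

/-! ### Rotations and the Laplacian in the abstract gradient calculus. -/

/-- The gradient fields `E_i` of the coordinates `s_i` of the unit 3-sphere, acting on an algebra
of functions. -/
structure GradientCalculus (C : Type*) [CommRing C] [Algebra ℂ C] where
  /-- the gradient fields -/
  E : Fin 4 → Derivation ℂ C C
  /-- the coordinates -/
  s : Fin 4 → C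
  E_s : ∀ i j, E i (s j) = (if i = j then 1 else 0) - s i * s j
  sum_sq : s 0 ^ 2 + s 1 ^ 2 + s 2 ^ 2 + s 3 ^ 2 = 1
  sum_E : ∀ f, s 0 * E 0 f + s 1 * E 1 f + s 2 * E 2 f + s 3 * E 3 f = 0
  comm : ∀ i j f, E i (E j f) = E j (E i f) + s i * E j f - s j * E i f

namespace GradientCalculus

variable {C : Type*} [CommRing C] [Algebra ℂ C] (G : GradientCalculus C)

theorem E_mul (i : Fin 4) (f g : C) : G.E i (f * g) = f * G.E i g + g * G.E i f := by
  simp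

/-- The rotation generators. -/
def rot (j k : Fin 4) (f : C) : C := G.s j * G.E k f - G.s k * G.E j f

/-- The Laplacian. -/
def lap (f : C) : C :=
  G.E 0 (G.E 0 f) + G.E 1 (G.E 1 f) + G.E 2 (G.E 2 f) + G.E 3 (G.E 3 f)

theorem lap_add (f g : C) : G.lap (f + g) = G.lap f + G.lap g := by
  simp only [lap, map_add]; ring

theorem lap_sub (f g : C) : G.lap (f - g) = G.lap f - G.lap g := by
  simp only [lap, map_sub]; ring

theorem lap_mul (f g : C) : G.lap (f * g) = f * G.lap g + g * G.lap f +
    2 * (G.E 0 f * G.E 0 g + G.E 1 f * G.E 1 g + G.E 2 f * G.E 2 g + G.E 3 f * G.E 3 g) := by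
  simp only [lap, E_mul, map_add]; ring

theorem sum_E_s (j : Fin 4) (g : C) : G.E 0 (G.s j) * G.E 0 g + G.E 1 (G.s j) * G.E 1 g +
    G.E 2 (G.s j) * G.E 2 g + G.E 3 (G.s j) * G.E 3 g = G.E j g := by
  have h := G.sum_E g
  simp only [E_s]
  fin_cases j
  · simp; linear_combination (-G.s 0) * h
  · simp; linear_combination (-G.s 1) * h
  · simp; linear_combination (-G.s 2) * h
  · simp; linear_combination (-G.s 3) * h

theorem E_s_symm (i j : Fin 4) : G.E i (G.s j) = G.E j (G.s i) := by
  rw [E_s, E_s]; simp only [eq_comm]; ring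

theorem lap_s (j : Fin 4) : G.lap (G.s j) = -3 * G.s j := by
  have h := G.sum_sq
  simp only [lap, E_s, map_sub, E_mul]
  fin_cases j
  · simp; linear_combination (2 * G.s 0) * h
  · simp; linear_combination (2 * G.s 1) * h
  · simp; linear_combination (2 * G.s 2) * h
  · simp; linear_combination (2 * G.s 3) * h

theorem lap_s_mul (j : Fin 4) (f : C) :
    G.lap (G.s j * f) = G.s j * G.lap f - 3 * G.s j * f + 2 * G.E j f := by
  rw [lap_mul, lap_s, sum_E_s]; ring

/-- Commuting E_i past each E_j twice leaves ∑ s_j E_i E_j f, which is removed by differentiating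
the relation ∑ s_j E_j f = 0. -/
theorem lap_E (i : Fin 4) (f : C) :
    G.lap (G.E i f) = G.E i (G.lap f) + G.E i f - 2 * G.s i * G.lap f := by
  have h1 := G.sum_E f
  have h2 := congrArg (G.E i) h1
  have h3 : ∀ j, G.E j (G.E j (G.E i f)) = G.E i (G.E j (G.E j f)) + 2 * G.s j * G.E i (G.E j f)
      + G.E i f - G.s i * G.s j * G.E j f
      - G.E j (G.s i) * G.E j f - 2 * G.s i * G.E j (G.E j f) := by
    intro j
    rw [G.comm j i f, map_sub, map_add, E_mul, E_mul, G.comm j i (G.E j f), G.comm j i f, E_s]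
    simp
    ring
  have h4 := G.sum_E_s i f
  simp only [lap, h3, map_add]
  simp only [map_add, E_mul, map_zero, G.E_s_symm i] at h2
  linear_combination 2 * h2 - 3 * h4 - G.s i * h1

/-- The terms 2 s_j s_k Δ cancel by antisymmetry. The remaining -2 (s_j E_k - s_k E_j) is
compensated by 2 [E_j, E_k]. -/
theorem lap_rot (j k : Fin 4) (f : C) : G.lap (G.rot j k f) = G.rot j k (G.lap f) := by
  simp only [rot, lap_sub, lap_s_mul, lap_E]
  rw [G.comm j k f]; ring

theorem sum_rot_sq (f : C) : G.rot 0 1 (G.rot 0 1 f) + G.rot 0 2 (G.rot 0 2 f) +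
    G.rot 0 3 (G.rot 0 3 f) + G.rot 1 2 (G.rot 1 2 f) + G.rot 1 3 (G.rot 1 3 f) +
    G.rot 2 3 (G.rot 2 3 f) = G.lap f := by
  have hS := G.sum_sq
  have h0 := G.sum_E (G.E 0 f)
  have h1 := G.sum_E (G.E 1 f)
  have h2 := G.sum_E (G.E 2 f)
  have h3 := G.sum_E (G.E 3 f)
  simp only [rot, map_sub, E_mul, E_s, lap]
  simp
  linear_combination (G.E 0 (G.E 0 f) + G.E 1 (G.E 1 f) + G.E 2 (G.E 2 f) + G.E 3 (G.E 3 f)) * hS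
    - G.s 0 * h0 - G.s 1 * h1 - G.s 2 * h2 - G.s 3 * h3 - 3 * G.sum_E f

/-! ### Reciprocals of a coordinate (`t`) and of the radius (`w`). -/

variable {t w : C} {c : Fin 4}

theorem E_inv (ht : G.s c * t = 1) (i : Fin 4) : G.E i t = -(t ^ 2 * G.E i (G.s c)) := by
  have h := congrArg (G.E i) ht
  simp only [E_mul, Derivation.map_one_eq_zero] at h
  linear_combination t * h - G.E i t * ht

theorem norm_grad (j : Fin 4) : G.E 0 (G.s j) * G.E 0 (G.s j) + G.E 1 (G.s j) * G.E 1 (G.s j) +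
    G.E 2 (G.s j) * G.E 2 (G.s j) + G.E 3 (G.s j) * G.E 3 (G.s j) = 1 - G.s j ^ 2 := by
  rw [sum_E_s, E_s]; simp; ring

theorem lap_inv (ht : G.s c * t = 1) : G.lap t = 2 * t ^ 3 + t := by
  have h1 := G.lap_s c
  have h2 := G.norm_grad c
  simp only [lap] at *
  simp only [G.E_inv ht, map_neg, E_mul, pow_two]
  linear_combination (-t ^ 2) * h1 + 2 * t ^ 3 * h2 + (t - 2 * t ^ 2 * G.s c) * ht

theorem lap_inv_mul (ht : G.s c * t = 1) (f : C) :
    G.lap (t * f) = t * G.lap f + (2 * t ^ 3 + t) * f - 2 * t ^ 2 * G.E c f := by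
  have h := G.sum_E_s c f
  rw [lap_mul, G.lap_inv ht]
  simp only [G.E_inv ht]
  linear_combination (-2 * t ^ 2) * h

/-- The two hypotheses are all that is ever used of w = 1/ρ: its square, since ρ² = 1 - s₄², and the
gradient that this forces. -/
theorem lap_w (hw : (1 - G.s 3 ^ 2) * w ^ 2 = 1)
    (hE : ∀ i, G.E i w = G.s 3 * w ^ 3 * G.E i (G.s 3)) : G.lap w = w := by
  have h1 := G.lap_s 3
  have h2 := G.norm_grad 3
  simp only [lap] at *
  simp only [hE, E_mul, pow_succ, pow_zero, one_mul]
  linear_combination (G.s 3 * w ^ 3) * h1 + (w ^ 3 + 3 * G.s 3 ^ 2 * w ^ 5) * h2 +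
    (w + 3 * G.s 3 ^ 2 * w ^ 3) * hw

theorem lap_w_mul (hw : (1 - G.s 3 ^ 2) * w ^ 2 = 1)
    (hE : ∀ i, G.E i w = G.s 3 * w ^ 3 * G.E i (G.s 3)) (f : C) :
    G.lap (w * f) = w * G.lap f + w * f + 2 * G.s 3 * w ^ 3 * G.E 3 f := by
  have h := G.sum_E_s 3 f
  rw [lap_mul, G.lap_w hw hE]
  simp only [hE]
  linear_combination (2 * G.s 3 * w ^ 3) * h

theorem rot_mul (i j : Fin 4) (f g : C) :
    G.rot i j (f * g) = f * G.rot i j g + g * G.rot i j f := by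
  simp only [rot, E_mul]; ring

theorem rot_add (i j : Fin 4) (f g : C) : G.rot i j (f + g) = G.rot i j f + G.rot i j g := by
  simp only [rot, map_add]; ring

theorem rot_inv {i j : Fin 4} (hij : i ≠ j) (ht : G.s i * t = 1) : G.rot i j t = t ^ 2 * G.s j := by
  simp only [rot, G.E_inv ht, E_s, hij.symm]
  simp; ring

theorem rot_s_right {i j : Fin 4} (hij : i ≠ j) : G.rot i j (G.s j) = G.s i := by
  simp only [rot, E_s, hij]; simp; ring

/-- The gradient of s_j²/s_i² is 2 s_j s_i⁻³ (s_i ∇s_j - s_j ∇s_i), so the first order part of [Δ,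
s_j²/s_i²] is the multiple 4 s_j s_i⁻³ of J_ij. That is also the first order part of [J_ij²,
1/s_i²], and the functions agree as well. -/
theorem rot_sq_inv_sq {i j : Fin 4} (hij : i ≠ j) (ht : G.s i * t = 1) (f : C) :
    G.rot i j (G.rot i j (t ^ 2 * f)) - t ^ 2 * G.rot i j (G.rot i j f) =
      G.lap (G.s j ^ 2 * t ^ 2 * f) - G.s j ^ 2 * t ^ 2 * G.lap f := by
  have e1 : G.rot i j (G.rot i j (t ^ 2 * f)) - t ^ 2 * G.rot i j (G.rot i j f) =
      (6 * t ^ 4 * G.s j ^ 2 + 2 * t ^ 2) * f + 4 * t ^ 3 * G.s j * G.rot i j f := by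
    simp only [pow_two, rot_mul, rot_add, G.rot_inv hij ht, G.rot_s_right hij]
    linear_combination (2 * t ^ 2 * f) * ht
  rw [e1]
  simp only [pow_two, mul_assoc, lap_s_mul, G.lap_inv_mul ht, rot, E_mul, E_s, G.E_inv ht]
  simp [hij.symm]
  linear_combination (4 * t ^ 2 * G.s j * G.E j f + t ^ 2 * G.s j ^ 2 * f * (2 * G.s i * t - 6)) * ht

/-! ### Laplace-Runge-Lenz operators in the abstract calculus. -/

/-- `½ ({J_{ic}, J_{4i}} + {J_{jc}, J_{4j}})`. -/
def lrl (c i j : Fin 4) (f : C) : C :=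
  G.rot i c (G.rot 3 i f) + G.rot 3 i (G.rot i c f) +
    (G.rot j c (G.rot 3 j f) + G.rot 3 j (G.rot j c f))

/-- The relation ∑ s_k E_k = 0, applied to f and to its derivatives, eliminates the indices i and j,
so that only c, the index 3 and Δ remain. There is no factor ½ in `lrl`: this is the leading part of
2 M₁ for c = 2 and of 2 M₃ for c = 0. -/
theorem lrl_eq {c i j : Fin 4} (h : (c, i, j) = (2, 1, 0) ∨ (c, i, j) = (0, 1, 2)) (f : C) :
    G.lrl c i j f = -(G.E c (G.E 3 f) + G.E 3 (G.E c f)) - 2 * G.s c * G.s 3 * G.lap f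
      + G.s 3 * G.E c f + G.s c * G.E 3 f := by
  have hS := G.sum_sq
  have h0 := G.sum_E (G.E 0 f)
  have h1 := G.sum_E (G.E 1 f)
  have h2 := G.sum_E (G.E 2 f)
  have h3 := G.sum_E (G.E 3 f)
  have h4 := G.sum_E f
  have d0 := congrArg (G.E 0) h4
  have d2 := congrArg (G.E 2) h4
  have d3 := congrArg (G.E 3) h4
  rcases h with h | h
  all_goals
    simp only [Prod.mk.injEq] at h
    obtain ⟨rfl, rfl, rfl⟩ := h
  · simp only [lrl, rot, map_sub, map_add, E_mul, E_s, lap, map_zero] at *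
    simp at *
    linear_combination G.s 2 * h3 + G.s 3 * h2 + G.s 3 * d2 + G.s 2 * d3 +
      2 * G.s 2 * G.s 3 * h4 - (G.E 2 (G.E 3 f) + G.E 3 (G.E 2 f)) * hS
  · simp only [lrl, rot, map_sub, map_add, E_mul, E_s, lap, map_zero] at *
    simp at *
    linear_combination G.s 0 * h3 + G.s 3 * h0 + G.s 3 * d0 + G.s 0 * d3 +
      2 * G.s 0 * G.s 3 * h4 - (G.E 0 (G.E 3 f) + G.E 3 (G.E 0 f)) * hS

theorem lrl_w {i j : Fin 4} (h : (c, i, j) = (2, 1, 0) ∨ (c, i, j) = (0, 1, 2))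
    (hw : (1 - G.s 3 ^ 2) * w ^ 2 = 1)
    (hE : ∀ i, G.E i w = G.s 3 * w ^ 3 * G.E i (G.s 3)) (f : C) :
    G.lrl c i j (G.s 3 * w * f) - G.s 3 * w * G.lrl c i j f =
      -(G.lap (G.s c * w * f) - G.s c * w * G.lap f) := by
  have hc : c ≠ 3 := by rcases h with h | h <;> simp at h <;> simp [h.1]
  simp only [G.lrl_eq h, mul_assoc, lap_s_mul, G.lap_w_mul hw hE, E_mul, map_add, hE, pow_succ,
    pow_zero, one_mul, E_s]
  simp [E_s, hc, hc.symm]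
  linear_combination (f * G.s c * (6 * G.s 3 ^ 4 * w ^ 3 + 2 * G.s 3 ^ 2 * w) +
    2 * G.s c * G.s 3 * w * G.E 3 f - 2 * G.s 3 ^ 2 * w * G.E c f) * hw

/-- For a pole in a direction other than c the bracket equation is solvable exactly, which is why
these terms are harmless for second order symmetries. -/
theorem lrl_inv_sq {i j k : Fin 4} (h : (c, i, j) = (2, 1, 0) ∨ (c, i, j) = (0, 1, 2))
    (hk : k ≠ 3) (hkc : k ≠ c) (ht : G.s k * t = 1) (f : C) :
    G.lrl c i j (t ^ 2 * f) - t ^ 2 * G.lrl c i j f =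
      -(G.lap (2 * G.s c * G.s 3 * t ^ 2 * f) - 2 * G.s c * G.s 3 * t ^ 2 * G.lap f) := by
  have hc : c ≠ 3 := by rcases h with h | h <;> simp at h <;> simp [h.1]
  have e : ∀ g, G.lap (2 * g) = 2 * G.lap g := fun g => by rw [two_mul, lap_add, two_mul]
  simp only [G.lrl_eq h, mul_assoc, e, lap_s_mul, G.lap_inv_mul ht, E_mul, map_add, map_neg,
    G.E_inv ht, pow_succ, pow_zero, one_mul, E_s]
  simp [E_s, hc, hc.symm, hk.symm, hkc.symm]
  linear_combination (f * t ^ 2 * G.s c * G.s 3 * (16 - 12 * (G.s k * t)) -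
    4 * t ^ 2 * (G.s c * G.E 3 f + G.s 3 * G.E c f)) * ht

/-- For the pole in the direction c itself the bracket equation fails by the first order operator 4
s_c⁻³ E_4. This defect is the source of the quartic symmetries. -/
theorem lrl_inv_sq_self {i j : Fin 4} (h : (c, i, j) = (2, 1, 0) ∨ (c, i, j) = (0, 1, 2))
    (ht : G.s c * t = 1) (f : C) :
    G.lrl c i j (t ^ 2 * f) - t ^ 2 * G.lrl c i j f =
      -(G.lap (2 * G.s 3 * t * f) - 2 * G.s 3 * t * G.lap f) + 4 * t ^ 3 * G.E 3 f := by
  have hc : c ≠ 3 := by rcases h with h | h <;> simp at h <;> simp [h.1]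
  have e : ∀ g, G.lap (2 * g) = 2 * G.lap g := fun g => by rw [two_mul, lap_add, two_mul]
  simp only [G.lrl_eq h, mul_assoc, e, lap_s_mul, G.lap_inv_mul ht, E_mul, map_add, map_neg,
    G.E_inv ht, pow_succ, pow_zero, one_mul, E_s]
  simp [E_s, hc, hc.symm]
  linear_combination (f * t * G.s 3 * (4 + 4 * (G.s c * t) - 8 * (G.s c * t) ^ 2) -
    4 * t * (G.s c * t + 1) * G.E 3 f + 4 * t ^ 2 * G.s 3 * G.E c f) * ht

/-- This is [H, K] = 0 divided by α/2, after [H, L] = -4α t³ E_4 has been inserted. The potential is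
eliminated: it enters only through H and through one function χ, which is known by its derivatives
along E_4 and E_c. What is left is an identity between words in s₄, s_c, t, χ, E_c, E_4 and H,
proved by normal ordering. Coefficients in the hypotheses are written as repeated sums, through
which linear maps distribute. -/
theorem quartic_commute (H L : C →ₗ[ℂ] C) (hc : c ≠ 3) (ht : G.s c * t = 1) {χ χ' : C}
    (hHs : ∀ i f, H (G.s i * f) = G.s i * H f - (G.s i * f + G.s i * f + G.s i * f) +
      (G.E i f + G.E i f))
    (hHt : ∀ f, H (t * f) = t * H f + (t * (t * t) + t * (t * t) + t) * f -
      (t * t * G.E c f + t * t * G.E c f))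
    (hHE : ∀ f, H (G.E 3 f) = G.E 3 (H f) + G.E 3 f - (G.s 3 * H f + G.s 3 * H f) + χ * f)
    (hχ : G.E 3 χ = (1 - G.s 3 * G.s 3) * χ') (hχ2 : G.E c χ = - (G.s c * G.s 3 * χ'))
    (hL : ∀ f, L f = -(G.E c (G.E 3 f) + G.E c (G.E 3 f)) + (G.s c * G.E 3 f + G.s c * G.E 3 f) -
      (G.s c * (G.s 3 * H f) + G.s c * (G.s 3 * H f)) + G.s c * χ * f)
    (X : C →ₗ[ℂ] C)
    (hX : ∀ f, X f = G.s 3 * f + G.s 3 * f + G.s 3 * f - G.E 3 f - G.E 3 f) (f : C) :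
    8 * (L (t * (t * (t * G.E 3 f))) + t * (t * (t * G.E 3 (L f))))
      - (H (X (X (t * (t * f)))) - X (X (t * (t * H f))))
      - (H (t * (t * X (X f))) - t * (t * X (X (H f))))
      + 2 * (H ((5 - 7 * (1 - G.s 3 ^ 2 - G.s c ^ 2)) * (t * (t * f))) -
        (5 - 7 * (1 - G.s 3 ^ 2 - G.s c ^ 2)) * (t * (t * H f))) = 0 := by
  -- Rewriting rules for the normal form: `r1`-`r9` move functions to the left of derivatives and
  -- E_c to the left of E_4, and `c1`-`c8` order the functions and cancel s_c t.
  have r1 : ∀ g, G.E 3 (G.s 3 * g) = G.s 3 * G.E 3 g + g - G.s 3 * (G.s 3 * g) := fun g => by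
    rw [E_mul, E_s]; simp; ring
  have r2 : ∀ g, G.E 3 (G.s c * g) = G.s c * G.E 3 g - G.s 3 * (G.s c * g) := fun g => by
    rw [E_mul, E_s]; simp [hc.symm]; ring
  have r3 : ∀ g, G.E c (G.s 3 * g) = G.s 3 * G.E c g - G.s 3 * (G.s c * g) := fun g => by
    rw [E_mul, E_s]; simp [hc]; ring
  have r4 : ∀ g, G.E c (G.s c * g) = G.s c * G.E c g + g - G.s c * (G.s c * g) := fun g => by
    rw [E_mul, E_s]; simp; ring
  have r5 : ∀ g, G.E 3 (t * g) = t * G.E 3 g + G.s 3 * (t * g) := fun g => by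
    rw [E_mul, G.E_inv ht, E_s]; simp [hc.symm]; linear_combination g * G.s 3 * t * ht
  have r6 : ∀ g, G.E c (t * g) = t * G.E c g - t * (t * g) + g := fun g => by
    rw [E_mul, G.E_inv ht, E_s]; simp; linear_combination g * (1 + G.s c * t) * ht
  have r7 : ∀ g, G.E 3 (χ * g) = χ * G.E 3 g + χ' * g - G.s 3 * (G.s 3 * (χ' * g)) := fun g => by
    rw [E_mul, hχ]; ring
  have r8 : ∀ g, G.E c (χ * g) = χ * G.E c g - G.s 3 * (G.s c * (χ' * g)) := fun g => by
    rw [E_mul, hχ2]; ring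
  have r9 : ∀ g, G.E 3 (G.E c g) = G.E c (G.E 3 g) + G.s 3 * G.E c g - G.s c * G.E 3 g :=
    fun g => G.comm 3 c g
  have c1 : ∀ g, G.s c * (t * g) = g := fun g => by rw [← mul_assoc, ht, one_mul]
  have c2 : ∀ g, t * (G.s c * g) = g := fun g => by rw [mul_left_comm, c1]
  have c3 : ∀ g, t * (G.s 3 * g) = G.s 3 * (t * g) := fun g => by rw [mul_left_comm]
  have c4 : ∀ g, G.s c * (G.s 3 * g) = G.s 3 * (G.s c * g) := fun g => by rw [mul_left_comm]
  have c5 : ∀ g, χ * (t * g) = t * (χ * g) := fun g => by rw [mul_left_comm]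
  have c6 : ∀ g, χ * (G.s 3 * g) = G.s 3 * (χ * g) := fun g => by rw [mul_left_comm]
  have c7 : ∀ g, χ * (G.s c * g) = G.s c * (χ * g) := fun g => by rw [mul_left_comm]
  have c8 : ∀ g, χ * (χ' * g) = χ' * (χ * g) := fun g => by rw [mul_left_comm]
  have hss : ∀ g, H (G.s 3 * (G.s 3 * g)) = G.s 3 * (G.s 3 * H g) - 8 * (G.s 3 * (G.s 3 * g)) +
      4 * (G.s 3 * G.E 3 g) + 2 * g := fun g => by
    simp only [hHs, r1]; ring
  have hsc : ∀ g, H (G.s c * (G.s c * g)) = G.s c * (G.s c * H g) - 8 * (G.s c * (G.s c * g)) +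
      4 * (G.s c * G.E c g) + 2 * g := fun g => by
    simp only [hHs, r4]; ring
  have htt : ∀ g, H (t * (t * g)) = t * (t * H g) + 6 * (t * (t * (t * (t * g)))) -
      4 * (t * (t * (t * G.E c g))) := fun g => by
    simp only [hHt, r6]; ring
  have hXX : ∀ g, X (X g) = 15 * (G.s 3 * (G.s 3 * g)) - 6 * g - 12 * (G.s 3 * G.E 3 g) +
      4 * G.E 3 (G.E 3 g) := fun g => by
    simp only [hX, map_add, map_sub, r1]; ring
  have hP : ∀ g, H (X (X g)) = X (X (H g)) +
      ((30 - 120 * G.s 3 ^ 2 - 20 * G.s 3 * χ + 4 * (χ' - G.s 3 ^ 2 * χ')) * g +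
      (76 * G.s 3 + 8 * χ) * G.E 3 g + (48 * G.s 3 ^ 2 - 8) * H g - 16 * G.E 3 (G.E 3 g) -
      16 * G.s 3 * G.E 3 (H g)) := fun g => by
    rw [hXX (H g)]
    simp only [hX, map_add, map_sub, r1, hHs, hHE, r7]
    ring
  have hE2 : ∀ g, G.E 3 (G.E 3 (t * (t * g))) = t * (t * G.E 3 (G.E 3 g)) +
      4 * (G.s 3 * (t * (t * G.E 3 g))) + 2 * (t * (t * g)) + 2 * (G.s 3 * (G.s 3 * (t * (t * g))))
      := fun g => by
    simp only [r5, map_add, r1, mul_add, c3]; ring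
  have hE1 : ∀ g, G.E 3 (t * (t * g)) = t * (t * G.E 3 g) + 2 * (G.s 3 * (t * (t * g))) :=
    fun g => by simp only [r5, mul_add, c3]; ring
  have h3E : ∀ g, G.E 3 (t * (t * (t * g))) = t * (t * (t * G.E 3 g)) +
      3 * (G.s 3 * (t * (t * (t * g)))) := fun g => by
    simp only [r5, mul_add, c3]; ring
  have h3c : ∀ g, G.E c (t * (t * (t * g))) = t * (t * (t * G.E c g)) -
      3 * (t * (t * (t * (t * g)))) + 3 * (t * (t * g)) := fun g => by
    simp only [r6, mul_add, mul_sub]; ring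
  have h3H : ∀ g, H (t * (t * (t * g))) = t * (t * (t * H g)) +
      12 * (t * (t * (t * (t * (t * g))))) - 3 * (t * (t * (t * g))) -
      6 * (t * (t * (t * (t * G.E c g)))) := fun g => by
    simp only [hHt, r6, mul_add, mul_sub]; ring
  have h3cE : ∀ g, G.E c (G.E 3 (t * (t * (t * g)))) = t * (t * (t * G.E c (G.E 3 g))) -
      3 * (t * (t * (t * (t * G.E 3 g)))) + 3 * (t * (t * G.E 3 g)) +
      3 * (G.s 3 * (t * (t * (t * G.E c g)))) - 9 * (G.s 3 * (t * (t * (t * (t * g))))) +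
      6 * (G.s 3 * (t * (t * g))) := fun g => by
    have : G.E 3 (t * (t * (t * g))) = t * (t * (t * G.E 3 g)) + (G.s 3 * (t * (t * (t * g))) +
      G.s 3 * (t * (t * (t * g))) + G.s 3 * (t * (t * (t * g)))) := by rw [h3E]; ring
    rw [this]
    simp only [map_add, r3, h3c, c1]
    ring
  have hLT : ∀ g, L (t * (t * (t * g))) = -2 * (t * (t * (t * G.E c (G.E 3 g)))) +
      6 * (t * (t * (t * (t * G.E 3 g)))) - 4 * (t * (t * G.E 3 g))
      + 6 * (G.s 3 * (t * (t * (t * G.E c g)))) - 6 * (G.s 3 * (t * (t * (t * (t * g)))))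
      - 2 * (G.s 3 * (t * (t * H g))) + χ * (t * (t * g)) := fun g => by
    rw [hL, h3cE, h3E, h3H]
    linear_combination (2 * t ^ 2 * G.E 3 g + 12 * G.s 3 * t ^ 2 * g - 2 * G.s 3 * t ^ 2 * H g -
      24 * G.s 3 * t ^ 4 * g + 12 * G.s 3 * t ^ 3 * G.E c g + χ * t ^ 2 * g) * ht
  have hEL : G.E 3 (L f) = -2 * G.E c (G.E 3 (G.E 3 f)) - 2 * G.s 3 * G.E c (G.E 3 f)
      + 4 * G.s c * G.E 3 (G.E 3 f) - 2 * G.s c * G.s 3 * G.E 3 f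
      - 2 * G.s c * (1 - 2 * G.s 3 ^ 2) * H f - 2 * G.s c * G.s 3 * G.E 3 (H f)
      + G.s c * χ * G.E 3 f + G.s c * (1 - G.s 3 ^ 2) * χ' * f - G.s c * G.s 3 * χ * f := by
    simp only [hL, map_add, map_sub, map_neg, r9, r2, r1, r7, mul_assoc, mul_add, mul_sub]
    ring
  have hw : ∀ g, H ((5 - 7 * (1 - G.s 3 ^ 2 - G.s c ^ 2)) * (t * (t * g))) =
      7 * H (G.s 3 * (G.s 3 * (t * (t * g)))) + 7 * H g - 2 * H (t * (t * g)) := fun g => by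
    have e : (5 - 7 * (1 - G.s 3 ^ 2 - G.s c ^ 2)) * (t * (t * g)) =
        (7 : ℂ) • (G.s 3 * (G.s 3 * (t * (t * g)))) + (7 : ℂ) • g - (2 : ℂ) • (t * (t * g)) := by
      simp only [Algebra.smul_def, map_ofNat]
      linear_combination 7 * g * (G.s c * t + 1) * ht
    rw [e]
    simp only [map_sub, map_add, map_smul]
    simp only [Algebra.smul_def, map_ofNat]
  -- The previous rules once more, with complex scalars as coefficients, so that an operator applied
  -- outside passes through them by linearity.
  have htt' : ∀ g, H (t * (t * g)) = t * (t * H g) + (6 : ℂ) • (t * (t * (t * (t * g)))) -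
      (4 : ℂ) • (t * (t * (t * G.E c g))) := fun g => by
    rw [htt]; simp only [Algebra.smul_def, map_ofNat]
  have hE1' : ∀ g, G.E 3 (t * (t * g)) = t * (t * G.E 3 g) + (2 : ℂ) • (G.s 3 * (t * (t * g))) :=
    fun g => by rw [hE1]; simp only [Algebra.smul_def, map_ofNat]
  have h4E : ∀ g, G.E 3 (t * (t * (t * (t * g)))) = t * (t * (t * (t * G.E 3 g))) +
      (4 : ℂ) • (G.s 3 * (t * (t * (t * (t * g))))) := fun g => by
    simp only [r5, mul_add, c3, Algebra.smul_def, map_ofNat]; ring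
  have h3E' : ∀ g, G.E 3 (t * (t * (t * g))) = t * (t * (t * G.E 3 g)) +
      (3 : ℂ) • (G.s 3 * (t * (t * (t * g)))) := fun g => by
    rw [h3E]; simp only [Algebra.smul_def, map_ofNat]
  have hEc : G.E c (X (X f)) = 15 * (G.s 3 ^ 2 * G.E c f - 2 * G.s c * G.s 3 ^ 2 * f) - 6 * G.E c f
      - 12 * (G.s 3 * G.E c (G.E 3 f) - G.s 3 * G.s c * G.E 3 f) + 4 * G.E c (G.E 3 (G.E 3 f)) := by
    simp only [hX, map_add, map_sub, r1, r3, mul_add, mul_sub]; ring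
  have hEEc : G.E 3 (G.E 3 (G.E c f)) = G.E c (G.E 3 (G.E 3 f)) + 2 * G.s 3 * G.E c (G.E 3 f)
      - 2 * G.s c * G.E 3 (G.E 3 f) + G.E c f := by
    simp only [map_add, map_sub, r9, r1, r2]; ring
  have hX3 : ∀ g, X (X (t * (t * (t * g)))) = t * (t * (t * (4 * G.E 3 (G.E 3 g) +
      12 * (G.s 3 * G.E 3 g) + (3 * G.s 3 ^ 2 + 6) * g))) := fun g => by
    rw [hXX, h3E']
    simp only [map_add, Derivation.map_smul, r1, h3E']
    simp only [Algebra.smul_def, map_ofNat]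
    ring
  have hX4 : ∀ g, X (X (t * (t * (t * (t * g))))) = t * (t * (t * (t * (4 * G.E 3 (G.E 3 g) +
      20 * (G.s 3 * G.E 3 g) + (15 * G.s 3 ^ 2 + 10) * g)))) := fun g => by
    rw [hXX, h4E]
    simp only [map_add, Derivation.map_smul, r1, h4E]
    simp only [Algebra.smul_def, map_ofNat]
    ring
  rw [hLT, hEL, hP, hE2, hE1, htt', htt', hw, hss, hE1, htt', hEc, hP]
  simp only [map_add, map_sub, map_smul, Derivation.map_smul, hX4, h4E]
  simp only [hX3, h3E', hE1']
  simp only [hXX, hEEc, hHE]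
  simp only [r9]
  simp only [Algebra.smul_def, map_ofNat]
  -- Once everything is in normal order, s_c t = 1 is the only relation still needed.
  linear_combination (8 * t ^ 2 * (4 * G.E 3 (G.E 3 f) - 2 * G.s 3 * G.E 3 f -
      2 * (1 - 2 * G.s 3 ^ 2) * H f - 2 * G.s 3 * G.E 3 (H f) + χ * G.E 3 f +
      (1 - G.s 3 ^ 2) * χ' * f - G.s 3 * χ * f) +
    4 * t ^ 2 * (-30 * G.s 3 ^ 2 * f + 12 * G.s 3 * G.E 3 f) +
    4 * t ^ 2 * (-8 * G.E 3 (G.E 3 f) - 12 * G.s 3 * G.E 3 f) + 64 * G.s 3 * t ^ 2 * G.E 3 f -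
    14 * (G.s c * t + 1) * H f) * ht

/-- The function χ = 2 s₄ V - E_4 V is what the potential adds to [H, E_4]. The condition `hW` says
that replacing Δ by H in L turns the potential of L into s_c χ, and `hχ` says that χ behaves like a
function of s₄ alone. The defect `hHL` then reduces the claim to `quartic_commute`. -/
theorem quartic_commute' (H L : C →ₗ[ℂ] C) (hc : c ≠ 3) (ht : G.s c * t = 1)
    {V W χ χ' : C} {α : ℂ} {i j : Fin 4}
    (h : (c, i, j) = (2, 1, 0) ∨ (c, i, j) = (0, 1, 2))
    (hH : ∀ f, H f = G.lap f + V * f) (hL : ∀ f, L f = G.lrl c i j f - W * f)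
    (hHL : ∀ f, H (L f) = L (H f) - (4 * α) • (t * (t * (t * G.E 3 f))))
    (hχV : 2 * G.s 3 * V - G.E 3 V = χ) (hW : 2 * G.s c * G.s 3 * V - W = G.s c * χ)
    (hχ : ∀ k, G.E k χ = χ' * G.E k (G.s 3))
    (X : C →ₗ[ℂ] C)
    (hX : ∀ f, X f = G.s 3 * f + G.s 3 * f + G.s 3 * f - G.E 3 f - G.E 3 f)
    (K : C → C) (hK : ∀ f, K f = -(L (L f)) - (α / 2) • (X (X (t * (t * f))) + t * (t * X (X f))) +
        α • ((5 - 7 * (1 - G.s 3 ^ 2 - G.s c ^ 2)) * (t * (t * f)))) (f : C) :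
    K (H f) = H (K f) := by
  have q := G.quartic_commute H L hc ht (χ := χ) (χ' := χ') ?_ ?_ ?_ ?_ ?_ ?_ X hX
  · have q := q f
    rw [hK, hK]
    simp only [map_add, map_sub, map_neg, map_smul, hHL]
    have q2 := congrArg (fun g => (α / 2) • g) q
    simp only [Algebra.smul_def, map_mul, map_ofNat, mul_zero] at q2 ⊢
    have h2 : algebraMap ℂ C (α / 2) * 2 = algebraMap ℂ C α := by
      rw [← map_ofNat (algebraMap ℂ C) 2, ← map_mul]; norm_num
    rw [← h2] at *
    linear_combination -q2
  · intro k f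
    rw [hH, hH, lap_s_mul]
    ring
  · intro f
    rw [hH, hH, G.lap_inv_mul ht]
    ring
  · intro f
    rw [hH, lap_E, hH, map_add, E_mul]
    linear_combination f * hχV
  · rw [hχ, E_s, if_pos rfl]; ring
  · rw [hχ, E_s, if_neg hc]; ring
  · intro f
    have e2 := G.comm 3 c f
    rw [hL, G.lrl_eq h, hH]
    linear_combination -e2 + f * hW

theorem E_coulomb (hE : ∀ i, G.E i w = G.s 3 * w ^ 3 * G.E i (G.s 3)) (a b : ℂ) (k : Fin 4) :
    G.E k (a • ((2 * G.s 3 ^ 2 - 1) * w) + b • G.s 3) =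
      (a • (4 * G.s 3 * w + (2 * G.s 3 ^ 2 - 1) * (G.s 3 * w ^ 3)) + b • 1) * G.E k (G.s 3) := by
  have e : G.E k (2 * G.s 3 ^ 2 - 1) = 4 * G.s 3 * G.E k (G.s 3) := by
    rw [show (2 * G.s 3 ^ 2 - 1 : C) = G.s 3 * G.s 3 + G.s 3 * G.s 3 - 1 by ring, map_sub, map_add,
      E_mul, Derivation.map_one_eq_zero]
    ring
  rw [map_add, Derivation.map_smul, Derivation.map_smul, E_mul, e, hE]
  simp only [Algebra.smul_def]
  ring

end GradientCalculus

/-! ### The calculus on the sphere and bracket equations. -/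

/-- The gradient calculus of smooth functions on `U`. -/
def sphereCalc (U : TopologicalSpace.Opens S3) : GradientCalculus (Smooth U) where
  E := derE
  s := coord
  E_s := E_coord
  sum_sq := by have h := sum_coord_sq (U := U); rwa [Fin.sum_univ_four] at h
  sum_E f := by have h := sum_coord_mul_E f; rwa [Fin.sum_univ_four] at h
  comm := E_comm

theorem sphereCalc_s (i : Fin 4) : (sphereCalc U).s i = coord i := rfl

theorem sphereCalc_E (i : Fin 4) (f : Smooth U) : (sphereCalc U).E i f = E i f := rfl

theorem J_eq_rot (j k : Fin 4) (f : Smooth U) : J j k f = (sphereCalc U).rot j k f := J_eq j k f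

theorem laplaceBeltrami_apply (f : Smooth U) : laplaceBeltrami f = (sphereCalc U).lap f := by
  rw [← GradientCalculus.sum_rot_sq]
  simp only [laplaceBeltrami, pow_two, LinearMap.add_apply, Module.End.mul_apply, J_eq_rot]

theorem J_commute_laplaceBeltrami (j k : Fin 4) :
    Commute (J j k : Op U) laplaceBeltrami := by
  apply LinearMap.ext; intro f
  simp only [Module.End.mul_apply, laplaceBeltrami_apply, J_eq_rot]
  exact ((sphereCalc U).lap_rot j k f).symm

/-- The equation `[A, V] = [Δ, W]`. -/
def BracketEq (A : Op U) (V W : Smooth U) : Prop :=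
  ∀ f, A (V * f) - V * A f = (sphereCalc U).lap (W * f) - W * (sphereCalc U).lap f

theorem BracketEq.add {A : Op U} {V W V' W' : Smooth U} (h : BracketEq A V W)
    (h' : BracketEq A V' W') : BracketEq A (V + V') (W + W') := by
  intro f
  have h1 := h f
  have h2 := h' f
  simp only [add_mul, map_add, GradientCalculus.lap_add]
  linear_combination h1 + h2

theorem lap_smul (c : ℂ) (f : Smooth U) : (sphereCalc U).lap (c • f) = c • (sphereCalc U).lap f := by
  simp only [← laplaceBeltrami_apply, map_smul]

theorem BracketEq.smul {A : Op U} {V W : Smooth U} (h : BracketEq A V W) (c : ℂ) :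
    BracketEq A (c • V) (c • W) := by
  intro f
  have h1 := congrArg (fun g => c • g) (h f)
  simpa only [smul_mul_assoc, map_smul, lap_smul, smul_sub] using h1

theorem BracketEq.of_zero {A : Op U} {V : Smooth U} (h : ∀ f, A (V * f) = V * A f) :
    BracketEq A V 0 := by
  intro f
  have h0 : (sphereCalc U).lap (0 : Smooth U) = 0 := by
    rw [← laplaceBeltrami_apply, map_zero]
  rw [h, sub_self, zero_mul, zero_mul, h0, sub_zero]

theorem BracketEq.one (A : Op U) : BracketEq A 1 0 := .of_zero fun f => by simp

theorem BracketEq.congr {A : Op U} {V W V' W' : Smooth U} (h : BracketEq A V W) (hV : V = V')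
    (hW : W = W') : BracketEq A V' W' := hV ▸ hW ▸ h

/-- If `A` commutes with `Δ` and `[A, V] = [Δ, W]` then `A + W` commutes with `Δ + V`. -/
theorem BracketEq.commute {A : Op U} {V W : Smooth U} (h : BracketEq A V W)
    (hA : Commute A laplaceBeltrami) :
    Commute (A + mulOp W) (laplaceBeltrami + mulOp V) := by
  apply LinearMap.ext; intro f
  have h1 := h f
  have h2 := LinearMap.congr_fun hA f
  simp only [Module.End.mul_apply, laplaceBeltrami_apply] at h2
  simp only [Module.End.mul_apply, LinearMap.add_apply, laplaceBeltrami_apply, mulOp_apply, mul_add,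
    mul_left_comm W V f] at h2 ⊢
  linear_combination h1 + h2

theorem rot_coord_of_ne {i j k : Fin 4} (hi : i ≠ k) (hj : j ≠ k) :
    (sphereCalc U).rot i j (coord k) = 0 := by
  change coord i * E j (coord k) - coord j * E i (coord k) = _
  rw [E_coord, E_coord]; simp only [hi, hj, if_false]; ring

theorem rot_inv_of_ne {i j k : Fin 4} (hi : i ≠ k) (hj : j ≠ k) {t : Smooth U}
    (ht : coord k * t = 1) : (sphereCalc U).rot i j t = 0 := by
  have h := rot_coord_of_ne (U := U) hi hj
  change coord i * E j t - coord j * E i t = _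
  change coord i * E j (coord k) - coord j * E i (coord k) = _ at h
  rw [E_of_mul_eq_one j ht, E_of_mul_eq_one i ht]
  linear_combination (-t ^ 2) * h

theorem J_sq_apply (i j : Fin 4) (f : Smooth U) :
    (J i j ^ 2 : Op U) f = (sphereCalc U).rot i j ((sphereCalc U).rot i j f) := by
  rw [pow_two, Module.End.mul_apply, J_eq_rot, J_eq_rot]

theorem J_sq_swap (i j : Fin 4) : (J i j ^ 2 : Op U) = J j i ^ 2 := by
  apply LinearMap.ext; intro f
  have h : ∀ g : Smooth U, J i j g = (-1 : ℂ) • J j i g := fun g => by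
    rw [J_eq, J_eq, neg_one_smul]; ring
  rw [pow_two, pow_two, Module.End.mul_apply, Module.End.mul_apply, h, h, map_smul, smul_smul]
  norm_num

/-- A rotation that annihilates V commutes with multiplication by V, so no correction is needed. -/
theorem bracketEq_J_sq_of_rot_eq_zero {i j : Fin 4} {V : Smooth U}
    (h : (sphereCalc U).rot i j V = 0) : BracketEq (J i j ^ 2) V 0 := by
  refine .of_zero fun f => ?_
  simp only [J_sq_apply, GradientCalculus.rot_mul, h, mul_zero, add_zero]

theorem bracketEq_J_sq_inv_sq {i j : Fin 4} (hij : i ≠ j) {t : Smooth U} (ht : coord i * t = 1) :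
    BracketEq (J i j ^ 2) (t ^ 2) (coord j ^ 2 * t ^ 2) := by
  intro f
  simp only [J_sq_apply]
  have e := (sphereCalc U).rot_sq_inv_sq hij ht f
  simpa only [sphereCalc_s] using e

theorem bracketEq_J_sq_inv_sq' {i j : Fin 4} (hij : i ≠ j) {t : Smooth U} (ht : coord j * t = 1) :
    BracketEq (J i j ^ 2) (t ^ 2) (coord i ^ 2 * t ^ 2) := by
  rw [J_sq_swap]; exact bracketEq_J_sq_inv_sq hij.symm ht

theorem bracketEq_J_sq_inv_sq_of_ne {i j k : Fin 4} (hi : i ≠ k) (hj : j ≠ k) {t : Smooth U}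
    (ht : coord k * t = 1) : BracketEq (J i j ^ 2) (t ^ 2) 0 := by
  apply bracketEq_J_sq_of_rot_eq_zero
  rw [pow_two, GradientCalculus.rot_mul, rot_inv_of_ne hi hj ht]; ring

theorem bracketEq_J_sq_coulomb (hU : U ≤ region2) {i j : Fin 4} (hi : i ≠ 3) (hj : j ≠ 3) :
    BracketEq (J i j ^ 2) (coord 3 * rinv hU) 0 := by
  apply bracketEq_J_sq_of_rot_eq_zero
  have h := rot_coord_of_ne (U := U) hi hj
  have h2 : (sphereCalc U).rot i j (rinv hU) = 0 := by
    change coord i * E j (coord 3) - coord j * E i (coord 3) = _ at h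
    change coord i * E j (rinv hU) - coord j * E i (rinv hU) = _
    rw [E_rinv hU, E_rinv hU]
    linear_combination (coord 3 * rinv hU ^ 3) * h
  rw [GradientCalculus.rot_mul, h, h2]; ring

theorem J_sq_commute_laplaceBeltrami (i j : Fin 4) :
    Commute (J i j ^ 2 : Op U) laplaceBeltrami := (J_commute_laplaceBeltrami i j).pow_left 2

/-! ### The second order symmetries built on squares of rotations. -/

/-- The rotation J₁₂ only sees the poles in s₁ and s₂; every other term of the potential is
invariant under it. The bracket equations of the five terms are added up, and the remaining
commutation theorems of this kind follow the same pattern. -/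
theorem L12_commute (hU : U ≤ region3) (a : Fin 5 → ℂ) : Commute (L12 hU a) (Hext hU a) := by
  refine BracketEq.commute ?_ (J_sq_commute_laplaceBeltrami 0 1)
  have h0 := bracketEq_J_sq_coulomb (hU.trans region3_le) (i := 0) (j := 1) (by decide) (by decide)
  have h1 := bracketEq_J_sq_inv_sq (i := 0) (j := 1) (by decide)
    (coord0_mul_inv1 (hU.trans region3_le))
  have h2 := bracketEq_J_sq_inv_sq' (i := 0) (j := 1) (by decide)
    (coord1_mul_inv2 (hU.trans region3_le))
  have h3 := bracketEq_J_sq_inv_sq_of_ne (i := 0) (j := 1) (by decide) (by decide)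
    (coord2_mul_inv3 hU)
  exact (((((h0.smul (a 0)).add (h1.smul (a 1))).add (h2.smul (a 2))).add (h3.smul (a 3))).add
    ((BracketEq.one _).smul (a 4))).congr rfl (by simp only [smul_zero]; abel)

theorem L13_commute (hU : U ≤ region3) (a : Fin 5 → ℂ) : Commute (L13 hU a) (Hext hU a) := by
  refine BracketEq.commute ?_ (J_sq_commute_laplaceBeltrami 0 2)
  have h0 := bracketEq_J_sq_coulomb (hU.trans region3_le) (i := 0) (j := 2) (by decide) (by decide)
  have h1 := bracketEq_J_sq_inv_sq (i := 0) (j := 2) (by decide)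
    (coord0_mul_inv1 (hU.trans region3_le))
  have h2 := bracketEq_J_sq_inv_sq_of_ne (i := 0) (j := 2) (by decide) (by decide)
    (coord1_mul_inv2 (hU.trans region3_le))
  have h3 := bracketEq_J_sq_inv_sq' (i := 0) (j := 2) (by decide) (coord2_mul_inv3 hU)
  exact (((((h0.smul (a 0)).add (h1.smul (a 1))).add (h2.smul (a 2))).add (h3.smul (a 3))).add
    ((BracketEq.one _).smul (a 4))).congr rfl (by simp only [smul_zero]; abel)

theorem L23_commute (hU : U ≤ region3) (a : Fin 5 → ℂ) : Commute (L23 hU a) (Hext hU a) := by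
  refine BracketEq.commute ?_ (J_sq_commute_laplaceBeltrami 1 2)
  have h0 := bracketEq_J_sq_coulomb (hU.trans region3_le) (i := 1) (j := 2) (by decide) (by decide)
  have h1 := bracketEq_J_sq_inv_sq_of_ne (i := 1) (j := 2) (by decide) (by decide)
    (coord0_mul_inv1 (hU.trans region3_le))
  have h2 := bracketEq_J_sq_inv_sq (i := 1) (j := 2) (by decide)
    (coord1_mul_inv2 (hU.trans region3_le))
  have h3 := bracketEq_J_sq_inv_sq' (i := 1) (j := 2) (by decide) (coord2_mul_inv3 hU)
  exact (((((h0.smul (a 0)).add (h1.smul (a 1))).add (h2.smul (a 2))).add (h3.smul (a 3))).add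
    ((BracketEq.one _).smul (a 4))).congr rfl (by simp only [smul_zero]; abel)

theorem Lc12_commute (hU : U ≤ region2) (b : Fin 4 → ℂ) : Commute (Lc12 hU b) (Hcoul hU b) := by
  refine BracketEq.commute ?_ (J_sq_commute_laplaceBeltrami 0 1)
  have h0 := bracketEq_J_sq_coulomb hU (i := 0) (j := 1) (by decide) (by decide)
  have h1 := bracketEq_J_sq_inv_sq (i := 0) (j := 1) (by decide) (coord0_mul_inv1 hU)
  have h2 := bracketEq_J_sq_inv_sq' (i := 0) (j := 1) (by decide) (coord1_mul_inv2 hU)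
  exact ((((h0.smul (b 0)).add (h1.smul (b 1))).add (h2.smul (b 2))).add
    ((BracketEq.one _).smul (b 3))).congr rfl (by simp only [smul_zero]; abel)

theorem Lc13_commute (hU : U ≤ region2) (b : Fin 4 → ℂ) : Commute (Lc13 hU b) (Hcoul hU b) := by
  refine BracketEq.commute ?_ (J_sq_commute_laplaceBeltrami 0 2)
  have h0 := bracketEq_J_sq_coulomb hU (i := 0) (j := 2) (by decide) (by decide)
  have h1 := bracketEq_J_sq_inv_sq (i := 0) (j := 2) (by decide) (coord0_mul_inv1 hU)
  have h2 := bracketEq_J_sq_inv_sq_of_ne (i := 0) (j := 2) (by decide) (by decide)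
    (coord1_mul_inv2 hU)
  exact ((((h0.smul (b 0)).add (h1.smul (b 1))).add (h2.smul (b 2))).add
    ((BracketEq.one _).smul (b 3))).congr rfl (by simp only [smul_zero]; abel)

theorem Lc23_commute (hU : U ≤ region2) (b : Fin 4 → ℂ) : Commute (Lc23 hU b) (Hcoul hU b) := by
  refine BracketEq.commute ?_ (J_sq_commute_laplaceBeltrami 1 2)
  have h0 := bracketEq_J_sq_coulomb hU (i := 1) (j := 2) (by decide) (by decide)
  have h1 := bracketEq_J_sq_inv_sq_of_ne (i := 1) (j := 2) (by decide) (by decide)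
    (coord0_mul_inv1 hU)
  have h2 := bracketEq_J_sq_inv_sq (i := 1) (j := 2) (by decide) (coord1_mul_inv2 hU)
  exact ((((h0.smul (b 0)).add (h1.smul (b 1))).add (h2.smul (b 2))).add
    ((BracketEq.one _).smul (b 3))).congr rfl (by simp only [smul_zero]; abel)

/-! ### Laplace-Runge-Lenz operators and quartic symmetries on the sphere. -/

/-- The leading part `{J_{ic}, J_{4i}} + {J_{jc}, J_{4j}}` of the Laplace-Runge-Lenz operators. -/
def lrlOp (c i j : Fin 4) : Op U := symm (J i c) (J 3 i) + symm (J j c) (J 3 j)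

theorem lrlOp_apply (c i j : Fin 4) (f : Smooth U) :
    lrlOp c i j f = (sphereCalc U).lrl c i j f := by
  simp only [lrlOp, symm, LinearMap.add_apply, Module.End.mul_apply, J_eq_rot,
    GradientCalculus.lrl]

theorem lrlOp_commute_laplaceBeltrami (c i j : Fin 4) :
    Commute (lrlOp c i j : Op U) laplaceBeltrami := by
  have h := J_commute_laplaceBeltrami (U := U)
  exact ((((h _ _).mul_left (h _ _)).add_left ((h _ _).mul_left (h _ _))).add_left
    (((h _ _).mul_left (h _ _)).add_left ((h _ _).mul_left (h _ _))))

theorem bracketEq_neg {A : Op U} {V W : Smooth U}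
    (h : ∀ f, A (V * f) - V * A f = -((sphereCalc U).lap (W * f) - W * (sphereCalc U).lap f)) :
    BracketEq A V (-W) := by
  intro f
  have e : -W * f = (-1 : ℂ) • (W * f) := by rw [neg_one_smul]; ring
  rw [h, e, lap_smul, neg_one_smul]
  ring

theorem bracketEq_lrlOp_coulomb (hU : U ≤ region2) {c i j : Fin 4}
    (h : (c, i, j) = (2, 1, 0) ∨ (c, i, j) = (0, 1, 2)) :
    BracketEq (lrlOp c i j) (coord 3 * rinv hU) (-(coord c * rinv hU)) := by
  refine bracketEq_neg fun f => ?_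
  simp only [lrlOp_apply]
  have e := (sphereCalc U).lrl_w h (rinv_sq hU) (E_rinv hU) f
  simpa only [sphereCalc_s] using e

theorem bracketEq_lrlOp_inv_sq {c i j k : Fin 4}
    (h : (c, i, j) = (2, 1, 0) ∨ (c, i, j) = (0, 1, 2)) (hk : k ≠ 3) (hkc : k ≠ c) {t : Smooth U}
    (ht : coord k * t = 1) :
    BracketEq (lrlOp c i j) (t ^ 2) (-(2 * coord c * coord 3 * t ^ 2)) := by
  refine bracketEq_neg fun f => ?_
  simp only [lrlOp_apply]
  have e := (sphereCalc U).lrl_inv_sq h hk hkc ht f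
  simpa only [sphereCalc_s] using e

/-- The function is written term by term as a sum of bracket equations produces it; the summand `b 3
• 0` is the contribution of the constant term. -/
theorem Lc_eq (hU : U ≤ region2) (b : Fin 4 → ℂ) :
    Lc hU b = lrlOp 2 1 0 + mulOp (b 0 • (-(coord 2 * rinv hU)) +
      b 1 • (-(2 * coord 2 * coord 3 * inv1 hU ^ 2)) +
      b 2 • (-(2 * coord 2 * coord 3 * inv2 hU ^ 2)) + b 3 • 0) := by
  apply LinearMap.ext; intro f
  simp only [Lc, lrlOp, LinearMap.add_apply, LinearMap.sub_apply, mulOp_apply, Algebra.smul_def,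
    map_ofNat]
  ring

theorem Lc_commute (hU : U ≤ region2) (b : Fin 4 → ℂ) : Commute (Lc hU b) (Hcoul hU b) := by
  rw [Lc_eq]
  refine BracketEq.commute ?_ (lrlOp_commute_laplaceBeltrami 2 1 0)
  have h0 := bracketEq_lrlOp_coulomb hU (c := 2) (i := 1) (j := 0) (by decide)
  have h1 := bracketEq_lrlOp_inv_sq (c := 2) (i := 1) (j := 0) (by decide) (by decide) (by decide)
    (coord0_mul_inv1 hU)
  have h2 := bracketEq_lrlOp_inv_sq (c := 2) (i := 1) (j := 0) (by decide) (by decide) (by decide)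
    (coord1_mul_inv2 hU)
  exact ((((h0.smul (b 0)).add (h1.smul (b 1))).add (h2.smul (b 2))).add
    ((BracketEq.one _).smul (b 3)))

/-- The sum of the s_i J_4i, i ≤ 3, collapses to -E_4 by ∑ s_i E_i = 0 and ∑ s_i² = 1; symmetrizing
doubles it and adds 3 s₄. So X is the first order operator along E_4 that the defect of L calls for.
-/
theorem X_apply (f : Smooth U) : (X : Op U) f = coord 3 * f + coord 3 * f + coord 3 * f
    - E 3 f - E 3 f := by
  have h1 := sum_coord_mul_E f
  have h2 := sum_coord_sq (U := U)
  rw [Fin.sum_univ_four] at h1 h2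
  have e3 : ∀ j : Fin 4, j ≠ 3 → E 3 (coord j : Smooth U) = - (coord 3 * coord j) := fun j hj => by
    rw [E_coord, if_neg hj.symm, zero_sub]
  have e0 : ∀ j : Fin 4, E j (coord j : Smooth U) = 1 - coord j * coord j := fun j => by
    rw [E_coord, if_pos rfl]
  simp only [X, symm, LinearMap.add_apply, Module.End.mul_apply, mulOp_apply, J_eq, E_mul,
    e3 0 (by decide), e3 1 (by decide), e3 2 (by decide), e0]
  linear_combination 2 * coord 3 * h1 - 2 * E 3 f * h2

theorem quartic_op_commute {c i j : Fin 4} (h : (c, i, j) = (2, 1, 0) ∨ (c, i, j) = (0, 1, 2))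
    {t V W χ χ' P : Smooth U} {α : ℂ} (ht : coord c * t = 1)
    {H L K : Op U} (hH : H = laplaceBeltrami + mulOp V) (hL : L = lrlOp c i j - mulOp W)
    (hHL : ∀ f, H (L f) = L (H f) - (4 * α) • (t * (t * (t * E 3 f))))
    (hχV : 2 * coord 3 * V - E 3 V = χ) (hW : 2 * coord c * coord 3 * V - W = coord c * χ)
    (hχ : ∀ k, E k χ = χ' * E k (coord 3))
    (hP : P = (5 - 7 * (1 - coord 3 ^ 2 - coord c ^ 2)) * t ^ 2)
    (hK : K = -(L ^ 2) - (1 / 2 : ℂ) • symm (U := U) (X ^ 2) (mulOp (α • t ^ 2)) +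
      mulOp (α • P)) : Commute K H := by
  have hc : c ≠ 3 := by rcases h with h | h <;> simp at h <;> simp [h.1]
  apply LinearMap.ext
  refine (sphereCalc U).quartic_commute' (t := t) (V := V) (W := W) (χ := χ) (χ' := χ') (α := α)
    H L hc ht h ?_ ?_ hHL hχV hW hχ X X_apply K ?_
  · intro f
    rw [hH, LinearMap.add_apply, laplaceBeltrami_apply, mulOp_apply]
  · intro f
    rw [hL, LinearMap.sub_apply, lrlOp_apply, mulOp_apply]
  · intro g
    simp only [sphereCalc_s]
    simp only [hK, symm, LinearMap.add_apply, LinearMap.sub_apply, LinearMap.neg_apply, pow_two,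
      LinearMap.smul_apply, Module.End.mul_apply, mulOp_apply, hP, smul_mul_assoc, map_smul,
      mul_assoc, ← smul_add, smul_smul]
    rw [show 1 / 2 * α = α / 2 by ring]

/-- The part V₀ of the potential satisfies its bracket equation and drops out; the pole in the
direction c contributes exactly the defect of `lrl_inv_sq_self`. -/
theorem lrl_bracket {c i j : Fin 4} (h : (c, i, j) = (2, 1, 0) ∨ (c, i, j) = (0, 1, 2))
    {t V₀ W₀ : Smooth U} {α : ℂ} (ht : coord c * t = 1) (h0 : BracketEq (lrlOp c i j) V₀ (-W₀))
    {H L : Op U} (hH : H = laplaceBeltrami + mulOp (V₀ + α • t ^ 2))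
    (hL : L = lrlOp c i j - mulOp (W₀ + α • (2 * coord 3 * t))) (f : Smooth U) :
    H (L f) = L (H f) - (4 * α) • (t * (t * (t * E 3 f))) := by
  have h1 := h0 f
  have h2 := (sphereCalc U).lrl_inv_sq_self h ht f
  have h3 := LinearMap.congr_fun (lrlOp_commute_laplaceBeltrami (U := U) c i j) f
  simp only [← lrlOp_apply, ← laplaceBeltrami_apply, sphereCalc_s, sphereCalc_E,
    Module.End.mul_apply] at h1 h2 h3
  have e1 : laplaceBeltrami (-W₀ * f) = -laplaceBeltrami (W₀ * f) := by
    rw [← map_neg]; congr 1; ring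
  rw [e1] at h1
  have h2' := congrArg (fun g => α • g) h2
  simp only [smul_sub, smul_add, smul_neg] at h2'
  simp only [hH, hL, LinearMap.add_apply, LinearMap.sub_apply, mulOp_apply]
  simp only [add_mul, smul_mul_assoc, map_add, map_sub, map_smul, mul_add, mul_sub]
  simp only [Algebra.smul_def, map_mul, map_ofNat] at h2' ⊢
  linear_combination -h1 - h2' - h3

/-- Common form of `K1` and `K3`: c is the direction whose pole obstructs the second order symmetry,
and i, j are the two harmless ones. -/
theorem quartic_symmetry (hU : U ≤ region2) {c i j : Fin 4}
    (h : (c, i, j) = (2, 1, 0) ∨ (c, i, j) = (0, 1, 2))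
    {tc ti tj : Smooth U} {a0 αc αi αj a4 : ℂ} (hc : coord c * tc = 1) (hi : coord i * ti = 1)
    (hj : coord j * tj = 1) {P : Smooth U} {H M K : Op U}
    (hH : H = laplaceBeltrami + mulOp (a0 • (coord 3 * rinv hU) + αc • tc ^ 2 + αi • ti ^ 2 +
      αj • tj ^ 2 + a4 • 1))
    (hM : M = (1 / 2 : ℂ) • lrlOp (U := U) c i j - mulOp ((a0 / 2) • (coord c * rinv hU) +
      αi • (coord c * coord 3 * ti ^ 2) + αj • (coord c * coord 3 * tj ^ 2) +
      αc • (coord 3 * tc)))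
    (hP : P = (5 - 7 * (1 - coord 3 ^ 2 - coord c ^ 2)) * tc ^ 2)
    (hK : K = -((4 : ℂ) • M ^ 2) - (1 / 2 : ℂ) • symm (U := U) (X ^ 2) (mulOp (αc • tc ^ 2)) +
      mulOp (αc • P)) : Commute K H := by
  have hcij : (c ≠ 3 ∧ i ≠ 3 ∧ j ≠ 3) ∧ i ≠ c ∧ j ≠ c := by
    rcases h with h | h <;> simp only [Prod.mk.injEq] at h <;> obtain ⟨rfl, rfl, rfl⟩ := h <;> decide
  set W₀ : Smooth U := a0 • (coord c * rinv hU) + αi • (2 * coord c * coord 3 * ti ^ 2) +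
    αj • (2 * coord c * coord 3 * tj ^ 2) with hW₀
  have h0 : BracketEq (lrlOp c i j) (a0 • (coord 3 * rinv hU) + αi • ti ^ 2 + αj • tj ^ 2 + a4 • 1)
      (-W₀) := by
    refine (((((bracketEq_lrlOp_coulomb hU h).smul a0).add
      ((bracketEq_lrlOp_inv_sq h hcij.1.2.1 hcij.2.1 hi).smul αi)).add
      ((bracketEq_lrlOp_inv_sq h hcij.1.2.2 hcij.2.2 hj).smul αj)).add
      ((BracketEq.one _).smul a4)).congr rfl ?_
    rw [hW₀]; simp only [Algebra.smul_def]; ring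
  set L : Op U := lrlOp c i j - mulOp (W₀ + αc • (2 * coord 3 * tc)) with hL
  have hML : M = (1 / 2 : ℂ) • L := by
    rw [hM, hL, hW₀]
    apply LinearMap.ext; intro f
    have h2 : algebraMap ℂ (Smooth U) (1 / 2) * 2 = 1 := by
      rw [← map_ofNat (algebraMap ℂ (Smooth U)) 2, ← map_mul]; norm_num
    have h3 : algebraMap ℂ (Smooth U) (a0 / 2) = algebraMap ℂ (Smooth U) (1 / 2) *
      algebraMap ℂ (Smooth U) a0 := by rw [← map_mul]; congr 1; ring
    simp only [LinearMap.sub_apply, LinearMap.smul_apply, mulOp_apply]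
    simp only [Algebra.smul_def, h3]
    linear_combination (coord c * coord 3 * f * (algebraMap ℂ (Smooth U) αi * ti ^ 2 +
      algebraMap ℂ (Smooth U) αj * tj ^ 2) + algebraMap ℂ (Smooth U) αc * coord 3 * tc * f) * h2
  have hH' : H = laplaceBeltrami + mulOp ((a0 • (coord 3 * rinv hU) + αi • ti ^ 2 + αj • tj ^ 2 +
      a4 • 1) + αc • tc ^ 2) := by rw [hH]; congr 2; abel
  have hE3 : E 3 (coord 3 : Smooth U) = 1 - coord 3 * coord 3 := by rw [E_coord, if_pos rfl]
  have hEt : ∀ {k : Fin 4} {t : Smooth U}, k ≠ 3 → coord k * t = 1 →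
      E 3 (t ^ 2) = 2 * t ^ 3 * (coord 3 * coord k) := fun {k t} hk ht => by
    rw [pow_two, E_mul, E_of_mul_eq_one 3 ht, E_coord, if_neg hk.symm]; ring
  have hE1 : ∀ k, E k (1 : Smooth U) = 0 := fun k => (derE k).map_one_eq_zero
  -- Since E_4 (1/s_k²) = 2 s₄/s_k² for k ≤ 3, all poles cancel in χ = 2 s₄ V - E_4 V. Only the
  -- Coulomb term and the constant survive, which makes χ a function of s₄.
  refine quartic_op_commute (t := tc) (α := αc) h hc hH' hL (lrl_bracket h hc h0 hH' hL)
    (χ := a0 • ((2 * coord 3 ^ 2 - 1) * rinv hU) + (2 * a4) • coord 3)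
    (χ' := a0 • (4 * coord 3 * rinv hU + (2 * coord 3 ^ 2 - 1) * (coord 3 * rinv hU ^ 3)) +
      (2 * a4) • 1) ?_ ?_ ?_ hP ?_
  · simp only [map_add, map_smul, E_mul, hEt hcij.1.1 hc, hEt hcij.1.2.1 hi, hEt hcij.1.2.2 hj,
      E_rinv hU, hE3, hE1]
    simp only [Algebra.smul_def, map_mul, map_ofNat]
    linear_combination (-algebraMap ℂ (Smooth U) a0 * coord 3 ^ 2 * rinv hU) * rinv_sq hU -
      2 * algebraMap ℂ (Smooth U) αc * coord 3 * tc ^ 2 * hc -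
      2 * algebraMap ℂ (Smooth U) αi * coord 3 * ti ^ 2 * hi -
      2 * algebraMap ℂ (Smooth U) αj * coord 3 * tj ^ 2 * hj
  · rw [hW₀]
    simp only [Algebra.smul_def, map_mul, map_ofNat]
    linear_combination 2 * algebraMap ℂ (Smooth U) αc * coord 3 * tc * hc
  · intro k
    exact (sphereCalc U).E_coulomb (E_rinv hU) a0 (2 * a4) k
  · rw [hK, hML, smul_pow, smul_smul]
    norm_num

theorem K1_commute (hU : U ≤ region3) (a : Fin 5 → ℂ) : Commute (K1 hU a) (Hext hU a) := by
  refine quartic_symmetry (hU.trans region3_le) (c := 2) (i := 1) (j := 0) (by decide)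
    (coord2_mul_inv3 hU) (coord1_mul_inv2 (hU.trans region3_le))
    (coord0_mul_inv1 (hU.trans region3_le)) (a0 := a 0) (αc := a 3) (αi := a 2) (αj := a 1)
    (a4 := a 4) (M := M1 hU a) ?_ ?_ ?_ rfl
  · rw [Hext]; congr 2; abel
  · rw [M1, lrlOp]; congr 2; abel
  · have h := sum_coord_sq (U := U)
    rw [Fin.sum_univ_four] at h
    linear_combination -7 * inv3 hU ^ 2 * h

theorem K3_commute (hU : U ≤ region3) (a : Fin 5 → ℂ) : Commute (K3 hU a) (Hext hU a) := by
  refine quartic_symmetry (hU.trans region3_le) (c := 0) (i := 1) (j := 2) (by decide)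
    (coord0_mul_inv1 (hU.trans region3_le)) (coord1_mul_inv2 (hU.trans region3_le))
    (coord2_mul_inv3 hU) (a0 := a 0) (αc := a 1) (αi := a 2) (αj := a 3)
    (a4 := a 4) (M := M3 hU a) ?_ ?_ ?_ rfl
  · rw [Hext]
  · rw [M3, lrlOp]; congr 2; abel
  · have h := sum_coord_sq (U := U)
    rw [Fin.sum_univ_four] at h
    linear_combination -7 * inv1 (hU.trans region3_le) ^ 2 * h

/-! ### Specialization to a vanishing pole at s₃ = 0. -/

theorem Hext_eq_Hcoul (hU : U ≤ region3) (b : Fin 4 → ℂ) :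
    Hext hU ![b 0, b 1, b 2, 0, b 3] = Hcoul (hU.trans region3_le) b := by
  simp [Hext, Hcoul]

theorem L12_eq_Lc12 (hU : U ≤ region3) (b : Fin 4 → ℂ) :
    L12 hU ![b 0, b 1, b 2, 0, b 3] = Lc12 (hU.trans region3_le) b := by
  simp [L12, Lc12]

theorem L13_eq_Lc13 (hU : U ≤ region3) (b : Fin 4 → ℂ) :
    L13 hU ![b 0, b 1, b 2, 0, b 3] = Lc13 (hU.trans region3_le) b := by
  simp [L13, Lc13]

theorem L23_eq_Lc23 (hU : U ≤ region3) (b : Fin 4 → ℂ) :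
    L23 hU ![b 0, b 1, b 2, 0, b 3] = Lc23 (hU.trans region3_le) b := by
  simp [L23, Lc23]

/-- The corrections to -4 M₁² all carry the factor a₃, and 2 M₁ becomes L when a₃ = 0. -/
theorem K1_eq_neg_Lc_sq (hU : U ≤ region3) (b : Fin 4 → ℂ) :
    K1 hU ![b 0, b 1, b 2, 0, b 3] = -(Lc (hU.trans region3_le) b ^ 2) := by
  have h : M1 hU ![b 0, b 1, b 2, 0, b 3] = (1 / 2 : ℂ) • Lc (hU.trans region3_le) b := by
    apply LinearMap.ext; intro f
    have h2 : algebraMap ℂ (Smooth U) (1 / 2) * 2 = 1 := by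
      rw [← map_ofNat (algebraMap ℂ (Smooth U)) 2, ← map_mul]; norm_num
    have h3 : algebraMap ℂ (Smooth U) (b 0 / 2) = algebraMap ℂ (Smooth U) (1 / 2) *
      algebraMap ℂ (Smooth U) (b 0) := by rw [← map_mul]; congr 1; ring
    have e : ![b 0, b 1, b 2, 0, b 3] 0 = b 0 ∧ ![b 0, b 1, b 2, 0, b 3] 1 = b 1 ∧
      ![b 0, b 1, b 2, 0, b 3] 2 = b 2 ∧ ![b 0, b 1, b 2, 0, b 3] 3 = 0 := ⟨rfl, rfl, rfl, rfl⟩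
    simp only [M1, Lc, e, LinearMap.sub_apply, LinearMap.add_apply, LinearMap.smul_apply,
      mulOp_apply]
    simp only [Algebra.smul_def, h3, map_ofNat, map_zero]
    linear_combination (coord 2 * coord 3 * f * (algebraMap ℂ (Smooth U) (b 1) *
      inv1 (hU.trans region3_le) ^ 2 + algebraMap ℂ (Smooth U) (b 2) *
      inv2 (hU.trans region3_le) ^ 2)) * h2
  have e3 : ![b 0, b 1, b 2, 0, b 3] 3 = 0 := rfl
  rw [K1, h, smul_pow, smul_smul, e3, zero_smul, zero_smul, map_zero, symm, mul_zero, zero_mul]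
  norm_num
  exact sub_zero (-(Lc (hU.trans region3_le) b ^ 2))

/-! ### Filtration of the differential operators -/

theorem mulOp_mem (f : Smooth U) : mulOp f ∈ diffOp U 0 := ⟨f, rfl⟩

theorem diffOp_le_succ (n : ℕ) : diffOp U n ≤ diffOp U (n + 1) := le_sup_left

theorem diffOp_mono {m n : ℕ} (h : m ≤ n) : diffOp U m ≤ diffOp U n :=
  monotone_nat_of_le_succ diffOp_le_succ h

theorem J_mul_mem (j k : Fin 4) {n : ℕ} {A : Op U} (hA : A ∈ diffOp U n) :
    J j k * A ∈ diffOp U (n + 1) := by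
  refine Submodule.mem_sup_right ?_
  refine Submodule.mem_iSup_of_mem j (Submodule.mem_iSup_of_mem k ?_)
  exact ⟨A, hA, rfl⟩

theorem one_mem_diffOp : (1 : Op U) ∈ diffOp U 0 := ⟨1, by
  apply LinearMap.ext; intro f; rw [mulOp_apply, one_mul, Module.End.one_apply]⟩

theorem J_mem (j k : Fin 4) : (J j k : Op U) ∈ diffOp U 1 := by
  have h := J_mul_mem j k (one_mem_diffOp (U := U))
  rwa [mul_one] at h

/-- An induction principle for differential operators. -/
theorem diffOp_induction {n : ℕ} {P : Op U → Prop} (h0 : ∀ A ∈ diffOp U n, P A)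
    (hJ : ∀ j k, ∀ A ∈ diffOp U n, P (J j k * A)) (hadd : ∀ A B, P A → P B → P (A + B))
    {A : Op U} (hA : A ∈ diffOp U (n + 1)) : P A := by
  obtain ⟨B, hB, C, hC, rfl⟩ := Submodule.mem_sup.1 hA
  refine hadd _ _ (h0 B hB) ?_
  have hz : P 0 := h0 0 (zero_mem _)
  refine Submodule.iSup_induction _ (motive := P) hC (fun j D hD => ?_) hz hadd
  refine Submodule.iSup_induction _ (motive := P) hD (fun k D hD => ?_) hz hadd
  obtain ⟨D', hD', rfl⟩ := hD
  exact hJ j k D' hD'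

theorem J_mul_apply (j k : Fin 4) (f g : Smooth U) : J j k (f * g) = f * J j k g + g * J j k f := by
  simp only [J_eq, E_mul]; ring

theorem mulOp_mul_J (f : Smooth U) (j k : Fin 4) :
    mulOp f * J j k = J j k * mulOp f - mulOp (J j k f) := by
  apply LinearMap.ext; intro g
  simp only [Module.End.mul_apply, LinearMap.sub_apply, mulOp_apply, J_mul_apply]; ring

theorem mulOp_mul_mulOp (f g : Smooth U) : mulOp f * mulOp g = mulOp (f * g) := by
  apply LinearMap.ext; intro h
  simp only [Module.End.mul_apply, mulOp_apply]; ring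

theorem op_sub_mul (A B C : Op U) : (A - B) * C = A * C - B * C := sub_mul A B C

theorem op_smul_sub (c : ℂ) (A B : Op U) : c • (A - B) = c • A - c • B := smul_sub c A B

theorem op_sub_self (A : Op U) : A - A = 0 := sub_self A

theorem op_sub_eq (A B : Op U) : A - B = A + (-1 : ℂ) • B := by
  apply LinearMap.ext; intro g
  simp only [LinearMap.sub_apply, LinearMap.add_apply, LinearMap.smul_apply]
  rw [neg_one_smul, sub_eq_add_neg]

theorem op_neg_eq (A : Op U) : -A = (-1 : ℂ) • A := by
  apply LinearMap.ext; intro g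
  simp only [LinearMap.neg_apply, LinearMap.smul_apply]
  rw [neg_one_smul]

theorem op_neg_mem {W : Submodule ℂ (Op U)} {A : Op U} (hA : A ∈ W) : -A ∈ W := by
  rw [op_neg_eq]
  exact W.smul_mem _ hA

theorem op_sub_mem {W : Submodule ℂ (Op U)} {A B : Op U} (hA : A ∈ W) (hB : B ∈ W) :
    A - B ∈ W := by
  rw [op_sub_eq]
  exact add_mem hA (W.smul_mem _ hB)

/-- In `diffOp` the rotations stand on the left, so a multiplication has to be commuted past them;
the commutator is multiplication by J f and costs no order. Hence `f` must vary in the induction. -/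
theorem mulOp_mul_mem (f : Smooth U) {n : ℕ} : ∀ {A : Op U}, A ∈ diffOp U n →
    mulOp f * A ∈ diffOp U n := by
  induction n generalizing f with
  | zero =>
    rintro A ⟨g, rfl⟩
    rw [mulOp_mul_mulOp]; exact mulOp_mem _
  | succ n ih =>
    intro A hA
    refine diffOp_induction (P := fun A => mulOp f * A ∈ diffOp U (n + 1))
      (fun A hA => diffOp_le_succ n (ih f hA)) (fun j k A hA => ?_) (fun A B hA hB => ?_) hA
    · rw [← mul_assoc, mulOp_mul_J, op_sub_mul, mul_assoc]
      exact op_sub_mem (J_mul_mem j k (ih f hA)) (diffOp_le_succ n (ih _ hA))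
    · rw [mul_add]; exact add_mem hA hB

theorem mul_mem_diffOp {m n : ℕ} {A B : Op U} (hA : A ∈ diffOp U m) (hB : B ∈ diffOp U n) :
    A * B ∈ diffOp U (m + n) := by
  induction m generalizing A with
  | zero =>
    obtain ⟨f, rfl⟩ := hA
    rw [zero_add]; exact mulOp_mul_mem f hB
  | succ m ih =>
    refine diffOp_induction (P := fun A => A * B ∈ diffOp U (m + 1 + n))
      (fun A hA => diffOp_mono (by omega) (ih hA)) (fun j k A hA => ?_) (fun A C hA hC => ?_) hA
    · rw [mul_assoc, show m + 1 + n = (m + n) + 1 by ring]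
      exact J_mul_mem j k (ih hA)
    · rw [add_mul]; exact add_mem hA hC

theorem mulOp_mem' (f : Smooth U) (n : ℕ) : mulOp f ∈ diffOp U n :=
  diffOp_mono (Nat.zero_le n) (mulOp_mem f)

theorem JJ_mem (i j k l : Fin 4) : (J i j * J k l : Op U) ∈ diffOp U 2 :=
  mul_mem_diffOp (J_mem i j) (J_mem k l)

theorem J_sq_mem (i j : Fin 4) : (J i j ^ 2 : Op U) ∈ diffOp U 2 := by
  rw [pow_two]; exact JJ_mem i j i j

theorem symm_mem {m n : ℕ} {A B : Op U} (hA : A ∈ diffOp U m) (hB : B ∈ diffOp U n) :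
    symm A B ∈ diffOp U (m + n) :=
  add_mem (mul_mem_diffOp hA hB) (by rw [add_comm m n]; exact mul_mem_diffOp hB hA)

theorem laplaceBeltrami_mem : (laplaceBeltrami : Op U) ∈ diffOp U 2 :=
  add_mem (add_mem (add_mem (add_mem (add_mem (J_sq_mem 0 1) (J_sq_mem 0 2)) (J_sq_mem 0 3))
    (J_sq_mem 1 2)) (J_sq_mem 1 3)) (J_sq_mem 2 3)

theorem E_mem (i : Fin 4) : (E i : Op U) ∈ diffOp U 1 :=
  sum_mem fun j _ => mulOp_mul_mem _ (J_mem j i)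

/-! ### Commutators with functions -/

/-- The commutator `[B, f]` with a function. -/
def ad (f : Smooth U) (B : Op U) : Op U := B * mulOp f - mulOp f * B

theorem ad_add (f : Smooth U) (A B : Op U) : ad f (A + B) = ad f A + ad f B := by
  simp only [ad, add_mul, mul_add]; abel

theorem ad_smul (f : Smooth U) (c : ℂ) (A : Op U) : ad f (c • A) = c • ad f A := by
  rw [ad, ad, op_smul_sub, smul_mul_assoc, mul_smul_comm]

theorem ad_mul (f : Smooth U) (A B : Op U) : ad f (A * B) = ad f A * B + A * ad f B := by
  apply LinearMap.ext; intro g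
  simp only [ad, Module.End.mul_apply, LinearMap.sub_apply, LinearMap.add_apply, map_sub]
  abel

theorem ad_mulOp (f g : Smooth U) : ad f (mulOp g) = 0 := by
  rw [ad, mulOp_mul_mulOp, mulOp_mul_mulOp, mul_comm, op_sub_self]

theorem ad_J (f : Smooth U) (j k : Fin 4) : ad f (J j k) = mulOp (J j k f) := by
  apply LinearMap.ext; intro g
  simp only [ad, Module.End.mul_apply, LinearMap.sub_apply, mulOp_apply, J_mul_apply]; ring

theorem ad_of_mem_zero (f : Smooth U) {A : Op U} (hA : A ∈ diffOp U 0) : ad f A = 0 := by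
  obtain ⟨g, rfl⟩ := hA
  exact ad_mulOp f g

theorem ad_mem (f : Smooth U) {n : ℕ} {A : Op U} (hA : A ∈ diffOp U (n + 1)) :
    ad f A ∈ diffOp U n := by
  induction n generalizing A with
  | zero =>
    refine diffOp_induction (P := fun A => ad f A ∈ diffOp U 0)
      (fun A hA => by rw [ad_of_mem_zero f hA]; exact zero_mem _) (fun j k A hA => ?_)
      (fun A B hA hB => ?_) hA
    · rw [ad_mul, ad_of_mem_zero f hA, mul_zero, add_zero, ad_J]
      exact mulOp_mul_mem _ hA
    · rw [ad_add]; exact add_mem hA hB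
  | succ n ih =>
    refine diffOp_induction (P := fun A => ad f A ∈ diffOp U (n + 1))
      (fun A hA => diffOp_le_succ n (ih hA)) (fun j k A hA => ?_)
      (fun A B hA hB => ?_) hA
    · rw [ad_mul, ad_J]
      exact add_mem (mulOp_mul_mem _ hA) (J_mul_mem j k (ih hA))
    · rw [ad_add]; exact add_mem hA hB

/-! ### Symbols -/

/-- The linear form `ℓ = ∑ ξ_i s_i` as a function on `U`. -/
def linForm (ξ : E4) : Smooth U := ∑ i, ((ξ i : ℝ) : ℂ) • coord i

theorem symbol_eq (n : ℕ) (D : Op U) (p : U) (ξ : E4) :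
    symbol n D p ξ = ((n.factorial : ℂ))⁻¹ * ((ad (linForm ξ))^[n] D 1).1 p := rfl

theorem ad_iterate_add (f : Smooth U) (n : ℕ) (A B : Op U) :
    (ad f)^[n] (A + B) = (ad f)^[n] A + (ad f)^[n] B := by
  induction n generalizing A B with
  | zero => rfl
  | succ n ih => rw [Function.iterate_succ_apply, ad_add, ih]; rfl

theorem ad_iterate_smul (f : Smooth U) (n : ℕ) (c : ℂ) (A : Op U) :
    (ad f)^[n] (c • A) = c • (ad f)^[n] A := by
  induction n generalizing A with
  | zero => rfl
  | succ n ih => rw [Function.iterate_succ_apply, ad_smul, ih]; rfl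

theorem ad_iterate_mem (f : Smooth U) {n : ℕ} {A : Op U} (hA : A ∈ diffOp U n) :
    (ad f)^[n] A ∈ diffOp U 0 := by
  induction n generalizing A with
  | zero => exact hA
  | succ n ih => exact ih (ad_mem f hA)

theorem ad_iterate_eq_zero (f : Smooth U) {n : ℕ} {A : Op U} (hA : A ∈ diffOp U n) :
    (ad f)^[n + 1] A = 0 := by
  rw [Function.iterate_succ_apply']
  exact ad_of_mem_zero f (ad_iterate_mem f hA)

theorem symbol_add (n : ℕ) (A B : Op U) (p : U) (ξ : E4) :
    symbol n (A + B) p ξ = symbol n A p ξ + symbol n B p ξ := by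
  simp only [symbol_eq, ad_iterate_add]
  exact mul_add _ _ _

theorem symbol_smul (n : ℕ) (c : ℂ) (A : Op U) (p : U) (ξ : E4) :
    symbol n (c • A) p ξ = c * symbol n A p ξ := by
  simp only [symbol_eq, ad_iterate_smul]
  exact mul_left_comm _ _ _

theorem symbol_sub (n : ℕ) (A B : Op U) (p : U) (ξ : E4) :
    symbol n (A - B) p ξ = symbol n A p ξ - symbol n B p ξ := by
  rw [op_sub_eq, symbol_add, symbol_smul]; ring

theorem symbol_eq_zero {n : ℕ} {A : Op U} (hA : A ∈ diffOp U n) (p : U) (ξ : E4) :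
    symbol (n + 1) A p ξ = 0 := by
  rw [symbol_eq, ad_iterate_eq_zero _ hA]
  exact mul_zero _

theorem J_linForm (j k : Fin 4) (p : U) (ξ : E4) :
    (J j k (linForm ξ : Smooth U)).1 p =
      (((p : E4) j * ξ k - (p : E4) k * ξ j : ℝ) : ℂ) := by
  have h : J j k (linForm ξ : Smooth U) = ∑ i, ((ξ i : ℝ) : ℂ) • J j k (coord i) := by
    simp only [linForm, map_sum, map_smul]
  have h2 : ∀ i, J j k (coord i : Smooth U) =
      coord j * (if k = i then 1 else 0) - coord k * (if j = i then 1 else 0) := fun i => by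
    rw [J_eq, E_coord, E_coord]; ring
  rw [h]
  simp only [h2, mul_ite, mul_one, mul_zero, smul_sub, smul_ite, smul_zero, Finset.sum_sub_distrib,
    Finset.sum_ite_eq, Finset.mem_univ, if_true]
  change (ξ k : ℂ) * ((p : E4) j : ℂ) - (ξ j : ℂ) * ((p : E4) k : ℂ) = _
  push_cast; ring

theorem symbol_JJ (i j k l : Fin 4) (p : U) (ξ : E4) :
    symbol 2 (J i j * J k l : Op U) p ξ =
      (((p : E4) i * ξ j - (p : E4) j * ξ i) * ((p : E4) k * ξ l - (p : E4) l * ξ k) : ℝ) := by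
  have h : (ad (linForm ξ))^[2] (J i j * J k l : Op U) =
      (2 : ℂ) • (mulOp (J i j (linForm ξ) * J k l (linForm ξ)) : Op U) := by
    simp only [Function.iterate_succ_apply', Function.iterate_zero, id_eq, ad_mul, ad_add, ad_J,
      ad_mulOp, zero_mul, mul_zero, add_zero, zero_add, mulOp_mul_mulOp]
    rw [two_smul]
  rw [symbol_eq, h]
  change _ * (2 * ((J i j (linForm ξ)).1 p * (J k l (linForm ξ)).1 p * 1)) = _
  rw [J_linForm, J_linForm]
  simp [Nat.factorial]

/-- In the Leibniz expansion of the fourth commutator of AB, three commutators kill either factor,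
so only the binomial(4, 2) = 6 balanced terms survive; and 6/4! = (1/2!)². -/
theorem symbol_mul {A B : Op U} (hA : A ∈ diffOp U 2) (hB : B ∈ diffOp U 2) (p : U) (ξ : E4) :
    symbol 4 (A * B) p ξ = symbol 2 A p ξ * symbol 2 B p ξ := by
  have hA3 := ad_iterate_eq_zero (linForm ξ) hA
  have hB3 := ad_iterate_eq_zero (linForm ξ) hB
  obtain ⟨f, hf⟩ := ad_iterate_mem (linForm ξ) hA
  obtain ⟨g, hg⟩ := ad_iterate_mem (linForm ξ) hB
  rw [symbol_eq, symbol_eq, symbol_eq]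
  simp only [Function.iterate_succ_apply', Function.iterate_zero, id_eq, Nat.reduceAdd] at *
  rw [← hf, ← hg]
  simp only [ad_mul, ad_add, ← hf, ← hg, ad_mulOp, zero_mul, mul_zero, add_zero, zero_add,
    mulOp_mul_mulOp]
  have hsix : (((mulOp (f * g) + (mulOp (f * g) + mulOp (f * g)) +
      (mulOp (f * g) + mulOp (f * g) + mulOp (f * g)) : Op U) 1)).1 p = 6 * (f.1 p * g.1 p) := by
    change f.1 p * g.1 p * 1 + (f.1 p * g.1 p * 1 + f.1 p * g.1 p * 1) +
      (f.1 p * g.1 p * 1 + f.1 p * g.1 p * 1 + f.1 p * g.1 p * 1) = _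
    ring
  rw [hsix]
  change _ = _ * (f.1 p * 1) * (_ * (g.1 p * 1))
  simp only [Nat.factorial]
  push_cast
  ring

/-! ### The symmetries as differential operators -/

theorem Hext_mem (hU : U ≤ region3) (a : Fin 5 → ℂ) : Hext hU a ∈ diffOp U 2 :=
  add_mem laplaceBeltrami_mem (mulOp_mem' _ 2)

theorem Hcoul_mem (hU : U ≤ region2) (b : Fin 4 → ℂ) : Hcoul hU b ∈ diffOp U 2 :=
  add_mem laplaceBeltrami_mem (mulOp_mem' _ 2)

theorem L12_mem (hU : U ≤ region3) (a : Fin 5 → ℂ) : L12 hU a ∈ diffOp U 2 :=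
  add_mem (J_sq_mem 0 1) (mulOp_mem' _ 2)

theorem L13_mem (hU : U ≤ region3) (a : Fin 5 → ℂ) : L13 hU a ∈ diffOp U 2 :=
  add_mem (J_sq_mem 0 2) (mulOp_mem' _ 2)

theorem L23_mem (hU : U ≤ region3) (a : Fin 5 → ℂ) : L23 hU a ∈ diffOp U 2 :=
  add_mem (J_sq_mem 1 2) (mulOp_mem' _ 2)

theorem Lc12_mem (hU : U ≤ region2) (b : Fin 4 → ℂ) : Lc12 hU b ∈ diffOp U 2 :=
  add_mem (J_sq_mem 0 1) (mulOp_mem' _ 2)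

theorem Lc13_mem (hU : U ≤ region2) (b : Fin 4 → ℂ) : Lc13 hU b ∈ diffOp U 2 :=
  add_mem (J_sq_mem 0 2) (mulOp_mem' _ 2)

theorem Lc23_mem (hU : U ≤ region2) (b : Fin 4 → ℂ) : Lc23 hU b ∈ diffOp U 2 :=
  add_mem (J_sq_mem 1 2) (mulOp_mem' _ 2)

theorem Lc_mem (hU : U ≤ region2) (b : Fin 4 → ℂ) : Lc hU b ∈ diffOp U 2 :=
  op_sub_mem (op_sub_mem (add_mem (symm_mem (J_mem _ _) (J_mem _ _))
    (symm_mem (J_mem _ _) (J_mem _ _))) (mulOp_mem' _ 2)) (mulOp_mem' _ 2)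

theorem M1_mem (hU : U ≤ region3) (a : Fin 5 → ℂ) : M1 hU a ∈ diffOp U 2 :=
  op_sub_mem (Submodule.smul_mem _ _ (add_mem (symm_mem (J_mem _ _) (J_mem _ _))
    (symm_mem (J_mem _ _) (J_mem _ _)))) (mulOp_mem' _ 2)

theorem M3_mem (hU : U ≤ region3) (a : Fin 5 → ℂ) : M3 hU a ∈ diffOp U 2 :=
  op_sub_mem (Submodule.smul_mem _ _ (add_mem (symm_mem (J_mem _ _) (J_mem _ _))
    (symm_mem (J_mem _ _) (J_mem _ _)))) (mulOp_mem' _ 2)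

theorem X_mem : (X : Op U) ∈ diffOp U 1 :=
  add_mem (add_mem (symm_mem (mulOp_mem _) (J_mem _ _)) (symm_mem (mulOp_mem _) (J_mem _ _)))
    (symm_mem (mulOp_mem _) (J_mem _ _))

theorem X_sq_symm_mem (f : Smooth U) : symm (U := U) (X ^ 2) (mulOp f) ∈ diffOp U 2 := by
  rw [pow_two]
  exact symm_mem (mul_mem_diffOp X_mem X_mem) (mulOp_mem f)

theorem M_sq_mem {A : Op U} (hA : A ∈ diffOp U 2) : A ^ 2 ∈ diffOp U 4 := by
  rw [pow_two]; exact mul_mem_diffOp hA hA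

theorem K_add_mem (f g : Smooth U) {A : Op U} (hA : A ∈ diffOp U 2) :
    -((4 : ℂ) • A ^ 2) - (1 / 2 : ℂ) • symm (U := U) (X ^ 2) (mulOp f) + mulOp g ∈
      diffOp U 4 :=
  add_mem (op_sub_mem (op_neg_mem (Submodule.smul_mem _ _ (M_sq_mem hA)))
    (Submodule.smul_mem _ _ (diffOp_mono (by norm_num) (X_sq_symm_mem f)))) (mulOp_mem' _ 4)

theorem K1_mem (hU : U ≤ region3) (a : Fin 5 → ℂ) : K1 hU a ∈ diffOp U 4 :=
  K_add_mem _ _ (M1_mem hU a)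

theorem K3_mem (hU : U ≤ region3) (a : Fin 5 → ℂ) : K3 hU a ∈ diffOp U 4 :=
  K_add_mem _ _ (M3_mem hU a)

/-! ### Their symbols -/

theorem symbol_of_lt {m n : ℕ} (h : m < n) {A : Op U} (hA : A ∈ diffOp U m) (p : U) (ξ : E4) :
    symbol n A p ξ = 0 := by
  obtain ⟨k, rfl⟩ := Nat.exists_eq_add_of_lt h
  exact symbol_eq_zero (diffOp_mono (Nat.le_add_right m k) hA) p ξ

theorem symbol_add_mulOp (n : ℕ) (A : Op U) (f : Smooth U) (p : U) (ξ : E4) :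
    symbol (n + 1) (A + mulOp f) p ξ = symbol (n + 1) A p ξ := by
  rw [symbol_add, symbol_of_lt (Nat.succ_pos n) (mulOp_mem f), add_zero]

theorem symbol_sub_mulOp (n : ℕ) (A : Op U) (f : Smooth U) (p : U) (ξ : E4) :
    symbol (n + 1) (A - mulOp f) p ξ = symbol (n + 1) A p ξ := by
  rw [symbol_sub, symbol_of_lt (Nat.succ_pos n) (mulOp_mem f), sub_zero]

/-- The symbol of `J j k`. -/
def rotSym (j k : Fin 4) (x ξ : E4) : ℝ := x j * ξ k - x k * ξ j

theorem symbol_J_sq (j k : Fin 4) (p : U) (ξ : E4) :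
    symbol 2 (J j k ^ 2 : Op U) p ξ = ((rotSym j k p ξ ^ 2 : ℝ) : ℂ) := by
  rw [pow_two, symbol_JJ, rotSym, pow_two]

theorem symbol_symm_J (i j k l : Fin 4) (p : U) (ξ : E4) :
    symbol 2 (symm (U := U) (J i j) (J k l)) p ξ =
      ((2 * (rotSym i j p ξ * rotSym k l p ξ) : ℝ) : ℂ) := by
  rw [symm, symbol_add, symbol_JJ, symbol_JJ, rotSym, rotSym]
  push_cast; ring

/-- The symbol of the Laplace–Beltrami operator. -/
def lapSym (x ξ : E4) : ℝ :=
  rotSym 0 1 x ξ ^ 2 + rotSym 0 2 x ξ ^ 2 + rotSym 0 3 x ξ ^ 2 + rotSym 1 2 x ξ ^ 2 +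
    rotSym 1 3 x ξ ^ 2 + rotSym 2 3 x ξ ^ 2

theorem symbol_laplaceBeltrami (p : U) (ξ : E4) :
    symbol 2 (laplaceBeltrami : Op U) p ξ = ((lapSym p ξ : ℝ) : ℂ) := by
  rw [laplaceBeltrami]
  simp only [symbol_add, symbol_J_sq, lapSym]
  push_cast; ring

theorem symbol_add_mulOp_two (A : Op U) (f : Smooth U) (p : U) (ξ : E4) :
    symbol 2 (A + mulOp f) p ξ = symbol 2 A p ξ := symbol_add_mulOp 1 A f p ξ

theorem symbol_sub_mulOp_two (A : Op U) (f : Smooth U) (p : U) (ξ : E4) :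
    symbol 2 (A - mulOp f) p ξ = symbol 2 A p ξ := symbol_sub_mulOp 1 A f p ξ

theorem symbol_Lc (hU : U ≤ region2) (b : Fin 4 → ℂ) (p : U) (ξ : E4) :
    symbol 2 (Lc hU b) p ξ = ((2 * (rotSym 0 2 p ξ * rotSym 3 0 p ξ +
      rotSym 1 2 p ξ * rotSym 3 1 p ξ) : ℝ) : ℂ) := by
  rw [Lc, symbol_sub_mulOp_two, symbol_sub_mulOp_two, symbol_add, symbol_symm_J, symbol_symm_J]
  push_cast; ring

theorem symbol_M1 (hU : U ≤ region3) (a : Fin 5 → ℂ) (p : U) (ξ : E4) :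
    symbol 2 (M1 hU a) p ξ = ((rotSym 1 2 p ξ * rotSym 3 1 p ξ +
      rotSym 0 2 p ξ * rotSym 3 0 p ξ : ℝ) : ℂ) := by
  rw [M1, symbol_sub_mulOp_two, symbol_smul, symbol_add, symbol_symm_J, symbol_symm_J]
  push_cast; ring

theorem symbol_M3 (hU : U ≤ region3) (a : Fin 5 → ℂ) (p : U) (ξ : E4) :
    symbol 2 (M3 hU a) p ξ = ((rotSym 1 0 p ξ * rotSym 3 1 p ξ +
      rotSym 2 0 p ξ * rotSym 3 2 p ξ : ℝ) : ℂ) := by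
  rw [M3, symbol_sub_mulOp_two, symbol_smul, symbol_add, symbol_symm_J, symbol_symm_J]
  push_cast; ring

/-- The corrections have order at most two and are invisible at order four. -/
theorem symbol_K (f g : Smooth U) {A : Op U} (hA : A ∈ diffOp U 2) (p : U) (ξ : E4) :
    symbol 4 (-((4 : ℂ) • A ^ 2) - (1 / 2 : ℂ) • symm (U := U) (X ^ 2) (mulOp f) + mulOp g) p ξ =
      -4 * symbol 2 A p ξ ^ 2 := by
  rw [symbol_add_mulOp 3, symbol_sub, symbol_smul, symbol_of_lt (by norm_num) (X_sq_symm_mem f),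
    op_neg_eq, symbol_smul, symbol_smul, pow_two A, symbol_mul hA hA]
  ring

theorem symbol_K1 (hU : U ≤ region3) (a : Fin 5 → ℂ) (p : U) (ξ : E4) :
    symbol 4 (K1 hU a) p ξ = ((-4 * (rotSym 1 2 p ξ * rotSym 3 1 p ξ +
      rotSym 0 2 p ξ * rotSym 3 0 p ξ) ^ 2 : ℝ) : ℂ) := by
  rw [K1, symbol_K _ _ (M1_mem hU a), symbol_M1]
  push_cast; ring

theorem symbol_K3 (hU : U ≤ region3) (a : Fin 5 → ℂ) (p : U) (ξ : E4) :
    symbol 4 (K3 hU a) p ξ = ((-4 * (rotSym 1 0 p ξ * rotSym 3 1 p ξ +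
      rotSym 2 0 p ξ * rotSym 3 2 p ξ) ^ 2 : ℝ) : ℂ) := by
  rw [K3, symbol_K _ _ (M3_mem hU a), symbol_M3]
  push_cast; ring

/-! ### Differentials of symbols -/

/-- At a unit vector the derivative of x ↦ x/‖x‖ is the projection along the radius; only its effect
on tangent vectors is needed. -/
theorem hasFDerivAt_normalize (p : U) : ∃ N' : E4 →L[ℝ] E4,
    HasFDerivAt (fun y : E4 => ‖y‖⁻¹ • y) N' (p : E4) ∧
      ∀ v : E4, inner ℝ (p : E4) v = 0 → N' v = v := by
  have h0 := Complex.reCLM.hasFDerivAt.comp (p : E4) (hasFDerivAt_norm_coe p)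
  have h1 : HasFDerivAt (fun x : E4 => ‖x‖) (innerSL ℝ (p : E4)) (p : E4) := h0
  have hne : ‖(p : E4)‖ ≠ 0 := by rw [norm_coe]; exact one_ne_zero
  have h2 := ((hasDerivAt_inv hne).comp_hasFDerivAt (p : E4) h1).smul (hasFDerivAt_id (p : E4))
  refine ⟨_, h2, fun v hv => ?_⟩
  simp [hv]

/-- A symbol is the restriction of an ambient function F, while its differential is defined through
the radial extension. Along tangential directions both have the same derivative, so differentials of
symbols can be tested on straight lines in the ambient space. -/
theorem fderiv_symbol_apply {F : E4 × E4 → ℝ} (hF : Differentiable ℝ F) {σ : U → E4 → ℂ}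
    (hσ : ∀ (p : U) ξ, σ p ξ = ((F ((p : E4), ξ) : ℝ) : ℂ)) (p : U) (ξ : E4) {v w : E4}
    (hv : inner ℝ (p : E4) v = 0) {d : ℝ}
    (hd : HasDerivAt (fun t : ℝ => F ((p : E4) + t • v, ξ + t • w)) d 0) :
    fderiv ℝ (fun y : E4 × E4 => radialExt (fun q : U => σ q y.2) y.1) ((p : E4), ξ) (v, w) =
      (d : ℂ) := by
  obtain ⟨N', hN, hN'⟩ := hasFDerivAt_normalize p
  have hN2 : HasFDerivAt (fun y : E4 × E4 => (‖y.1‖⁻¹ • y.1, y.2))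
      ((N'.comp (ContinuousLinearMap.fst ℝ E4 E4)).prod (ContinuousLinearMap.snd ℝ E4 E4))
      ((p : E4), ξ) := by
    refine HasFDerivAt.prodMk ?_ hasFDerivAt_snd
    exact HasFDerivAt.comp (g := fun y : E4 => ‖y‖⁻¹ • y) ((p : E4), ξ) hN hasFDerivAt_fst
  have hp : (fun y : E4 × E4 => (‖y.1‖⁻¹ • y.1, y.2)) ((p : E4), ξ) = ((p : E4), ξ) := by
    simp
  have hFd : HasFDerivAt F (fderiv ℝ F ((p : E4), ξ))
      ((fun y : E4 × E4 => (‖y.1‖⁻¹ • y.1, y.2)) ((p : E4), ξ)) := by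
    rw [hp]; exact (hF _).hasFDerivAt
  have hcomp := Complex.ofRealCLM.hasFDerivAt.comp ((p : E4), ξ) (hFd.comp ((p : E4), ξ) hN2)
  have hev : (fun y : E4 × E4 => radialExt (fun q : U => σ q y.2) y.1) =ᶠ[nhds ((p : E4), ξ)]
      (Complex.ofRealCLM ∘ F ∘ fun y : E4 × E4 => (‖y.1‖⁻¹ • y.1, y.2)) := by
    have ho : IsOpen {y : E4 × E4 | y.1 ∈ cone U} := (isOpen_cone U).preimage continuous_fst
    filter_upwards [ho.mem_nhds (show ((p : E4), ξ) ∈ {y : E4 × E4 | y.1 ∈ cone U} from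
      coe_mem_cone p)] with y hy
    rw [radialExt_eq_conePoint _ hy, hσ, conePoint_eq]
    rfl
  rw [(hcomp.congr_of_eventuallyEq hev).fderiv]
  have hline : HasDerivAt (fun t : ℝ => F ((p : E4) + t • v, ξ + t • w))
      (fderiv ℝ F ((p : E4), ξ) (v, w)) 0 := by
    have hl : HasDerivAt (fun t : ℝ => ((p : E4) + t • v, ξ + t • w)) (v, w) 0 := by
      refine HasDerivAt.prodMk ?_ ?_
      · simpa using ((hasDerivAt_id (0 : ℝ)).smul_const v).const_add (p : E4)
      · simpa using ((hasDerivAt_id (0 : ℝ)).smul_const w).const_add ξ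
    have hF0 : HasFDerivAt F (fderiv ℝ F ((p : E4), ξ))
        ((fun t : ℝ => ((p : E4) + t • v, ξ + t • w)) 0) := by
      simpa using (hF ((p : E4), ξ)).hasFDerivAt
    exact hF0.comp_hasDerivAt (0 : ℝ) hl
  rw [← hline.unique hd]
  simp [hN' v hv]

/-- The directional derivative of the symbol of `J j k`. -/
def rotSymDeriv (j k : Fin 4) (x ξ v w : E4) : ℝ := rotSym j k v ξ + rotSym j k x w

theorem hasDerivAt_rotSym (j k : Fin 4) (x ξ v w : E4) :
    HasDerivAt (fun t : ℝ => rotSym j k (x + t • v) (ξ + t • w)) (rotSymDeriv j k x ξ v w) 0 := by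
  have h : ∀ (y u : E4) (i : Fin 4), HasDerivAt (fun t : ℝ => (y + t • u) i) (u i) 0 := by
    intro y u i
    simpa using ((hasDerivAt_id (0 : ℝ)).mul_const (u i)).const_add (y i)
  have e := ((h x v j).mul (h ξ w k)).sub ((h x v k).mul (h ξ w j))
  refine (e.congr_deriv ?_)
  simp [rotSymDeriv, rotSym]; ring

theorem hasDerivAt_rotSym_mul (i j k l : Fin 4) (x ξ v w : E4) :
    HasDerivAt (fun t : ℝ => rotSym i j (x + t • v) (ξ + t • w) * rotSym k l (x + t • v) (ξ + t • w))
      (rotSymDeriv i j x ξ v w * rotSym k l x ξ + rotSym i j x ξ * rotSymDeriv k l x ξ v w) 0 := by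
  have e := (hasDerivAt_rotSym i j x ξ v w).mul (hasDerivAt_rotSym k l x ξ v w)
  refine e.congr_deriv ?_
  simp

theorem hasDerivAt_rotSym_sq (j k : Fin 4) (x ξ v w : E4) :
    HasDerivAt (fun t : ℝ => rotSym j k (x + t • v) (ξ + t • w) ^ 2)
      (2 * rotSym j k x ξ * rotSymDeriv j k x ξ v w) 0 := by
  have e := (hasDerivAt_rotSym j k x ξ v w).pow 2
  refine e.congr_deriv ?_
  simp

theorem hasDerivAt_lapSym (x ξ v w : E4) :
    HasDerivAt (fun t : ℝ => lapSym (x + t • v) (ξ + t • w))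
      (2 * rotSym 0 1 x ξ * rotSymDeriv 0 1 x ξ v w + 2 * rotSym 0 2 x ξ * rotSymDeriv 0 2 x ξ v w +
        2 * rotSym 0 3 x ξ * rotSymDeriv 0 3 x ξ v w + 2 * rotSym 1 2 x ξ * rotSymDeriv 1 2 x ξ v w +
        2 * rotSym 1 3 x ξ * rotSymDeriv 1 3 x ξ v w +
        2 * rotSym 2 3 x ξ * rotSymDeriv 2 3 x ξ v w) 0 := by
  have h := fun j k => hasDerivAt_rotSym_sq j k x ξ v w
  exact ((((((h 0 1).add (h 0 2)).add (h 0 3)).add (h 1 2)).add (h 1 3)).add (h 2 3))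

theorem contDiff_rotSym (j k : Fin 4) : ContDiff ℝ ω (fun z : E4 × E4 => rotSym j k z.1 z.2) := by
  unfold rotSym; fun_prop

theorem contDiff_lapSym : ContDiff ℝ ω (fun z : E4 × E4 => lapSym z.1 z.2) := by
  have h := contDiff_rotSym
  exact ((((((h 0 1).pow 2).add ((h 0 2).pow 2)).add ((h 0 3).pow 2)).add ((h 1 2).pow 2)).add
    ((h 1 3).pow 2)).add ((h 2 3).pow 2)

theorem rotSym_zero_left (j k : Fin 4) (x : E4) : rotSym j k 0 x = 0 := by simp [rotSym]

theorem rotSym_zero_right (j k : Fin 4) (x : E4) : rotSym j k x 0 = 0 := by simp [rotSym]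

/-- The directions giving `α` and `β` leave the symbols of J₁₂, J₁₃, J₂₃ unchanged to first order.
On them a linear relation reduces to two equations for the coefficients of H and S, with determinant
`hdet`. After that, four directions that move the angular momentum force the other three
coefficients to vanish. -/
theorem linearIndependent_symbols {H A B C S : Op U} {k : ℕ} {G : E4 × E4 → ℝ}
    (hH : ∀ (p : U) ξ, symbol 2 H p ξ = ((lapSym p ξ : ℝ) : ℂ))
    (hA : ∀ (p : U) ξ, symbol 2 A p ξ = ((rotSym 0 1 p ξ ^ 2 : ℝ) : ℂ))
    (hB : ∀ (p : U) ξ, symbol 2 B p ξ = ((rotSym 0 2 p ξ ^ 2 : ℝ) : ℂ))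
    (hC : ∀ (p : U) ξ, symbol 2 C p ξ = ((rotSym 1 2 p ξ ^ 2 : ℝ) : ℂ))
    (hG : Differentiable ℝ G)
    (hS : ∀ (p : U) ξ, symbol k S p ξ = ((G ((p : E4), ξ) : ℝ) : ℂ)) (p : U) (ξ : E4) {α β : ℝ}
    (hα : HasDerivAt (fun t : ℝ => G ((p : E4) + t • (0 : E4), ξ + t • ev 3)) α 0)
    (hβ : HasDerivAt (fun t : ℝ => G ((p : E4) + t • !₂[(p : E4) 3 * (p : E4) 0,
      (p : E4) 3 * (p : E4) 1, (p : E4) 3 * (p : E4) 2, (p : E4) 3 ^ 2 - 1], ξ + t • -((p : E4) 3 • ξ)))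
      β 0)
    (h01 : rotSym 0 1 p ξ ≠ 0) (h02 : rotSym 0 2 p ξ ≠ 0) (h12 : rotSym 1 2 p ξ ≠ 0)
    (hp : (p : E4) 0 ≠ 0)
    (hdet : (rotSym 0 3 p ξ * (p : E4) 0 + rotSym 1 3 p ξ * (p : E4) 1 +
      rotSym 2 3 p ξ * (p : E4) 2) * β -
      (rotSym 0 3 p ξ * ξ 0 + rotSym 1 3 p ξ * ξ 1 + rotSym 2 3 p ξ * ξ 2) * α ≠ 0) :
    LinearIndependent ℂ fun i : Fin 5 =>
      fderiv ℝ (fun y : E4 × E4 => radialExt (fun q : U =>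
        symbol ((![2, 2, 2, 2, k] : Fin 5 → ℕ) i) ((![H, A, B, C, S] : Fin 5 → Op U) i) q y.2) y.1)
        ((p : E4), ξ) := by
  have hsq : (p : E4) 0 ^ 2 + (p : E4) 1 ^ 2 + (p : E4) 2 ^ 2 + (p : E4) 3 ^ 2 = (1 : ℝ) := by
    exact_mod_cast sum_sq p
  rw [Fintype.linearIndependent_iff]
  intro g hg
  have key : ∀ v w : E4, inner ℝ (p : E4) v = 0 →
      g 0 * ((2 * rotSym 0 1 p ξ * rotSymDeriv 0 1 p ξ v w +
        2 * rotSym 0 2 p ξ * rotSymDeriv 0 2 p ξ v w +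
        2 * rotSym 0 3 p ξ * rotSymDeriv 0 3 p ξ v w +
        2 * rotSym 1 2 p ξ * rotSymDeriv 1 2 p ξ v w +
        2 * rotSym 1 3 p ξ * rotSymDeriv 1 3 p ξ v w +
        2 * rotSym 2 3 p ξ * rotSymDeriv 2 3 p ξ v w : ℝ) : ℂ) +
      g 1 * ((2 * rotSym 0 1 p ξ * rotSymDeriv 0 1 p ξ v w : ℝ) : ℂ) +
      g 2 * ((2 * rotSym 0 2 p ξ * rotSymDeriv 0 2 p ξ v w : ℝ) : ℂ) +
      g 3 * ((2 * rotSym 1 2 p ξ * rotSymDeriv 1 2 p ξ v w : ℝ) : ℂ) +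
      g 4 * fderiv ℝ (fun y : E4 × E4 => radialExt (fun q : U => symbol k S q y.2) y.1)
        ((p : E4), ξ) (v, w) = 0 := by
    intro v w hv
    have e := congrArg (fun T : E4 × E4 →L[ℝ] ℂ => T (v, w)) hg
    rw [Fin.sum_univ_five] at e
    have c := fun j k => ((contDiff_rotSym j k).pow 2).differentiable (by simp)
    have e0 := fderiv_symbol_apply (contDiff_lapSym.differentiable (by simp)) hH p ξ hv
      (hasDerivAt_lapSym (p : E4) ξ v w)
    have e1 := fderiv_symbol_apply (c 0 1) hA p ξ hv (hasDerivAt_rotSym_sq 0 1 (p : E4) ξ v w)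
    have e2 := fderiv_symbol_apply (c 0 2) hB p ξ hv (hasDerivAt_rotSym_sq 0 2 (p : E4) ξ v w)
    have e3 := fderiv_symbol_apply (c 1 2) hC p ξ hv (hasDerivAt_rotSym_sq 1 2 (p : E4) ξ v w)
    rw [← e0, ← e1, ← e2, ← e3]
    exact e
  -- Moving only ξ₄ does not change the components 01, 02, 12 of the angular momentum.
  have ka := key 0 (ev 3) (inner_zero_right _)
  rw [fderiv_symbol_apply hG hS p ξ (inner_zero_right _) hα] at ka
  -- The vector is s₄ p - e₄, minus the gradient of s₄. It scales (s₁, s₂, s₃) by s₄ to first order,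
  -- and scaling ξ by -s₄ compensates this in the angular momentum.
  have hb : inner ℝ (p : E4) (!₂[(p : E4) 3 * (p : E4) 0,
      (p : E4) 3 * (p : E4) 1, (p : E4) 3 * (p : E4) 2, (p : E4) 3 ^ 2 - 1] : E4) = 0 := by
    simp [PiLp.inner_apply, Fin.sum_univ_four]
    linear_combination (p : E4) 3 * hsq
  have kb := key _ (-((p : E4) 3 • ξ)) hb
  rw [fderiv_symbol_apply hG hS p ξ hb hβ] at kb
  have hρ : ∀ v w : E4, v 3 = 0 → inner ℝ (p : E4) v = 0 → g 4 = 0 → g 0 = 0 →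
      g 1 * ((rotSym 0 1 p ξ * rotSymDeriv 0 1 p ξ v w : ℝ) : ℂ) +
      g 2 * ((rotSym 0 2 p ξ * rotSymDeriv 0 2 p ξ v w : ℝ) : ℂ) +
      g 3 * ((rotSym 1 2 p ξ * rotSymDeriv 1 2 p ξ v w : ℝ) : ℂ) = 0 := by
    intro v w _ hv h4 h0
    have e := key v w hv
    rw [h4, h0] at e
    push_cast at e ⊢
    linear_combination e / 2
  have ka' : g 0 * (2 * ((rotSym 0 3 p ξ * (p : E4) 0 + rotSym 1 3 p ξ * (p : E4) 1 +
      rotSym 2 3 p ξ * (p : E4) 2 : ℝ) : ℂ)) + g 4 * α = 0 := by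
    rw [← ka]
    simp [rotSymDeriv, rotSym, ev]
    left; ring
  have kb' : g 0 * (2 * ((rotSym 0 3 p ξ * ξ 0 + rotSym 1 3 p ξ * ξ 1 +
      rotSym 2 3 p ξ * ξ 2 : ℝ) : ℂ)) + g 4 * β = 0 := by
    rw [← kb]
    simp [rotSymDeriv, rotSym]
    ring
  have hdet' : ((((rotSym 0 3 p ξ * (p : E4) 0 + rotSym 1 3 p ξ * (p : E4) 1 +
      rotSym 2 3 p ξ * (p : E4) 2) * β -
      (rotSym 0 3 p ξ * ξ 0 + rotSym 1 3 p ξ * ξ 1 + rotSym 2 3 p ξ * ξ 2) * α : ℝ)) : ℂ) ≠ 0 :=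
    Complex.ofReal_ne_zero.2 hdet
  have h4 : g 4 = 0 := by
    refine (mul_eq_zero.1 ?_).resolve_right hdet'
    push_cast at ka' kb' ⊢
    linear_combination (rotSym 0 3 p ξ * (p : E4) 0 + rotSym 1 3 p ξ * (p : E4) 1 +
      rotSym 2 3 p ξ * (p : E4) 2 : ℂ) * kb' -
      (rotSym 0 3 p ξ * ξ 0 + rotSym 1 3 p ξ * ξ 1 + rotSym 2 3 p ξ * ξ 2 : ℂ) * ka'
  have h0 : g 0 = 0 := by
    rw [h4] at ka' kb'
    refine (mul_eq_zero.1 ?_).resolve_right hdet'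
    push_cast at ka' kb' ⊢
    linear_combination β / 2 * ka' - α / 2 * kb'
  have w0 := hρ 0 (ev 0) rfl (inner_zero_right _) h4 h0
  have w1 := hρ 0 (ev 1) rfl (inner_zero_right _) h4 h0
  have w2 := hρ 0 (ev 2) rfl (inner_zero_right _) h4 h0
  -- Varying ξ moves the angular momentum only within the plane orthogonal to (s₁, s₂, s₃). The
  -- missing direction comes from moving the point along the angular momentum vector itself, which
  -- is tangent to the sphere.
  have w3 := hρ !₂[rotSym 1 2 p ξ, -rotSym 0 2 p ξ, rotSym 0 1 p ξ, 0] 0 rfl (by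
    simp [PiLp.inner_apply, Fin.sum_univ_four, rotSym]; ring) h4 h0
  have c01 := Complex.ofReal_ne_zero.2 h01
  have c02 := Complex.ofReal_ne_zero.2 h02
  have c12 := Complex.ofReal_ne_zero.2 h12
  have cp := Complex.ofReal_ne_zero.2 hp
  have d01 : ((rotSym 0 1 p ξ : ℝ) : ℂ) = (p : E4) 0 * ξ 1 - (p : E4) 1 * ξ 0 := by
    simp [rotSym]
  have d02 : ((rotSym 0 2 p ξ : ℝ) : ℂ) = (p : E4) 0 * ξ 2 - (p : E4) 2 * ξ 0 := by
    simp [rotSym]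
  have d12 : ((rotSym 1 2 p ξ : ℝ) : ℂ) = (p : E4) 1 * ξ 2 - (p : E4) 2 * ξ 1 := by
    simp [rotSym]
  have hsum : ((rotSym 0 1 p ξ ^ 2 + rotSym 0 2 p ξ ^ 2 + rotSym 1 2 p ξ ^ 2 : ℝ) : ℂ) ≠ 0 :=
    Complex.ofReal_ne_zero.2 (by positivity)
  simp [rotSymDeriv, rotSym_zero_left, rotSym_zero_right] at w0 w1 w2 w3
  simp [rotSym, ev] at w0 w1 w2 w3
  push_cast at hsum
  rw [d01, d02, d12] at hsum
  rw [d01] at c01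
  rw [d02] at c02
  rw [d12] at c12
  have h3 : g 3 = 0 := by
    refine (mul_eq_zero.1 ?_).resolve_right (mul_ne_zero c12 hsum)
    linear_combination
      ((((p : E4) 1 : ℂ) * (ξ 2 : ℂ) - ((p : E4) 2 : ℂ) * (ξ 1 : ℂ)) * (ξ 1 : ℂ) +
        (((p : E4) 0 : ℂ) * (ξ 2 : ℂ) - ((p : E4) 2 : ℂ) * (ξ 0 : ℂ)) * (ξ 0 : ℂ)) * w1 +
      ((((p : E4) 1 : ℂ) * (ξ 2 : ℂ) -
        ((p : E4) 2 : ℂ) * (ξ 1 : ℂ)) * (ξ 2 : ℂ) -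
        (((p : E4) 0 : ℂ) * (ξ 1 : ℂ) -
        ((p : E4) 1 : ℂ) * (ξ 0 : ℂ)) * (ξ 0 : ℂ)) * w2 -
      ((p : E4) 0 : ℂ) * w3
  have h1 : g 1 = 0 := by
    rw [h3] at w1
    refine (mul_eq_zero.1 ?_).resolve_right (mul_ne_zero c01 cp)
    linear_combination w1
  have h2 : g 2 = 0 := by
    rw [h3] at w2
    refine (mul_eq_zero.1 ?_).resolve_right (mul_ne_zero c02 cp)
    linear_combination w2
  intro i
  fin_cases i <;> assumption

/-! ### Density -/

/-- Identity theorem: an analytic function that vanishes on a nonempty open set vanishes everywhere.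
-/
theorem dense_ne_zero_of_contDiff {Q : E4 → ℝ} (hQ : ContDiff ℝ ω Q) {ξ₀ : E4} (h : Q ξ₀ ≠ 0) :
    Dense {ξ | Q ξ ≠ 0} := by
  rw [dense_iff_inter_open]
  rintro O hO ⟨x, hx⟩
  by_contra hne
  have hz : ∀ y ∈ O, Q y = 0 := fun y hy => by
    by_contra hy0
    exact hne ⟨y, hy, hy0⟩
  have hev : Q =ᶠ[nhds x] (fun _ => (0 : ℝ)) := by
    filter_upwards [hO.mem_nhds hx] with y hy using hz y hy
  have ha : AnalyticOnNhd ℝ Q Set.univ := contDiff_omega_iff_analyticOnNhd.1 hQ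
  exact h (ha.eqOn_of_preconnected_of_eventuallyEq analyticOnNhd_const isPreconnected_univ
    (Set.mem_univ x) hev (Set.mem_univ ξ₀))

theorem dense_of_fibers {D : Set (U × E4)} {A : Set U} (hA : Dense A)
    (hD : ∀ p ∈ A, Dense {ξ | (p, ξ) ∈ D}) : Dense D := by
  rw [dense_iff_inter_open]
  rintro O hO ⟨⟨p, ξ⟩, hp⟩
  obtain ⟨W, V, hW, hV, hpW, hξV, hsub⟩ := isOpen_prod_iff.1 hO p ξ hp
  obtain ⟨q, hqW, hqA⟩ := hA.inter_open_nonempty W hW ⟨p, hpW⟩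
  obtain ⟨η, hηV, hηD⟩ := (hD q hqA).inter_open_nonempty V hV ⟨ξ, hξV⟩
  exact ⟨(q, η), hsub ⟨hqW, hηV⟩, hηD⟩

/-- The points with `s₃ ≠ 0` are dense. -/
theorem dense_coord_two_ne_zero : Dense {p : U | (p : E4) 2 ≠ 0} := by
  rw [dense_iff_inter_open]
  rintro O hO ⟨p, hp⟩
  by_cases h2 : (p : E4) 2 = 0
  swap; · exact ⟨p, hp, h2⟩
  obtain ⟨W, hW, rfl⟩ := isOpen_induced_iff.1 hO
  let W' : TopologicalSpace.Opens S3 := ⟨W, hW⟩ ⊓ U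
  -- The perturbation is made in the ambient space: the cone is open, so p + t e₃ stays in it for
  -- small t, and normalizing only rescales the third coordinate.
  have hc : (p : E4) ∈ cone W' := ⟨⟨p, hp, p.2⟩, coe_eq p⟩
  have hcont : Continuous (fun t : ℝ => (p : E4) + t • ev 2) := by fun_prop
  have ho : IsOpen {t : ℝ | (p : E4) + t • ev 2 ∈ cone W'} := (isOpen_cone W').preimage hcont
  have h0 : (0 : ℝ) ∈ {t : ℝ | (p : E4) + t • ev 2 ∈ cone W'} := by simpa using hc
  obtain ⟨ε, hε, hball⟩ := Metric.isOpen_iff.1 ho 0 h0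
  have ht : ε / 2 ∈ Metric.ball (0 : ℝ) ε := by
    rw [Metric.mem_ball, dist_zero_right, Real.norm_eq_abs, abs_of_pos (by linarith)]
    linarith
  obtain ⟨q, hq⟩ := hball ht
  refine ⟨⟨q, q.2.2⟩, q.2.1, ?_⟩
  have hx : (p : E4) + (ε / 2) • ev 2 ≠ 0 := ne_zero_of_mem_cone (hball ht)
  change (q : E4) 2 ≠ 0
  rw [hq]
  have hn : ‖(p : E4) + (ε / 2) • ev 2‖⁻¹ ≠ 0 := inv_ne_zero (norm_ne_zero_iff.2 hx)
  simp only [PiLp.smul_apply, PiLp.add_apply, h2, smul_eq_mul, ev]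
  refine mul_ne_zero hn ?_
  simp [hε.ne']

/-- The symbol of half the Laplace-Runge-Lenz operator. -/
def lrlSym (c i j : Fin 4) (x ξ : E4) : ℝ :=
  rotSym i c x ξ * rotSym 3 i x ξ + rotSym j c x ξ * rotSym 3 j x ξ

theorem contDiff_lrlSym (c i j : Fin 4) : ContDiff ℝ ω (fun z : E4 × E4 => lrlSym c i j z.1 z.2) := by
  unfold lrlSym rotSym; fun_prop

theorem hasDerivAt_lrlSym (c i j : Fin 4) (x ξ v w : E4) :
    HasDerivAt (fun t : ℝ => lrlSym c i j (x + t • v) (ξ + t • w))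
      ((rotSymDeriv i c x ξ v w * rotSym 3 i x ξ + rotSym i c x ξ * rotSymDeriv 3 i x ξ v w) +
        (rotSymDeriv j c x ξ v w * rotSym 3 j x ξ + rotSym j c x ξ * rotSymDeriv 3 j x ξ v w)) 0 :=
  (hasDerivAt_rotSym_mul i c 3 i x ξ v w).add (hasDerivAt_rotSym_mul j c 3 j x ξ v w)

theorem hasDerivAt_lrlSym_ev {c i j : Fin 4} (h : (c, i, j) = (2, 1, 0) ∨ (c, i, j) = (0, 1, 2))
    (x ξ : E4) :
    HasDerivAt (fun t : ℝ => lrlSym c i j (x + t • (0 : E4)) (ξ + t • ev 3))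
      (-(rotSym i c x ξ * x i + rotSym j c x ξ * x j)) 0 := by
  refine (hasDerivAt_lrlSym c i j x ξ 0 (ev 3)).congr_deriv ?_
  rcases h with h | h <;> cases h <;> simp [rotSymDeriv, rotSym, ev] <;> ring

theorem hasDerivAt_lrlSym_radial {c i j : Fin 4}
    (h : (c, i, j) = (2, 1, 0) ∨ (c, i, j) = (0, 1, 2)) (x ξ : E4) :
    HasDerivAt (fun t : ℝ => lrlSym c i j
      (x + t • !₂[x 3 * x 0, x 3 * x 1, x 3 * x 2, x 3 ^ 2 - 1]) (ξ + t • -(x 3 • ξ)))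
      (-(rotSym i c x ξ * ξ i + rotSym j c x ξ * ξ j)) 0 := by
  refine (hasDerivAt_lrlSym c i j x ξ _ _).congr_deriv ?_
  rcases h with h | h <;> cases h <;> simp [rotSymDeriv, rotSym] <;> ring

/-- The Jacobian of the symbols of the Hamiltonian and the Laplace-Runge-Lenz operator transversal
to the orbits of the angular momentum. -/
def lrlJacobian (c i j : Fin 4) (x ξ : E4) : ℝ :=
  (rotSym 0 3 x ξ * x 0 + rotSym 1 3 x ξ * x 1 + rotSym 2 3 x ξ * x 2) *
      -(rotSym i c x ξ * ξ i + rotSym j c x ξ * ξ j) -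
    (rotSym 0 3 x ξ * ξ 0 + rotSym 1 3 x ξ * ξ 1 + rotSym 2 3 x ξ * ξ 2) *
      -(rotSym i c x ξ * x i + rotSym j c x ξ * x j)

theorem isOpen_ne_zero_of_contDiff {Q : E4 → ℝ} (hQ : ContDiff ℝ ω Q) : IsOpen {ξ | Q ξ ≠ 0} :=
  isOpen_ne_fun hQ.continuous continuous_const

/-- For fixed x each of the five conditions is the nonvanishing of a polynomial in ξ, so one good
covector for each suffices. The covectors are sparse, chosen so that the value factors into
coordinates and sums of squares. -/
theorem dense_regular {c i j : Fin 4} (h : (c, i, j) = (2, 1, 0) ∨ (c, i, j) = (0, 1, 2)) {x : E4}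
    (h0 : x 0 ≠ 0) (h1 : x 1 ≠ 0) (h2 : x 2 ≠ 0) :
    Dense {ξ : E4 | (((rotSym 0 1 x ξ ≠ 0 ∧ rotSym 0 2 x ξ ≠ 0) ∧ rotSym 1 2 x ξ ≠ 0) ∧
      lrlSym c i j x ξ ≠ 0) ∧ lrlJacobian c i j x ξ ≠ 0} := by
  have cr : ∀ j k, ContDiff ℝ ω (fun ξ : E4 => rotSym j k x ξ) := fun j k => by
    unfold rotSym; fun_prop
  have cl : ContDiff ℝ ω (fun ξ : E4 => lrlSym c i j x ξ) := by
    unfold lrlSym rotSym; fun_prop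
  have cj : ContDiff ℝ ω (fun ξ : E4 => lrlJacobian c i j x ξ) := by
    unfold lrlJacobian rotSym; fun_prop
  have d01 := dense_ne_zero_of_contDiff (cr 0 1) (ξ₀ := ev 0) (by simp [rotSym, ev, h1])
  have d02 := dense_ne_zero_of_contDiff (cr 0 2) (ξ₀ := ev 0) (by simp [rotSym, ev, h2])
  have d12 := dense_ne_zero_of_contDiff (cr 1 2) (ξ₀ := ev 1) (by simp [rotSym, ev, h2])
  have hl : ∃ ξ₀, lrlSym c i j x ξ₀ ≠ 0 := by
    rcases h with h | h <;> cases h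
    · refine ⟨!₂[x 0, 0, 0, x 3 + 1], ?_⟩
      have : lrlSym 2 1 0 x !₂[x 0, 0, 0, x 3 + 1] = x 0 ^ 2 * x 2 := by
        simp [lrlSym, rotSym]; ring
      rw [this]; positivity
    · refine ⟨!₂[0, 0, x 2, x 3 + 1], ?_⟩
      have : lrlSym 0 1 2 x !₂[0, 0, x 2, x 3 + 1] = x 0 * x 2 ^ 2 := by
        simp [lrlSym, rotSym]; ring
      rw [this]; positivity
  have hj : ∃ ξ₀, lrlJacobian c i j x ξ₀ ≠ 0 := by
    rcases h with h | h <;> cases h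
    · refine ⟨!₂[1, 0, 0, 1], ?_⟩
      have : lrlJacobian 2 1 0 x !₂[1, 0, 0, 1] = x 2 * (x 1 ^ 2 + x 2 ^ 2) := by
        simp [lrlJacobian, rotSym]; ring
      rw [this]; positivity
    · refine ⟨!₂[0, 0, 1, 1], ?_⟩
      have : lrlJacobian 0 1 2 x !₂[0, 0, 1, 1] = x 0 * (x 0 ^ 2 + x 1 ^ 2) := by
        simp [lrlJacobian, rotSym]; ring
      rw [this]; positivity
  obtain ⟨_, hl⟩ := hl
  obtain ⟨_, hj⟩ := hj
  have o := fun j k => isOpen_ne_zero_of_contDiff (cr j k)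
  exact (((d01.inter_of_isOpen_right d02 (o 0 2)).inter_of_isOpen_right d12 (o 1 2)).inter_of_isOpen_right
    (dense_ne_zero_of_contDiff cl hl) (isOpen_ne_zero_of_contDiff cl)).inter_of_isOpen_right
    (dense_ne_zero_of_contDiff cj hj) (isOpen_ne_zero_of_contDiff cj)

/-- The function φ treats both systems at once: φ(t) = 2t for the operator L of order two and φ(t) =
-4t² for the quartic ones. Where the Laplace-Runge-Lenz symbol is nonzero, φ' only rescales the
determinant. -/
theorem symbolsIndependent_of_symbol_eq {H A B C S : Op U} {k : ℕ} {c i j : Fin 4}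
    (hU : U ≤ region2) (h : (c, i, j) = (2, 1, 0) ∨ (c, i, j) = (0, 1, 2)) {φ φ' : ℝ → ℝ}
    (hφ : ∀ t, HasDerivAt φ (φ' t) t) (hφ' : ∀ t, t ≠ 0 → φ' t ≠ 0)
    (hH : ∀ (p : U) ξ, symbol 2 H p ξ = ((lapSym p ξ : ℝ) : ℂ))
    (hA : ∀ (p : U) ξ, symbol 2 A p ξ = ((rotSym 0 1 p ξ ^ 2 : ℝ) : ℂ))
    (hB : ∀ (p : U) ξ, symbol 2 B p ξ = ((rotSym 0 2 p ξ ^ 2 : ℝ) : ℂ))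
    (hC : ∀ (p : U) ξ, symbol 2 C p ξ = ((rotSym 1 2 p ξ ^ 2 : ℝ) : ℂ))
    (hS : ∀ (p : U) ξ, symbol k S p ξ = ((φ (lrlSym c i j p ξ) : ℝ) : ℂ)) :
    SymbolsIndependent ![2, 2, 2, 2, k] ![H, A, B, C, S] := by
  refine dense_of_fibers dense_coord_two_ne_zero fun p hp2 => ?_
  have hp0 : (p : E4) 0 ≠ 0 := (hU p.2).1
  have hp1 : (p : E4) 1 ≠ 0 := (hU p.2).2
  refine (dense_regular h hp0 hp1 hp2).mono ?_
  rintro ξ ⟨⟨⟨⟨h01, h02⟩, h12⟩, hl⟩, hj⟩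
  have hd : Differentiable ℝ φ := fun t => (hφ t).differentiableAt
  have hα : HasDerivAt φ (φ' (lrlSym c i j p ξ))
      (lrlSym c i j ((p : E4) + (0 : ℝ) • (0 : E4)) (ξ + (0 : ℝ) • ev 3)) := by
    simpa using hφ (lrlSym c i j p ξ)
  have hβ : HasDerivAt φ (φ' (lrlSym c i j p ξ))
      (lrlSym c i j ((p : E4) + (0 : ℝ) • !₂[(p : E4) 3 * (p : E4) 0, (p : E4) 3 * (p : E4) 1,
        (p : E4) 3 * (p : E4) 2, (p : E4) 3 ^ 2 - 1]) (ξ + (0 : ℝ) • -((p : E4) 3 • ξ))) := by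
    simpa using hφ (lrlSym c i j p ξ)
  refine linearIndependent_symbols (G := fun z => φ (lrlSym c i j z.1 z.2)) hH hA hB hC
    (hd.comp ((contDiff_lrlSym c i j).differentiable (by simp))) hS p ξ
    (hα.comp 0 (hasDerivAt_lrlSym_ev h (p : E4) ξ))
    (hβ.comp 0 (hasDerivAt_lrlSym_radial h (p : E4) ξ)) h01 h02 h12 hp0 ?_
  have e := mul_ne_zero (hφ' _ hl) hj
  rw [lrlJacobian] at e
  intro he
  apply e
  linear_combination he

/-! ### Superintegrability of the two systems -/

theorem hasDerivAt_neg_four_sq (t : ℝ) : HasDerivAt (fun t : ℝ => -4 * t ^ 2) (-8 * t) t := by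
  refine ((hasDerivAt_pow 2 t).const_mul (-4)).congr_deriv ?_
  simp; ring

theorem symbol_Hext (hU : U ≤ region3) (a : Fin 5 → ℂ) (p : U) (ξ : E4) :
    symbol 2 (Hext hU a) p ξ = ((lapSym p ξ : ℝ) : ℂ) := by
  rw [Hext, symbol_add_mulOp_two, symbol_laplaceBeltrami]

theorem symbol_L12 (hU : U ≤ region3) (a : Fin 5 → ℂ) (p : U) (ξ : E4) :
    symbol 2 (L12 hU a) p ξ = ((rotSym 0 1 p ξ ^ 2 : ℝ) : ℂ) := by
  rw [L12, symbol_add_mulOp_two, symbol_J_sq]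

theorem symbol_L13 (hU : U ≤ region3) (a : Fin 5 → ℂ) (p : U) (ξ : E4) :
    symbol 2 (L13 hU a) p ξ = ((rotSym 0 2 p ξ ^ 2 : ℝ) : ℂ) := by
  rw [L13, symbol_add_mulOp_two, symbol_J_sq]

theorem symbol_L23 (hU : U ≤ region3) (a : Fin 5 → ℂ) (p : U) (ξ : E4) :
    symbol 2 (L23 hU a) p ξ = ((rotSym 1 2 p ξ ^ 2 : ℝ) : ℂ) := by
  rw [L23, symbol_add_mulOp_two, symbol_J_sq]

theorem isSuperintegrable_K1 (hU : U ≤ region3) (a : Fin 5 → ℂ) :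
    IsSuperintegrable 4 (Hext hU a) ![2, 2, 2, 2, 4]
      ![Hext hU a, L12 hU a, L13 hU a, L23 hU a, K1 hU a] where
  first := rfl
  order_le i := by fin_cases i <;> simp
  mem_diffOp i := by
    fin_cases i
    exacts [Hext_mem hU a, L12_mem hU a, L13_mem hU a, L23_mem hU a, K1_mem hU a]
  commute i := by
    fin_cases i
    exacts [Commute.refl _, L12_commute hU a, L13_commute hU a, L23_commute hU a, K1_commute hU a]
  independent := symbolsIndependent_of_symbol_eq (hU.trans region3_le) (c := 2) (i := 1) (j := 0)
    (by decide) hasDerivAt_neg_four_sq (fun t ht => mul_ne_zero (by norm_num) ht)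
    (symbol_Hext hU a) (symbol_L12 hU a) (symbol_L13 hU a) (symbol_L23 hU a) (symbol_K1 hU a)

theorem isSuperintegrable_K3 (hU : U ≤ region3) (a : Fin 5 → ℂ) :
    IsSuperintegrable 4 (Hext hU a) ![2, 2, 2, 2, 4]
      ![Hext hU a, L12 hU a, L13 hU a, L23 hU a, K3 hU a] where
  first := rfl
  order_le i := by fin_cases i <;> simp
  mem_diffOp i := by
    fin_cases i
    exacts [Hext_mem hU a, L12_mem hU a, L13_mem hU a, L23_mem hU a, K3_mem hU a]
  commute i := by
    fin_cases i
    exacts [Commute.refl _, L12_commute hU a, L13_commute hU a, L23_commute hU a, K3_commute hU a]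
  independent := symbolsIndependent_of_symbol_eq (hU.trans region3_le) (c := 0) (i := 1) (j := 2)
    (by decide) hasDerivAt_neg_four_sq (fun t ht => mul_ne_zero (by norm_num) ht)
    (symbol_Hext hU a) (symbol_L12 hU a) (symbol_L13 hU a) (symbol_L23 hU a) (symbol_K3 hU a)

theorem isSuperintegrable_Lc (hU : U ≤ region2) (b : Fin 4 → ℂ) :
    IsSuperintegrable 2 (Hcoul hU b) ![2, 2, 2, 2, 2]
      ![Hcoul hU b, Lc12 hU b, Lc13 hU b, Lc23 hU b, Lc hU b] where
  first := rfl
  order_le i := by fin_cases i <;> simp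
  mem_diffOp i := by
    fin_cases i
    exacts [Hcoul_mem hU b, Lc12_mem hU b, Lc13_mem hU b, Lc23_mem hU b, Lc_mem hU b]
  commute i := by
    fin_cases i
    exacts [Commute.refl _, Lc12_commute hU b, Lc13_commute hU b, Lc23_commute hU b,
      Lc_commute hU b]
  independent := by
    refine symbolsIndependent_of_symbol_eq hU (c := 2) (i := 1) (j := 0) (φ := fun t => 2 * t)
      (φ' := fun _ => 2) (by decide) (fun t => by simpa using (hasDerivAt_id t).const_mul 2)
      (fun t _ => two_ne_zero) (fun p ξ => ?_) (fun p ξ => ?_) (fun p ξ => ?_) (fun p ξ => ?_)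
      (fun p ξ => ?_)
    · rw [Hcoul, symbol_add_mulOp_two, symbol_laplaceBeltrami]
    · rw [Lc12, symbol_add_mulOp_two, symbol_J_sq]
    · rw [Lc13, symbol_add_mulOp_two, symbol_J_sq]
    · rw [Lc23, symbol_add_mulOp_two, symbol_J_sq]
    · rw [symbol_Lc, lrlSym, add_comm (rotSym 0 2 _ _ * _)]

/-! ### Linear independence of the symmetries -/

theorem sum_lapSym_ev_three (x : E4) : lapSym x (ev 3) = x 0 ^ 2 + x 1 ^ 2 + x 2 ^ 2 := by
  simp [lapSym, rotSym, ev]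

theorem symbol_zero (n : ℕ) (p : U) (ξ : E4) : symbol n (0 : Op U) p ξ = 0 := by
  have h := symbol_smul n 0 (0 : Op U) p ξ
  rwa [zero_smul, zero_mul] at h

/-- On the covectors (s, 0, 0, t) and (0, 0, s, t) the relation is a polynomial in s and t. The
coefficients of s²t² give two linear equations for c and d, with nonzero determinant because (x₀² +
x₁²)(x₁² + x₂²) > x₀² x₂². -/
theorem eq_zero_of_symbols_eq_zero {c d : ℂ} {x : E4} (h0 : x 0 ≠ 0)
    (h1 : x 1 ≠ 0) (h2 : x 2 ≠ 0)
    (h : ∀ ξ : E4, c * ((lrlSym 2 1 0 x ξ ^ 2 : ℝ) : ℂ) + d * ((lrlSym 0 1 2 x ξ ^ 2 : ℝ) : ℂ) = 0) :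
    c = 0 ∧ d = 0 := by
  have e : ∀ s t : ℝ, c * (x 2 * s * (x 3 * s - x 0 * t)) ^ 2 +
      d * (s * t * (x 1 ^ 2 + x 2 ^ 2)) ^ 2 = (0 : ℂ) := by
    intro s t
    have := h !₂[s, 0, 0, t]
    simp [lrlSym, rotSym] at this
    linear_combination this
  have f : ∀ s t : ℝ, c * (s * t * (x 0 ^ 2 + x 1 ^ 2)) ^ 2 +
      d * (x 0 * s * (x 3 * s - x 2 * t)) ^ 2 = (0 : ℂ) := by
    intro s t
    have := h !₂[0, 0, s, t]
    simp [lrlSym, rotSym] at this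
    linear_combination this
  have e1 := e 1 1
  have e2 := e 1 (-1)
  have e3 := e 1 0
  have f1 := f 1 1
  have f2 := f 1 (-1)
  have f3 := f 1 0
  have ha : c * (x 2 ^ 2 * x 0 ^ 2) + d * (x 1 ^ 2 + x 2 ^ 2) ^ 2 = (0 : ℂ) := by
    push_cast at e1 e2 e3
    linear_combination e1 / 2 + e2 / 2 - e3
  have hb : c * (x 0 ^ 2 + x 1 ^ 2) ^ 2 + d * (x 0 ^ 2 * x 2 ^ 2) = (0 : ℂ) := by
    push_cast at f1 f2 f3
    linear_combination f1 / 2 + f2 / 2 - f3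
  have hdet : (((x 0 ^ 2 + x 1 ^ 2) ^ 2 * (x 1 ^ 2 + x 2 ^ 2) ^ 2 - (x 0 ^ 2 * x 2 ^ 2) ^ 2 : ℝ) : ℂ)
      ≠ 0 := by
    refine Complex.ofReal_ne_zero.2 (ne_of_gt ?_)
    have h0' : 0 < x 0 ^ 2 := by positivity
    have h1' : 0 < x 1 ^ 2 := by positivity
    have h2' : 0 < x 2 ^ 2 := by positivity
    have : (x 0 ^ 2 + x 1 ^ 2) ^ 2 * (x 1 ^ 2 + x 2 ^ 2) ^ 2 - (x 0 ^ 2 * x 2 ^ 2) ^ 2 =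
      (x 1 ^ 2 * (x 0 ^ 2 + x 1 ^ 2 + x 2 ^ 2)) *
        (x 0 ^ 2 * x 1 ^ 2 + x 0 ^ 2 * x 2 ^ 2 + x 1 ^ 4 + x 1 ^ 2 * x 2 ^ 2 + x 0 ^ 2 * x 2 ^ 2) := by
      ring
    rw [this]
    positivity
  push_cast at hdet
  constructor
  · refine (mul_eq_zero.1 ?_).resolve_right hdet
    linear_combination (x 1 ^ 2 + x 2 ^ 2 : ℂ) ^ 2 * hb - (x 0 ^ 2 * x 2 ^ 2 : ℂ) * ha
  · refine (mul_eq_zero.1 ?_).resolve_right hdet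
    linear_combination (x 0 ^ 2 + x 1 ^ 2 : ℂ) ^ 2 * ha - (x 0 ^ 2 * x 2 ^ 2 : ℂ) * hb

/-- The covector e₄ is seen by the Laplacian alone; the other three basis covectors then separate
the rotations. -/
theorem eq_zero_of_symbols_eq_zero' {c1 c2 c3 c4 : ℂ} {x : E4} (h0 : x 0 ≠ 0) (h1 : x 1 ≠ 0)
    (h2 : x 2 ≠ 0)
    (h : ∀ ξ : E4, c1 * ((lapSym x ξ : ℝ) : ℂ) + c2 * ((rotSym 0 1 x ξ ^ 2 : ℝ) : ℂ) +
      c3 * ((rotSym 0 2 x ξ ^ 2 : ℝ) : ℂ) + c4 * ((rotSym 1 2 x ξ ^ 2 : ℝ) : ℂ) = 0) :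
    c1 = 0 ∧ c2 = 0 ∧ c3 = 0 ∧ c4 = 0 := by
  have e3 := h (ev 3)
  have e0 := h (ev 0)
  have e1 := h (ev 1)
  have e2 := h (ev 2)
  have p3 : ((lapSym x (ev 3) : ℝ) : ℂ) ≠ 0 := by
    rw [sum_lapSym_ev_three]
    exact Complex.ofReal_ne_zero.2 (by positivity)
  have c0 := Complex.ofReal_ne_zero.2 h0
  have c1' := Complex.ofReal_ne_zero.2 h1
  have c2' := Complex.ofReal_ne_zero.2 h2
  have z1 : c1 = 0 := by
    refine (mul_eq_zero.1 ?_).resolve_right p3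
    simpa [rotSym, ev] using e3
  rw [z1] at e0 e1 e2
  simp [rotSym, ev] at e0 e1 e2
  have z2 : c2 = 0 := by
    refine (mul_eq_zero.1 ?_).resolve_right (mul_ne_zero (pow_ne_zero 2 c0) (pow_ne_zero 2 c1'))
    linear_combination (x 0 : ℂ) ^ 2 / 2 * e0 + (x 1 : ℂ) ^ 2 / 2 * e1 - (x 2 : ℂ) ^ 2 / 2 * e2
  rw [z2] at e0 e1
  refine ⟨z1, z2, ?_, ?_⟩
  · refine (mul_eq_zero.1 ?_).resolve_right (pow_ne_zero 2 c2')
    linear_combination e0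
  · refine (mul_eq_zero.1 ?_).resolve_right (pow_ne_zero 2 c2')
    linear_combination e1

theorem op_linearIndependent_of {m : ℕ} (v : Fin m → Op U)
    (h : ∀ g : Fin m → ℂ, ∑ i, g i • v i = 0 → ∀ i, g i = 0) : LinearIndependent ℂ v := by
  refine Fintype.linearIndependent_iffₛ.2 fun f g hfg i => ?_
  refine sub_eq_zero.1 (h (fun i => f i - g i) ?_ i)
  apply LinearMap.ext; intro x
  have e := congrArg (fun A : Op U => A x) hfg
  simp only [LinearMap.sum_apply, LinearMap.smul_apply, sub_smul, Finset.sum_sub_distrib] at e ⊢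
  rw [e, sub_self]; rfl

/-- The coefficients are peeled off by order: symbols of order four, symbols of order two, and
finally the value on the constant function 1. -/
theorem symmetries_combination_eq_zero (hU : U ≤ region3) (a : Fin 5 → ℂ) (p : U) {g : Fin 7 → ℂ}
    (hg' : g 0 • (1 : Op U) + g 1 • Hext hU a + g 2 • L12 hU a + g 3 • L13 hU a +
      g 4 • L23 hU a + g 5 • K1 hU a + g 6 • K3 hU a = 0) (i : Fin 7) : g i = 0 := by
  have h0 : (p : E4) 0 ≠ 0 := (hU p.2).1.1
  have h1 : (p : E4) 1 ≠ 0 := (hU p.2).1.2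
  have h2 : (p : E4) 2 ≠ 0 := (hU p.2).2
  have hone : (1 : Op U) ∈ diffOp U 1 := diffOp_mono (Nat.zero_le _) one_mem_diffOp
  have s4 : ∀ ξ : E4, (g 5 * -4) * ((lrlSym 2 1 0 p ξ ^ 2 : ℝ) : ℂ) +
      (g 6 * -4) * ((lrlSym 0 1 2 p ξ ^ 2 : ℝ) : ℂ) = 0 := by
    intro ξ
    have e := congrArg (fun A => symbol 4 A p ξ) hg'
    simp only [symbol_add, symbol_smul, symbol_zero, symbol_K1, symbol_K3,
      symbol_of_lt (n := 4) (by norm_num) hone, symbol_of_lt (n := 4) (by norm_num) (Hext_mem hU a),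
      symbol_of_lt (n := 4) (by norm_num) (L12_mem hU a),
      symbol_of_lt (n := 4) (by norm_num) (L13_mem hU a),
      symbol_of_lt (n := 4) (by norm_num) (L23_mem hU a)] at e
    rw [← e, lrlSym, lrlSym]
    push_cast; ring
  obtain ⟨g5, g6⟩ := eq_zero_of_symbols_eq_zero h0 h1 h2 s4
  have g5' : g 5 = 0 := by linear_combination -g5 / 4
  have g6' : g 6 = 0 := by linear_combination -g6 / 4
  rw [g5', g6', zero_smul, zero_smul, add_zero, add_zero] at hg'
  have s2 : ∀ ξ : E4, g 1 * ((lapSym p ξ : ℝ) : ℂ) + g 2 * ((rotSym 0 1 p ξ ^ 2 : ℝ) : ℂ) +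
      g 3 * ((rotSym 0 2 p ξ ^ 2 : ℝ) : ℂ) + g 4 * ((rotSym 1 2 p ξ ^ 2 : ℝ) : ℂ) = 0 := by
    intro ξ
    have e := congrArg (fun A => symbol 2 A p ξ) hg'
    simp only [symbol_add, symbol_smul, symbol_zero, symbol_Hext, symbol_L12, symbol_L13,
      symbol_L23, symbol_of_lt (n := 2) (by norm_num) hone] at e
    rw [← e]; ring
  obtain ⟨g1, g2, g3, g4⟩ := eq_zero_of_symbols_eq_zero' h0 h1 h2 s2
  rw [g1, g2, g3, g4] at hg'
  simp only [zero_smul, add_zero] at hg'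
  have g0 : g 0 = 0 := by
    have e := congrFun (congrArg Subtype.val (congrArg (fun A : Op U => A 1) hg')) p
    have e2 : g 0 * 1 = 0 := e
    rwa [mul_one] at e2
  fin_cases i <;> assumption

theorem linearIndependent_symmetries (hU : U ≤ region3) (a : Fin 5 → ℂ)
    (hne : (U : Set S3).Nonempty) : LinearIndependent ℂ
      ![(1 : Op U), Hext hU a, L12 hU a, L13 hU a, L23 hU a, K1 hU a, K3 hU a] := by
  obtain ⟨p0, hp0⟩ := hne
  refine op_linearIndependent_of _ fun g hg => ?_
  rw [Fin.sum_univ_seven] at hg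
  exact symmetries_combination_eq_zero hU a ⟨p0, hp0⟩ hg

/-! ### Independence of the potentials -/

theorem J_coord (j k i : Fin 4) : J j k (coord i : Smooth U) =
    coord j * (if k = i then 1 else 0) - coord k * (if j = i then 1 else 0) := by
  rw [J_eq, E_coord, E_coord]; ring

theorem J_inv_sq (j k : Fin 4) {s t : Smooth U} (h : s * t = 1) :
    J j k (t ^ 2) = -2 * t ^ 3 * J j k s := by
  rw [pow_two, J_mul_apply, J_eq, J_eq, E_of_mul_eq_one _ h, E_of_mul_eq_one _ h]; ring

theorem J_coulomb (hU : U ≤ region2) (j k : Fin 4) :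
    J j k (coord 3 * rinv hU) = rinv hU ^ 3 * J j k (coord 3) := by
  have h := rinv_sq hU
  rw [J_mul_apply, J_eq j k (rinv hU), E_rinv, E_rinv, J_eq]
  linear_combination (-(rinv hU) * (coord j * E k (coord 3) - coord k * E j (coord 3))) * h

/-- Each of the rotations J₃₄, J₁₃, J₂₃ annihilates two of the three functions, and the derivative
of the third is nonzero because s₃ ≠ 0. -/
theorem linearIndependent_potential3 (hU : U ≤ region2) (p : U) (h2 : (p : E4) 2 ≠ 0) :
    LinearIndependent ℂ fun i => fderiv ℝ (radialExt (potential3 hU i).1) (p : E4) := by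
  rw [Fintype.linearIndependent_iff]
  intro g hg
  have key : ∀ j k, g 0 * (J j k (coord 3 * rinv hU)).1 p + g 1 * (J j k (inv1 hU ^ 2)).1 p +
      g 2 * (J j k (inv2 hU ^ 2)).1 p = 0 := by
    intro j k
    have e := congrArg (fun T : E4 →L[ℝ] ℂ => T (rotVec j k p)) hg
    rw [Fin.sum_univ_three] at e
    exact e
  simp only [J_coulomb, J_inv_sq _ _ (coord0_mul_inv1 hU), J_inv_sq _ _ (coord1_mul_inv2 hU),
    J_coord] at key
  have k0 := key 2 3
  have k1 := key 0 2
  have k2 := key 1 2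
  have c2 := Complex.ofReal_ne_zero.2 h2
  have n0 : (rinv hU).1 p ≠ 0 := inv_ne_zero (radius_ne hU p)
  have n1 : (inv1 hU).1 p ≠ 0 := inv_ne_zero (coord_ne 0 (fun p => (hU p.2).1) p)
  have n2 : (inv2 hU).1 p ≠ 0 := inv_ne_zero (coord_ne 1 (fun p => (hU p.2).2) p)
  have h22 : (2 : Smooth U).1 p ≠ 0 := two_ne_zero (α := ℂ)
  have z0 : g 0 = 0 := by
    refine (mul_eq_zero.1 ?_).resolve_right (mul_ne_zero (pow_ne_zero 3 n0) c2)
    simpa [coord_apply] using k0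
  have z1 : g 1 = 0 := by
    simp [coord_apply] at k1
    tauto
  have z2 : g 2 = 0 := by
    simp [coord_apply] at k2
    tauto
  intro i
  fin_cases i <;> assumption

theorem laplaceBeltrami_add_potential3 (hU : U ≤ region2) (b : Fin 3 → ℂ) :
    laplaceBeltrami + mulOp (∑ i, b i • potential3 hU i) = Hcoul hU ![b 0, b 1, b 2, 0] := by
  rw [Hcoul, Fin.sum_univ_three]
  congr 2
  change _ = _ + (0 : ℂ) • (1 : Smooth U)
  rw [zero_smul, add_zero]
  rfl

theorem isSemidegenerate_of_symmetries_mem_span (hU : U ≤ region2)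
    (h : ∀ b : Fin 4 → ℂ, b 0 ≠ 0 → b 1 ≠ 0 → b 2 ≠ 0 → ∀ S ∈ diffOp U 2, Commute S (Hcoul hU b) →
      S ∈ Submodule.span ℂ
        {(1 : Op U), Hcoul hU b, Lc12 hU b, Lc13 hU b, Lc23 hU b, Lc hU b}) :
    IsSemidegenerate (potential3 hU) where
  superintegrable b := by
    rw [laplaceBeltrami_add_potential3]
    exact ⟨_, _, isSuperintegrable_Lc hU _⟩
  independent := dense_coord_two_ne_zero.mono fun p hp => linearIndependent_potential3 hU p hp
  not_nondegenerate hn := by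
    classical
    -- Any parameters without a zero would do: seven independent operators would have to lie in a
    -- space spanned by six.
    obtain ⟨S, hS, hli⟩ := hn ![1, 1, 1]
    rw [laplaceBeltrami_add_potential3] at hS
    set b : Fin 4 → ℂ := ![(![1, 1, 1] : Fin 3 → ℂ) 0, (![1, 1, 1] : Fin 3 → ℂ) 1,
      (![1, 1, 1] : Fin 3 → ℂ) 2, 0] with hb
    have hspan := h b one_ne_zero one_ne_zero one_ne_zero
    let w : Fin 6 → Op U := ![1, Hcoul hU b, Lc12 hU b, Lc13 hU b, Lc23 hU b, Lc hU b]
    have hw : {(1 : Op U), Hcoul hU b, Lc12 hU b, Lc13 hU b, Lc23 hU b, Lc hU b} ⊆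
        Set.range w := by
      rintro x (rfl | rfl | rfl | rfl | rfl | rfl)
      exacts [⟨0, rfl⟩, ⟨1, rfl⟩, ⟨2, rfl⟩, ⟨3, rfl⟩, ⟨4, rfl⟩, ⟨5, rfl⟩]
    have hle : Set.range (Fin.cons 1 S : Fin 7 → Op U) ⊆ Submodule.span ℂ (Set.range w) := by
      rintro _ ⟨i, rfl⟩
      refine Fin.cases ?_ (fun i => ?_) i
      · exact Submodule.subset_span ⟨0, rfl⟩
      · exact Submodule.span_mono hw (hspan _ (hS i).1 (hS i).2)
    have hc := linearIndependent_le_span_aux' _ hli (Set.range w) hle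
    have hr := Fintype.card_range_le w
    simp at hc hr
    omega

/-! ### The stereographic parametrization -/

/-- The vector `(2x, 2y, 2z, 1 - r²)`. -/
def stereoCone (x : E3) : E4 := !₂[2 * x 0, 2 * x 1, 2 * x 2, 1 - ‖x‖ ^ 2]

theorem norm_sq_add_one_pos (x : E3) : 0 < ‖x‖ ^ 2 + 1 := by positivity

theorem stereoVec_eq (x : E3) : stereoVec x = (‖x‖ ^ 2 + 1)⁻¹ • stereoCone x := rfl

theorem stereoCone_eq (x : E3) : stereoCone x = (‖x‖ ^ 2 + 1) • stereoVec x := by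
  rw [stereoVec_eq, smul_smul, mul_inv_cancel₀ (norm_sq_add_one_pos x).ne', one_smul]

theorem norm_stereoCone (x : E3) : ‖stereoCone x‖ = ‖x‖ ^ 2 + 1 := by
  have h : ‖stereoVec x‖ = 1 := norm_eq_of_mem_sphere (stereo x)
  rw [stereoCone_eq, norm_smul, h, mul_one, Real.norm_of_nonneg (norm_sq_add_one_pos x).le]

theorem stereoCone_mem_cone {x : E3} (hx : stereo x ∈ U) : stereoCone x ∈ cone U :=
  ⟨⟨stereo x, hx⟩, by rw [norm_stereoCone]; rfl⟩

/-- Radial extensions ignore positive factors, so the denominator r² + 1 can be dropped and the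
pullback is a composition with a polynomial map. -/
theorem pullback_eq (f : Smooth U) (x : E3) : pullback f x = radialExt f.1 (stereoCone x) := by
  by_cases h : stereo x ∈ U
  · rw [pullback, dif_pos h, radialExt_eq f.1 ⟨stereo x, h⟩ _ (by rw [norm_stereoCone]; rfl)]
  · rw [pullback, dif_neg h, radialExt, dif_neg]
    rintro ⟨p, hp⟩
    rw [norm_stereoCone] at hp
    exact h ((Subtype.ext hp : (p : S3) = stereo x) ▸ p.2)

theorem pullback_of_mem (f : Smooth U) {x : E3} (h : stereo x ∈ U) :
    pullback f x = f.1 ⟨stereo x, h⟩ := dif_pos h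

/-- The standard basis of `ℝ³`. -/
abbrev e3 (i : Fin 3) : E3 := EuclideanSpace.single i (1 : ℝ)

theorem norm_sq_eq (x : E3) : ‖x‖ ^ 2 = x 0 ^ 2 + x 1 ^ 2 + x 2 ^ 2 := by
  rw [EuclideanSpace.real_norm_sq_eq, Fin.sum_univ_three]

theorem contDiff_stereoCone : ContDiff ℝ ∞ stereoCone := by
  have h := contDiff_norm_sq ℝ (E := E3) (n := ∞)
  unfold stereoCone
  rw [contDiff_euclidean]
  intro i
  fin_cases i <;> simp <;> fun_prop

theorem stereoCone_line (x : E3) (i : Fin 3) (t : ℝ) : stereoCone (x + t • e3 i) =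
    stereoCone x + t • ((2 : ℝ) • ev i.castSucc - (2 * x i) • ev 3) - t ^ 2 • ev 3 := by
  ext j
  simp only [stereoCone, norm_sq_eq]
  fin_cases i <;> fin_cases j <;> simp [ev, e3] <;> ring

theorem fderiv_stereoCone (x : E3) (i : Fin 3) : fderiv ℝ stereoCone x (e3 i) =
    (2 : ℝ) • ev i.castSucc - (2 * x i) • ev 3 := by
  have hd : DifferentiableAt ℝ stereoCone x := contDiff_stereoCone.differentiable (by simp) x
  rw [← hd.lineDeriv_eq_fderiv, lineDeriv]
  simp only [stereoCone_line]
  set v : E4 := (2 : ℝ) • ev i.castSucc - (2 * x i) • ev 3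
  have h1 := ((hasDerivAt_id (0 : ℝ)).smul_const v).const_add (stereoCone x)
  have h2 := (hasDerivAt_pow 2 (0 : ℝ)).smul_const (ev 3)
  have h3 : HasDerivAt (fun t : ℝ => stereoCone x + t • v - t ^ 2 • ev 3) _ 0 := h1.sub h2
  rw [h3.deriv]
  simp

/-- `f` is differentiable at `y` with `i`-th partial derivative `d`. -/
def HasPartial (i : Fin 3) (f : E3 → ℂ) (d : ℂ) (y : E3) : Prop :=
  DifferentiableAt ℝ f y ∧ fderiv ℝ f y (e3 i) = d

namespace HasPartial

variable {i : Fin 3} {f g : E3 → ℂ} {a b : ℂ} {y : E3}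

theorem mul (hf : HasPartial i f a y) (hg : HasPartial i g b y) :
    HasPartial i (fun z => f z * g z) (a * g y + f y * b) y := by
  refine ⟨hf.1.mul hg.1, ?_⟩
  rw [fderiv_fun_mul hf.1 hg.1]
  simp [hf.2, hg.2]; ring

theorem add (hf : HasPartial i f a y) (hg : HasPartial i g b y) :
    HasPartial i (fun z => f z + g z) (a + b) y := by
  refine ⟨hf.1.add hg.1, ?_⟩
  rw [fderiv_fun_add hf.1 hg.1]
  simp [hf.2, hg.2]

theorem const (c : ℂ) : HasPartial i (fun _ => c) 0 y :=
  ⟨differentiableAt_const c, by simp⟩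

theorem ofReal {f : E3 → ℝ} {a : ℝ} (hf : HasFDerivAt f (fderiv ℝ f y) y)
    (h : fderiv ℝ f y (e3 i) = a) : HasPartial i (fun z => (f z : ℂ)) a y := by
  have e := Complex.ofRealCLM.hasFDerivAt.comp y hf
  refine ⟨e.differentiableAt, ?_⟩
  have e2 : fderiv ℝ (fun z => (f z : ℂ)) y = _ := e.fderiv
  rw [e2]
  simp [h]

theorem coord (j : Fin 3) : HasPartial i (fun z => (z j : ℂ)) (if i = j then 1 else 0) y := by
  have h : HasFDerivAt (fun z : E3 => z j) (EuclideanSpace.proj (𝕜 := ℝ) j) y :=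
    (EuclideanSpace.proj (𝕜 := ℝ) j).hasFDerivAt
  have h2 := ofReal (i := i) (y := y) (f := fun z : E3 => z j) (a := if i = j then 1 else 0)
    (by rw [h.fderiv]; exact h) (by rw [h.fderiv]; simp [e3, eq_comm])
  split_ifs at h2 ⊢ <;> simpa using h2

end HasPartial

/-- `1 / (r² + 1)`. -/
def stereoScale (x : E3) : ℝ := (‖x‖ ^ 2 + 1)⁻¹

theorem hasFDerivAt_norm_sq_add_one (y : E3) :
    HasFDerivAt (fun z : E3 => ‖z‖ ^ 2 + 1) (2 • innerSL ℝ y) y :=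
  (hasStrictFDerivAt_norm_sq y).hasFDerivAt.add_const 1

theorem hasPartial_stereoScale (i : Fin 3) (y : E3) :
    HasPartial i (fun z => (stereoScale z : ℂ)) (-2 * (y i : ℂ) * (stereoScale y : ℂ) ^ 2) y := by
  have h := (hasDerivAt_inv (norm_sq_add_one_pos y).ne').comp_hasFDerivAt y (hasFDerivAt_norm_sq_add_one y)
  have h2 := HasPartial.ofReal (i := i) (f := stereoScale) (a := -2 * y i * stereoScale y ^ 2)
    (by exact h.differentiableAt.hasFDerivAt) (by
      have e : fderiv ℝ stereoScale y = _ := h.fderiv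
      rw [e]
      simp [EuclideanSpace.inner_single_right, stereoScale]
      ring)
  simpa using h2

theorem confFactor_eq (x : E3) : confFactor x = 4 * stereoScale x ^ 2 := by
  rw [confFactor, stereoScale, inv_pow, div_eq_mul_inv]

theorem stereoScale_pos (x : E3) : 0 < stereoScale x := inv_pos.2 (norm_sq_add_one_pos x)

theorem confFactor_pos (x : E3) : 0 < confFactor x := by
  rw [confFactor_eq]; have := stereoScale_pos x; positivity

theorem hasPartial_confFactor_rpow (i : Fin 3) (y : E3) :
    HasPartial i (fun z => ((confFactor z ^ (1 / 4 : ℝ) : ℝ) : ℂ))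
      (-(y i : ℂ) * (stereoScale y : ℂ) * ((confFactor y ^ (1 / 4 : ℝ) : ℝ) : ℂ)) y := by
  have h := (hasDerivAt_inv (norm_sq_add_one_pos y).ne').comp_hasFDerivAt y (hasFDerivAt_norm_sq_add_one y)
  have h1 : HasFDerivAt stereoScale _ y := h
  have h2 := ((h1.pow 2).const_mul 4)
  have h3 : HasFDerivAt confFactor _ y := h2.congr_of_eventuallyEq
    (Filter.Eventually.of_forall fun z => confFactor_eq z)
  have h4 := h3.rpow_const (p := 1 / 4) (Or.inl (confFactor_pos y).ne')
  have h5 := HasPartial.ofReal (i := i) (f := fun z => confFactor z ^ (1 / 4 : ℝ))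
    (a := -y i * stereoScale y * confFactor y ^ (1 / 4 : ℝ))
    (by exact h4.differentiableAt.hasFDerivAt) (by
      rw [h4.fderiv, Real.rpow_sub_one (confFactor_pos y).ne']
      have hs := (stereoScale_pos y).ne'
      rw [confFactor_eq]
      generalize (4 * stereoScale y ^ 2) ^ (1 / 4 : ℝ) = w
      have hn : stereoScale y * (‖y‖ ^ 2 + 1) = 1 :=
        inv_mul_cancel₀ (norm_sq_add_one_pos y).ne'
      simp [EuclideanSpace.inner_single_right]
      field_simp
      linear_combination (-4 * w * y i * (stereoScale y * (‖y‖ ^ 2 + 1) + 1)) * hn)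
  simpa using h5

/-- Chain rule through `stereoCone`. The factor 1/(r² + 1) appears because the derivative of the
radial extension has degree -1 and `stereoCone y` has norm r² + 1. -/
theorem hasPartial_pullback (f : Smooth U) {y : E3} (hy : stereo y ∈ U) (i : Fin 3) :
    HasPartial i (pullback f) ((stereoScale y : ℂ) * (2 * pullback (E i.castSucc f) y +
      -2 * (y i : ℂ) * pullback (E 3 f) y)) y := by
  have hc := stereoCone_mem_cone hy
  have h1 := (differentiableAt_radialExt' f hc).hasFDerivAt
  have h2 := (contDiff_stereoCone.differentiable (by simp) y).hasFDerivAt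
  have h3 := h1.comp y h2
  have h4 : HasFDerivAt (pullback f) _ y :=
    h3.congr_of_eventuallyEq (Filter.Eventually.of_forall fun z => pullback_eq f z)
  refine ⟨h4.differentiableAt, ?_⟩
  rw [h4.fderiv, pullback_eq, pullback_eq, radialExt_E _ _ hc, radialExt_E _ _ hc,
    norm_stereoCone]
  have hn : (stereoScale y : ℂ) * ((‖y‖ ^ 2 + 1 : ℝ) : ℂ) = 1 := by
    exact_mod_cast inv_mul_cancel₀ (norm_sq_add_one_pos y).ne'
  rw [ContinuousLinearMap.comp_apply, fderiv_stereoCone, map_sub, map_smul, map_smul]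
  simp only [Complex.real_smul]
  push_cast at hn ⊢
  linear_combination (-(2 * fderiv ℝ (radialExt f.1) (stereoCone y) (ev i.castSucc)) +
    2 * (y i : ℂ) * fderiv ℝ (radialExt f.1) (stereoCone y) (ev 3)) * hn

theorem continuous_stereo : Continuous stereo := by
  refine Continuous.subtype_mk ?_ _
  have h := contDiff_stereoCone.continuous
  refine Continuous.smul (Continuous.inv₀ (by fun_prop) fun x => (norm_sq_add_one_pos x).ne') h

theorem eventually_stereo_mem {x : E3} (hx : stereo x ∈ U) : ∀ᶠ y in nhds x, stereo y ∈ U :=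
  continuous_stereo.continuousAt.eventually (U.isOpen.mem_nhds hx)

theorem contDiffAt_pullback (f : Smooth U) {x : E3} (hx : stereo x ∈ U) :
    ContDiffAt ℝ 2 (pullback f) x := by
  have h1 := contDiffAt_radialExt f (stereoCone_mem_cone hx)
  have h2 := (h1.comp x contDiff_stereoCone.contDiffAt).of_le
    (show (2 : WithTop ℕ∞) ≤ ∞ from WithTop.coe_le_coe.2 (OrderTop.le_top (2 : ℕ∞)))
  exact h2.congr_of_eventuallyEq (Filter.Eventually.of_forall fun z => pullback_eq f z)

theorem contDiffAt_confFactor_rpow (x : E3) :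
    ContDiffAt ℝ 2 (fun z => ((confFactor z ^ (1 / 4 : ℝ) : ℝ) : ℂ)) x := by
  have h := contDiff_norm_sq ℝ (E := E3) (n := 2)
  have h1 : ContDiffAt ℝ 2 (fun z : E3 => 4 / (‖z‖ ^ 2 + 1) ^ 2) x :=
    contDiffAt_const.div ((h.add contDiff_const).pow 2).contDiffAt
      (pow_ne_zero 2 (norm_sq_add_one_pos x).ne')
  exact Complex.ofRealCLM.contDiff.contDiffAt.comp x
    (h1.rpow_const_of_ne (p := 1 / 4) (confFactor_pos x).ne')

theorem laplacian_eq_of_hasPartial {g : E3 → ℂ} {x : E3} (hg : ContDiffAt ℝ 2 g x)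
    {d : Fin 3 → E3 → ℂ} {d2 : Fin 3 → ℂ} (h1 : ∀ᶠ y in nhds x, ∀ i, HasPartial i g (d i y) y)
    (h2 : ∀ i, HasPartial i (d i) (d2 i) x) : (Δ g) x = ∑ i, d2 i := by
  rw [InnerProductSpace.laplacian_eq_iteratedFDeriv_orthonormalBasis g
    (EuclideanSpace.basisFun (Fin 3) ℝ)]
  refine Finset.sum_congr rfl fun i _ => ?_
  rw [iteratedFDeriv_two_apply, ← (h2 i).2]
  have hd : DifferentiableAt ℝ (fderiv ℝ g) x :=
    (hg.fderiv_right (m := 1) (by norm_num)).differentiableAt (by norm_num)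
  have he : (fun y => fderiv ℝ g y (e3 i)) =ᶠ[nhds x] d i := by
    filter_upwards [h1] with y hy using (hy i).2
  rw [← he.fderiv_eq, fderiv_clm_apply hd (differentiableAt_const _)]
  simp [e3]

theorem stereo_castSucc (x : E3) (i : Fin 3) :
    ((stereo x : E4) i.castSucc : ℂ) = 2 * (x i : ℂ) * (stereoScale x : ℂ) := by
  fin_cases i <;> simp [stereo, stereoVec, stereoScale] <;> ring

theorem stereo_three (x : E3) : ((stereo x : E4) 3 : ℂ) =
    (1 - ((x 0 : ℂ) ^ 2 + (x 1 : ℂ) ^ 2 + (x 2 : ℂ) ^ 2)) * (stereoScale x : ℂ) := by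
  have hr : (‖x‖ : ℂ) ^ 2 = (x 0 : ℂ) ^ 2 + (x 1 : ℂ) ^ 2 + (x 2 : ℂ) ^ 2 := by
    exact_mod_cast norm_sq_eq x
  rw [← hr]
  simp [stereo, stereoVec, stereoScale]; ring

theorem stereoScale_mul (x : E3) :
    (stereoScale x : ℂ) * ((x 0 : ℂ) ^ 2 + (x 1 : ℂ) ^ 2 + (x 2 : ℂ) ^ 2 + 1) = 1 := by
  have hr : (‖x‖ : ℂ) ^ 2 = (x 0 : ℂ) ^ 2 + (x 1 : ℂ) ^ 2 + (x 2 : ℂ) ^ 2 := by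
    exact_mod_cast norm_sq_eq x
  rw [← hr]
  exact_mod_cast inv_mul_cancel₀ (norm_sq_add_one_pos x).ne'

theorem stereo_sum_E (g : Smooth U) {x : E3} (hx : stereo x ∈ U) :
    2 * (x 0 : ℂ) * pullback (E 0 g) x + 2 * (x 1 : ℂ) * pullback (E 1 g) x +
      2 * (x 2 : ℂ) * pullback (E 2 g) x +
      (1 - ((x 0 : ℂ) ^ 2 + (x 1 : ℂ) ^ 2 + (x 2 : ℂ) ^ 2)) * pullback (E 3 g) x = 0 := by
  have hm : (stereoScale x : ℂ) ≠ 0 := Complex.ofReal_ne_zero.2 (stereoScale_pos x).ne'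
  have c0 : ((stereo x : E4) 0 : ℂ) = _ := stereo_castSucc x 0
  have c1 : ((stereo x : E4) 1 : ℂ) = _ := stereo_castSucc x 1
  have c2 : ((stereo x : E4) 2 : ℂ) = _ := stereo_castSucc x 2
  have c3 := stereo_three x
  simp only [pullback_of_mem _ hx]
  have e : ((stereo x : E4) 0 : ℂ) * (E 0 g).1 ⟨stereo x, hx⟩ +
      ((stereo x : E4) 1 : ℂ) * (E 1 g).1 ⟨stereo x, hx⟩ +
      ((stereo x : E4) 2 : ℂ) * (E 2 g).1 ⟨stereo x, hx⟩ +
      ((stereo x : E4) 3 : ℂ) * (E 3 g).1 ⟨stereo x, hx⟩ = 0 :=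
    congrFun (congrArg Subtype.val ((sphereCalc U).sum_E g)) ⟨stereo x, hx⟩
  refine (mul_eq_zero.1 ?_).resolve_left hm
  linear_combination e - (E 0 g).1 ⟨stereo x, hx⟩ * c0 - (E 1 g).1 ⟨stereo x, hx⟩ * c1 -
    (E 2 g).1 ⟨stereo x, hx⟩ * c2 - (E 3 g).1 ⟨stereo x, hx⟩ * c3

theorem stereo_E_comm (f : Smooth U) {x : E3} (hx : stereo x ∈ U) (i : Fin 3) :
    pullback (E 3 (E i.castSucc f)) x = pullback (E i.castSucc (E 3 f)) x +
      (1 - ((x 0 : ℂ) ^ 2 + (x 1 : ℂ) ^ 2 + (x 2 : ℂ) ^ 2)) * (stereoScale x : ℂ) *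
        pullback (E i.castSucc f) x -
      2 * (x i : ℂ) * (stereoScale x : ℂ) * pullback (E 3 f) x := by
  rw [← stereo_castSucc, ← stereo_three]
  simp only [pullback_of_mem _ hx]
  exact congrFun (congrArg Subtype.val (E_comm 3 i.castSucc f)) ⟨stereo x, hx⟩

theorem pullback_laplaceBeltrami (f : Smooth U) {x : E3} (hx : stereo x ∈ U) :
    pullback (laplaceBeltrami f) x = pullback (E 0 (E 0 f)) x + pullback (E 1 (E 1 f)) x +
      pullback (E 2 (E 2 f)) x + pullback (E 3 (E 3 f)) x := by
  simp only [pullback_of_mem _ hx]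
  exact congrFun (congrArg Subtype.val (laplaceBeltrami_apply f)) ⟨stereo x, hx⟩

/-- The second partial derivatives of `u^{1/4} (f ∘ σ)`, up to the factor `u^{1/4}`. -/
def secondPartial (f : Smooth U) (x : E3) (i : Fin 3) : ℂ :=
  -3 * (x i : ℂ) * (stereoScale x : ℂ) ^ 2 * (-(x i : ℂ) * pullback f x +
      2 * pullback (E i.castSucc f) x - 2 * (x i : ℂ) * pullback (E 3 f) x) +
    (stereoScale x : ℂ) * (-pullback f x - 2 * pullback (E 3 f) x +
      (stereoScale x : ℂ) * (-(x i : ℂ) * (2 * pullback (E i.castSucc f) x -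
        2 * (x i : ℂ) * pullback (E 3 f) x) +
      2 * (2 * pullback (E i.castSucc (E i.castSucc f)) x -
        2 * (x i : ℂ) * pullback (E 3 (E i.castSucc f)) x) -
      2 * (x i : ℂ) * (2 * pullback (E i.castSucc (E 3 f)) x -
        2 * (x i : ℂ) * pullback (E 3 (E 3 f)) x)))

/-- Mixed second derivatives are reordered by `stereo_E_comm`. The radial combinations ∑ x_i E_i f
and ∑ x_i E_i E_4 f are then eliminated by ∑ s_i E_i = 0, applied to f and to E_4 f. -/
theorem sum_secondPartial (f : Smooth U) {x : E3} (hx : stereo x ∈ U) :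
    ∑ i, secondPartial f x i =
      (stereoScale x : ℂ) ^ 2 * (4 * pullback (laplaceBeltrami f) x - 3 * pullback f x) := by
  have r1 := stereo_sum_E f hx
  have r2 := stereo_sum_E (E 3 f) hx
  have hw := stereoScale_mul x
  rw [Fin.sum_univ_three]
  simp only [secondPartial, stereo_E_comm f hx, pullback_laplaceBeltrami f hx]
  simp only [show (0 : Fin 3).castSucc = (0 : Fin 4) from rfl,
    show (1 : Fin 3).castSucc = (1 : Fin 4) from rfl,
    show (2 : Fin 3).castSucc = (2 : Fin 4) from rfl]
  generalize (x 0 : ℂ) = a0 at *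
  generalize (x 1 : ℂ) = a1 at *
  generalize (x 2 : ℂ) = a2 at *
  generalize (stereoScale x : ℂ) = m at *
  linear_combination (-4 * m ^ 2) * r2 +
    (-4 * m ^ 2 - 2 * m ^ 3 * (1 - (a0 ^ 2 + a1 ^ 2 + a2 ^ 2))) * r1 +
    (pullback (E 3 f) x * (2 * m * (m * (a0 ^ 2 + a1 ^ 2 + a2 ^ 2 + 1) + 3)) +
      3 * m * pullback f x) * hw

/-- With m = 1/(r² + 1) one has u = 4m² and ∂_i u^{1/4} = -x_i m u^{1/4}, so every partial
derivative keeps the factor u^{1/4}. Dividing by u leaves Δ_S f - (3/4) f. -/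
theorem laplacian_confFactor_mul_pullback (f : Smooth U) {x : E3} (hx : stereo x ∈ U) :
    (Δ fun z => ((confFactor z ^ (1 / 4 : ℝ) : ℝ) : ℂ) * pullback f z) x =
      ((confFactor x ^ (1 / 4 : ℝ) : ℝ) : ℂ) * ((stereoScale x : ℂ) ^ 2 *
        (4 * pullback (laplaceBeltrami f) x - 3 * pullback f x)) := by
  have hB : ∀ i : Fin 3,
      HasPartial i (fun z => -1 * (z i : ℂ) * pullback f z + 2 * pullback (E i.castSucc f) z +
        -2 * (z i : ℂ) * pullback (E 3 f) z) _ x := fun i =>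
    ((((HasPartial.const (-1)).mul (HasPartial.coord i)).mul (hasPartial_pullback f hx i)).add
      ((HasPartial.const 2).mul (hasPartial_pullback (E i.castSucc f) hx i))).add
      (((HasPartial.const (-2)).mul (HasPartial.coord i)).mul (hasPartial_pullback (E 3 f) hx i))
  rw [← sum_secondPartial f hx, Finset.mul_sum]
  refine laplacian_eq_of_hasPartial ((contDiffAt_confFactor_rpow x).mul (contDiffAt_pullback f hx))
    (d := fun i y => ((confFactor y ^ (1 / 4 : ℝ) : ℝ) : ℂ) * ((stereoScale y : ℂ) *
      (-1 * (y i : ℂ) * pullback f y + 2 * pullback (E i.castSucc f) y +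
        -2 * (y i : ℂ) * pullback (E 3 f) y))) ?_ (fun i => ?_)
  · filter_upwards [eventually_stereo_mem hx] with y hy i
    have e := (hasPartial_confFactor_rpow i y).mul (hasPartial_pullback f hy i)
    refine ⟨e.1, e.2.trans ?_⟩
    ring
  · have e := (hasPartial_confFactor_rpow i x).mul ((hasPartial_stereoScale i x).mul (hB i))
    refine ⟨e.1, e.2.trans ?_⟩
    rw [if_pos rfl, secondPartial]
    ring

/-! ### The Stäckel transform -/

theorem mapsTo_stereo : Set.MapsTo stereo {x : E3 | ∀ i, x i ≠ 0} (region3 : Set S3) := by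
  intro x hx
  have h := stereoScale_pos x
  have e : ∀ i : Fin 3, (stereo x : E4) i.castSucc = 2 * x i * stereoScale x := fun i => by
    exact_mod_cast stereo_castSucc x i
  have hne : ∀ i : Fin 3, (stereo x : E4) i.castSucc ≠ 0 := fun i => by
    rw [e]; exact mul_ne_zero (mul_ne_zero two_ne_zero (hx i)) h.ne'
  exact ⟨⟨hne 0, hne 1⟩, hne 2⟩

theorem sum_sq_S3 (s : S3) : (s : E4) 0 ^ 2 + (s : E4) 1 ^ 2 + (s : E4) 2 ^ 2 + (s : E4) 3 ^ 2 =
    (1 : ℝ) := by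
  have h : ‖(s : E4)‖ ^ 2 = 1 := by rw [norm_eq_of_mem_sphere s]; norm_num
  rwa [EuclideanSpace.real_norm_sq_eq, Fin.sum_univ_four] at h

theorem one_add_pos_of_mem_region3 {s : S3} (hs : s ∈ region3) : 0 < 1 + (s : E4) 3 := by
  have h := sum_sq_S3 s
  have h0 : 0 < (s : E4) 0 ^ 2 := by have := hs.1.1; positivity
  nlinarith [sq_nonneg ((s : E4) 1), sq_nonneg ((s : E4) 2)]

theorem stereoInv_apply (s : S3) (i : Fin 3) :
    stereoInv s i = (1 + (s : E4) 3)⁻¹ * (s : E4) i.castSucc := by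
  fin_cases i <;> simp [stereoInv]

theorem mapsTo_stereoInv : Set.MapsTo stereoInv (region3 : Set S3) {x : E3 | ∀ i, x i ≠ 0} := by
  intro s hs i
  have h := (one_add_pos_of_mem_region3 hs).ne'
  rw [stereoInv_apply]
  refine mul_ne_zero (inv_ne_zero h) ?_
  fin_cases i
  exacts [hs.1.1, hs.1.2, hs.2]

theorem stereoInv_stereo (x : E3) : stereoInv (stereo x) = x := by
  have h := norm_sq_add_one_pos x
  have h3 : (stereo x : E4) 3 = (‖x‖ ^ 2 + 1)⁻¹ * (1 - ‖x‖ ^ 2) := by simp [stereo, stereoVec]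
  have hi : (1 + (stereo x : E4) 3)⁻¹ = (‖x‖ ^ 2 + 1) / 2 := by
    rw [h3, inv_eq_iff_eq_inv]
    field_simp
    ring
  ext i
  have e : (stereo x : E4) i.castSucc = 2 * x i * stereoScale x := by
    exact_mod_cast stereo_castSucc x i
  rw [stereoInv_apply, hi, e, stereoScale]
  field_simp

theorem stereo_stereoInv {s : S3} (hs : s ∈ region3) : stereo (stereoInv s) = s := by
  have h := one_add_pos_of_mem_region3 hs
  have hsq := sum_sq_S3 s
  have hn : ‖stereoInv s‖ ^ 2 = (1 - (s : E4) 3) / (1 + (s : E4) 3) := by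
    have e0 : stereoInv s 0 = (1 + (s : E4) 3)⁻¹ * (s : E4) 0 := stereoInv_apply s 0
    have e1 : stereoInv s 1 = (1 + (s : E4) 3)⁻¹ * (s : E4) 1 := stereoInv_apply s 1
    have e2 : stereoInv s 2 = (1 + (s : E4) 3)⁻¹ * (s : E4) 2 := stereoInv_apply s 2
    rw [norm_sq_eq, e0, e1, e2]
    field_simp
    linear_combination hsq
  have hn1 : (‖stereoInv s‖ ^ 2 + 1)⁻¹ = (1 + (s : E4) 3) / 2 := by
    rw [hn, inv_eq_iff_eq_inv]
    field_simp
    ring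
  apply Subtype.ext
  change stereoVec (stereoInv s) = (s : E4)
  ext j
  rw [stereoVec_eq, hn1]
  have key : ∀ i : Fin 3, (1 + (s : E4) 3) / 2 * (2 * stereoInv s i) = (s : E4) i.castSucc := by
    intro i
    rw [stereoInv_apply]
    field_simp
  fin_cases j
  · exact key 0
  · exact key 1
  · exact key 2
  · change (1 + (s : E4) 3) / 2 * (1 - ‖stereoInv s‖ ^ 2) = (s : E4) 3
    rw [hn]
    field_simp
    ring

theorem invOn_stereo : Set.InvOn stereoInv stereo {x : E3 | ∀ i, x i ≠ 0} (region3 : Set S3) :=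
  ⟨fun x _ => stereoInv_stereo x, fun _ hs => stereo_stereoInv hs⟩

theorem rpow_neg_mul_rpow {u : ℝ} (hu : 0 < u) :
    ((u ^ (-(1 / 4) : ℝ) : ℝ) : ℂ) * ((u ^ (1 / 4 : ℝ) : ℝ) : ℂ) = 1 := by
  rw [← Complex.ofReal_mul, ← Real.rpow_add hu]
  norm_num

theorem stackel_Hflat (hU : U ≤ region3) (a : Fin 5 → ℂ) (f : Smooth U) {x : E3}
    (hx : stereo x ∈ U) :
    stackel confFactor (Hflat ![a 0, a 1, a 2, a 3, a 4 + 3 / 4]) (pullback f) x =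
      (Hext hU a f).1 ⟨stereo x, hx⟩ := by
  have hs : (stereo x : S3) ∈ region3 := hU hx
  have hm := stereoScale_pos x
  have hx0 : ∀ i : Fin 3, x i ≠ 0 := fun i => by
    have := mapsTo_stereoInv hs i
    rwa [stereoInv_stereo] at this
  have hr : 0 < ‖x‖ := norm_pos_iff.2 fun h => hx0 0 (by rw [h]; rfl)
  have hρ : √((stereo x : E4) 0 ^ 2 + (stereo x : E4) 1 ^ 2 + (stereo x : E4) 2 ^ 2) =
      2 * ‖x‖ * stereoScale x := by
    have e0 : (stereo x : E4) 0 = 2 * x 0 * stereoScale x := by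
      exact_mod_cast stereo_castSucc x 0
    have e1 : (stereo x : E4) 1 = 2 * x 1 * stereoScale x := by
      exact_mod_cast stereo_castSucc x 1
    have e2 : (stereo x : E4) 2 = 2 * x 2 * stereoScale x := by
      exact_mod_cast stereo_castSucc x 2
    rw [Real.sqrt_eq_iff_mul_self_eq (by positivity) (by positivity), e0, e1, e2]
    linear_combination (-4 * stereoScale x ^ 2) * norm_sq_eq x
  have h3 : ((stereo x : E4) 3 : ℂ) = (1 - (‖x‖ : ℂ) ^ 2) * (stereoScale x : ℂ) := by
    simp [stereo, stereoVec, stereoScale]; ring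
  have hR : (Hext hU a f).1 ⟨stereo x, hx⟩ = (laplaceBeltrami f).1 ⟨stereo x, hx⟩ +
      (a 0 * (((stereo x : E4) 3 : ℂ) *
        ((√((stereo x : E4) 0 ^ 2 + (stereo x : E4) 1 ^ 2 + (stereo x : E4) 2 ^ 2) : ℝ) : ℂ)⁻¹) +
      a 1 * (((stereo x : E4) 0 : ℂ)⁻¹) ^ 2 + a 2 * (((stereo x : E4) 1 : ℂ)⁻¹) ^ 2 +
      a 3 * (((stereo x : E4) 2 : ℂ)⁻¹) ^ 2 + a 4 * 1) * f.1 ⟨stereo x, hx⟩ := rfl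
  have c0 : ((stereo x : E4) 0 : ℂ) = _ := stereo_castSucc x 0
  have c1 : ((stereo x : E4) 1 : ℂ) = _ := stereo_castSucc x 1
  have c2 : ((stereo x : E4) 2 : ℂ) = _ := stereo_castSucc x 2
  rw [hR, hρ, h3, c0, c1, c2, stackel, Hflat, laplacian_confFactor_mul_pullback f hx,
    pullback_of_mem _ hx, pullback_of_mem _ hx]
  -- Of the two fractional powers only the fact that they are inverse to each other is needed from
  -- here on.
  have hw := rpow_neg_mul_rpow (confFactor_pos x)
  generalize (confFactor x ^ (-(1 / 4) : ℝ) : ℝ) = w' at *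
  generalize (confFactor x ^ (1 / 4 : ℝ) : ℝ) = w at *
  have hn : ‖x‖ ^ 2 + 1 = (stereoScale x)⁻¹ := by rw [stereoScale, inv_inv]
  rw [hn, confFactor_eq]
  have y0 := Complex.ofReal_ne_zero.2 (hx0 0)
  have y1 := Complex.ofReal_ne_zero.2 (hx0 1)
  have y2 := Complex.ofReal_ne_zero.2 (hx0 2)
  have yr := Complex.ofReal_ne_zero.2 hr.ne'
  have ym := Complex.ofReal_ne_zero.2 hm.ne'
  have hw' : (w' : ℂ) ≠ 0 := left_ne_zero_of_mul_eq_one hw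
  have hw0 : (w : ℂ) = (w' : ℂ)⁻¹ := eq_inv_of_mul_eq_one_right hw
  rw [hw0]
  simp only [Matrix.cons_val]
  push_cast
  field_simp
  ring

/-! ### Normal forms of differential operators of low order -/

/-- The coefficients of the first order part of an operator of order one. -/
def sym1 (A : Op U) (i : Fin 4) : Smooth U := ad (coord i) A 1

/-- Twice the coefficients of the second order part of an operator of order two. -/
def sym2 (A : Op U) (i j : Fin 4) : Smooth U := ad (coord i) (ad (coord j) A) 1

theorem ad_apply (f g : Smooth U) (A : Op U) : ad f A g = A (f * g) - f * A g := rfl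

theorem ad_comm (f g : Smooth U) (A : Op U) : ad f (ad g A) = ad g (ad f A) := by
  apply LinearMap.ext; intro h
  simp only [ad_apply, mul_sub, ← mul_assoc, mul_comm f g]
  abel

theorem sym2_comm (A : Op U) (i j : Fin 4) : sym2 A i j = sym2 A j i := by
  rw [sym2, ad_comm, sym2]

theorem sym1_add (A B : Op U) (i : Fin 4) : sym1 (A + B) i = sym1 A i + sym1 B i := by
  rw [sym1, ad_add]; rfl

theorem sym1_smul (c : ℂ) (A : Op U) (i : Fin 4) : sym1 (c • A) i = c • sym1 A i := by
  rw [sym1, ad_smul]; rfl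

theorem sym2_add (A B : Op U) (i j : Fin 4) : sym2 (A + B) i j = sym2 A i j + sym2 B i j := by
  rw [sym2, ad_add, ad_add]; rfl

theorem sym2_smul (c : ℂ) (A : Op U) (i j : Fin 4) : sym2 (c • A) i j = c • sym2 A i j := by
  rw [sym2, ad_smul, ad_smul]; rfl

theorem sym1_mulOp (f : Smooth U) (i : Fin 4) : sym1 (mulOp f) i = 0 := by
  rw [sym1, ad_mulOp]; rfl

theorem eq_mulOp_of_mem_zero {A : Op U} (hA : A ∈ diffOp U 0) : A = mulOp (A 1) := by
  obtain ⟨f, rfl⟩ := hA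
  rw [mulOp_apply, mul_one]

theorem sum_J_coord_mul_E (j k : Fin 4) (h : Smooth U) :
    ∑ i, J j k (coord i) * E i h = J j k h := by
  have e : ∀ i, J j k (coord i : Smooth U) * E i h =
      (if k = i then coord j * E i h else 0) - (if j = i then coord k * E i h else 0) := fun i => by
    rw [J_coord]; split_ifs <;> ring
  rw [Finset.sum_congr rfl fun i _ => e i, Finset.sum_sub_distrib, Finset.sum_ite_eq,
    Finset.sum_ite_eq, if_pos (Finset.mem_univ _), if_pos (Finset.mem_univ _), J_eq]

/-- The fields E_i are linearly dependent over the functions, but the coefficients [A, s_i] give a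
canonical expansion: it is additive in A and correct for a rotation because ∑ J(s_i) E_i = J. -/
theorem apply_of_mem_diffOp_one {A : Op U} (hA : A ∈ diffOp U 1) (h : Smooth U) :
    A h = A 1 * h + ∑ i, sym1 A i * E i h := by
  refine diffOp_induction (P := fun A => ∀ h, A h = A 1 * h + ∑ i, sym1 A i * E i h)
    ?_ ?_ ?_ hA h
  · rintro _ ⟨f, rfl⟩ h
    simp only [sym1_mulOp, zero_mul, Finset.sum_const_zero, mulOp_apply, mul_one, add_zero]
  · rintro j k _ ⟨f, rfl⟩ h
    have e : ∀ i, sym1 (J j k * mulOp f) i * E i h = f * (J j k (coord i) * E i h) := fun i => by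
      rw [sym1, ad_mul, ad_mulOp, ad_J, mul_zero, add_zero]
      simp only [Module.End.mul_apply, mulOp_apply]
      ring
    simp only [e, ← Finset.mul_sum, sum_J_coord_mul_E, Module.End.mul_apply, mulOp_apply,
      J_mul_apply, mul_one]
    ring
  · intro A B hA hB h
    simp only [sym1_add, add_mul, Finset.sum_add_distrib, LinearMap.add_apply]
    rw [hA, hB]
    ring

theorem eq_of_mem_diffOp_one {A : Op U} (hA : A ∈ diffOp U 1) :
    A = mulOp (A 1) + ∑ i, mulOp (sym1 A i) * E i := by
  apply LinearMap.ext; intro h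
  rw [apply_of_mem_diffOp_one hA h]
  simp only [LinearMap.add_apply, LinearMap.sum_apply, Module.End.mul_apply, mulOp_apply]

/-- Here `d j`, `e i j` and `w i j` stand for E_j h, E_i E_j h and E_i l_j. Symmetrizing the
coefficients v_i l_j costs only commutators of the E_i, which have first order. -/
theorem symmetrize_sum {C : Type*} [CommRing C] [Algebra ℂ C] (x : C) (v l s d : Fin 4 → C)
    (e w : Fin 4 → Fin 4 → C) (he : ∀ i j, e i j = e j i + s i * d j - s j * d i) :
    x + ∑ i, ∑ j, v i * (l j * e i j + d j * w i j) -
      ∑ i, ∑ j, ((1 / 2 : ℂ) • (v i * l j + v j * l i)) * e i j =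
    x + ∑ i, ∑ j, (v i * w i j * d j + (1 / 2 : ℂ) • (v i * l j * (s i * d j - s j * d i))) := by
  have hc : algebraMap ℂ C (1 / 2) + algebraMap ℂ C (1 / 2) = 1 := by
    rw [← map_add, add_halves, map_one]
  have h2 : ∑ i, ∑ j, ((1 / 2 : ℂ) • (v i * l j + v j * l i)) * e i j =
      ∑ i, ∑ j, ((1 / 2 : ℂ) • (v i * l j)) * (e i j + e j i) := by
    simp only [smul_add, add_mul, mul_add, Finset.sum_add_distrib]
    rw [Finset.sum_comm (f := fun i j => ((1 / 2 : ℂ) • (v j * l i)) * e i j)]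
  rw [h2, add_sub_assoc, ← Finset.sum_sub_distrib]
  congr 1
  refine Finset.sum_congr rfl fun i _ => ?_
  rw [← Finset.sum_sub_distrib]
  refine Finset.sum_congr rfl fun j _ => ?_
  rw [he i j]
  simp only [Algebra.smul_def]
  linear_combination (-v i * l j * (e j i + s i * d j - s j * d i)) * hc

theorem sum_mem_diffOp {ι : Type*} (s : Finset ι) {n : ℕ} {A : ι → Op U}
    (h : ∀ i ∈ s, A i ∈ diffOp U n) : ∑ i ∈ s, A i ∈ diffOp U n := Submodule.sum_mem _ h

/-- For J times a first order operator with coefficients l the leading coefficients are v_i l_j with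
v_i = J s_i. The symmetric coefficients `sym2` reproduce them up to terms of first order. -/
theorem sub_sum_sym2_mem {A : Op U} (hA : A ∈ diffOp U 2) :
    A - ∑ i, ∑ j, mulOp (((1 / 2 : ℂ)) • sym2 A i j) * (E i * E j) ∈ diffOp U 1 := by
  refine diffOp_induction (P := fun A =>
    A - ∑ i, ∑ j, mulOp (((1 / 2 : ℂ)) • sym2 A i j) * (E i * E j) ∈ diffOp U 1) ?_ ?_ ?_ hA
  · intro A hA
    have e : ∀ i j, sym2 A i j = 0 := fun i j => by
      rw [sym2, ad_of_mem_zero _ (ad_mem _ hA)]; rfl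
    simp only [e, smul_zero, map_zero, zero_mul, Finset.sum_const_zero]
    exact op_sub_mem hA (zero_mem _)
  · intro a b C hC
    set v : Fin 4 → Smooth U := fun i => J a b (coord i) with hv
    set l : Fin 4 → Smooth U := sym1 C with hl
    have hs : ∀ i j, sym2 (J a b * C) i j = v i * l j + v j * l i := fun i j => by
      have h1 := ad_of_mem_zero (coord i) (ad_mem (coord j) hC)
      rw [sym2, ad_mul, ad_add, ad_mul, ad_mul, ad_J, ad_mulOp, h1, zero_mul, mul_zero, zero_add,
        add_zero, ad_J]
      simp only [LinearMap.add_apply, Module.End.mul_apply, mulOp_apply]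
      simp only [hv, hl, sym1]
      ring
    have key : J a b * C - ∑ i, ∑ j, mulOp (((1 / 2 : ℂ)) • sym2 (J a b * C) i j) * (E i * E j) =
        J a b * mulOp (C 1) + ∑ i, ∑ j, (mulOp (v i * E i (l j)) * E j +
          (1 / 2 : ℂ) • (mulOp (v i * l j) * (mulOp (coord i) * E j - mulOp (coord j) * E i))) := by
      apply LinearMap.ext; intro h
      simp only [LinearMap.add_apply, LinearMap.sub_apply, LinearMap.sum_apply,
        LinearMap.smul_apply, Module.End.mul_apply, mulOp_apply, hs]
      have h1 : J a b (∑ j, l j * E j h) =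
          ∑ i, ∑ j, v i * (l j * E i (E j h) + E j h * E i (l j)) := by
        rw [← sum_J_coord_mul_E]
        simp only [map_sum, E_mul, Finset.mul_sum, hv]
      rw [apply_of_mem_diffOp_one hC h, map_add, h1]
      have h2 := symmetrize_sum (J a b (C 1 * h)) v l coord (fun i => E i h)
        (fun i j => E i (E j h)) (fun i j => E i (l j)) fun i j => E_comm i j h
      convert h2 using 1
    rw [key]
    refine add_mem (J_mul_mem a b (mulOp_mem _)) (sum_mem_diffOp _ fun i _ =>
      sum_mem_diffOp _ fun j _ => add_mem (mulOp_mul_mem _ (E_mem j)) (Submodule.smul_mem _ _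
      (mulOp_mul_mem _ (op_sub_mem (mulOp_mul_mem _ (E_mem j)) (mulOp_mul_mem _ (E_mem i))))))
  · intro A B hA hB
    have e : A + B - ∑ i, ∑ j, mulOp (((1 / 2 : ℂ)) • sym2 (A + B) i j) * (E i * E j) =
        (A - ∑ i, ∑ j, mulOp (((1 / 2 : ℂ)) • sym2 A i j) * (E i * E j)) +
        (B - ∑ i, ∑ j, mulOp (((1 / 2 : ℂ)) • sym2 B i j) * (E i * E j)) := by
      simp only [sym2_add, smul_add, map_add, add_mul, Finset.sum_add_distrib]
      apply LinearMap.ext; intro h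
      simp only [LinearMap.add_apply, LinearMap.sub_apply]
      abel
    rw [e]
    exact add_mem hA hB

/-! ### The Killing equation -/

theorem ad_eq_of_mem_one (f : Smooth U) {A : Op U} (hA : A ∈ diffOp U 1) :
    ad f A = mulOp (∑ a, sym1 A a * E a f) := by
  rw [eq_mulOp_of_mem_zero (ad_mem f hA), ad_apply, apply_of_mem_diffOp_one hA, mul_one,
    mul_comm f, add_sub_cancel_left]

/-- Tangency of the first order part: apply A to ∑ s_i² = 1, which gives twice the sum. -/
theorem sum_sym1_mul_coord {A : Op U} (hA : A ∈ diffOp U 1) : ∑ a, sym1 A a * coord a = 0 := by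
  have h : ∀ i, A (coord i * coord i) = A 1 * (coord i * coord i) +
      ((coord i * sym1 A i) + (coord i * sym1 A i)) := fun i => by
    have h1 : ∀ j f, A (coord j * f) = sym1 A j * f + coord j * A f := fun j f => by
      have h2 := LinearMap.congr_fun (eq_mulOp_of_mem_zero (ad_mem (coord j) hA)) f
      rw [ad_apply, mulOp_apply] at h2
      rw [sym1, ← h2]; ring
    have h3 := h1 i 1
    rw [mul_one, mul_one] at h3
    rw [h1, h3]; ring
  have h1 := congrArg A (sum_coord_sq (U := U))
  simp only [map_sum, pow_two, h, Finset.sum_add_distrib, ← Finset.mul_sum] at h1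
  have h2 := sum_coord_sq (U := U)
  simp only [pow_two] at h2
  rw [h2, mul_one, add_eq_left] at h1
  have h3 := congrArg (fun f => (1 / 2 : ℂ) • f) h1
  simp only [smul_add, ← add_smul, smul_zero] at h3
  norm_num at h3
  simpa only [mul_comm] using h3

theorem ad_H_apply (V : Smooth U) (i : Fin 4) (h : Smooth U) :
    ad (coord i) (laplaceBeltrami + mulOp V : Op U) h = 2 * E i h - 3 * (coord i * h) := by
  have h1 := (sphereCalc U).lap_s_mul i h
  simp only [sphereCalc_s, sphereCalc_E] at h1
  rw [ad_add, ad_mulOp, add_zero]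
  simp only [ad_apply, laplaceBeltrami_apply, h1]
  ring

theorem ad_ad_H (V : Smooth U) (i j : Fin 4) :
    ad (coord j) (ad (coord i) (laplaceBeltrami + mulOp V : Op U)) =
      mulOp ((2 : ℂ) • E i (coord j)) := by
  apply LinearMap.ext; intro h
  rw [ad_apply, ad_H_apply, ad_H_apply, E_mul, mulOp_apply]
  simp only [Algebra.smul_def, map_ofNat]
  ring

theorem E_two_mul (i : Fin 4) (f : Smooth U) : E i (2 * f) = 2 * E i f := by
  rw [two_mul, map_add, two_mul]

theorem eq_zero_of_two_mul {f : Smooth U} (h : 2 * f = 0) : f = 0 := by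
  apply Subtype.ext; funext p
  have h5 : (2 : ℂ) * f.1 p = 0 := congrArg (fun f : Smooth U => f.1 p) h
  exact (mul_eq_zero.1 h5).resolve_left two_ne_zero

theorem E_coord_symm (i j : Fin 4) : E i (coord j : Smooth U) = E j (coord i) :=
  (sphereCalc U).E_s_symm i j

theorem sum_mul_E_coord (l : Fin 4 → Smooth U) (h : ∑ a, l a * coord a = 0) (j : Fin 4) :
    ∑ a, l a * E a (coord j) = l j := by
  have e : ∀ a, l a * E a (coord j) = (if a = j then l a else 0) - l a * coord a * coord j :=
    fun a => by rw [E_coord]; split_ifs <;> ring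
  rw [Finset.sum_congr rfl fun a _ => e a, Finset.sum_sub_distrib, ← Finset.sum_mul, h, zero_mul,
    sub_zero, Finset.sum_ite_eq', if_pos (Finset.mem_univ _)]

theorem sum_mul_E_E_coord (l : Fin 4 → Smooth U) (h : ∑ a, l a * coord a = 0) (i j : Fin 4) :
    ∑ a, l a * E a (E i (coord j)) = -(l i * coord j + l j * coord i) := by
  have e : ∀ a, l a * E a (E i (coord j)) = -(coord j * (l a * E a (coord i)) +
      coord i * (l a * E a (coord j))) := fun a => by
    have h0 : E a ((if i = j then 1 else 0 : Smooth U)) = 0 := by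
      split_ifs
      · exact (derE a).map_one_eq_zero
      · exact map_zero _
    rw [E_coord i j, map_sub, h0, E_mul]
    ring
  rw [Finset.sum_congr rfl fun a _ => e a, Finset.sum_neg_distrib, Finset.sum_add_distrib,
    ← Finset.mul_sum, ← Finset.mul_sum, sum_mul_E_coord l h, sum_mul_E_coord l h]
  ring

/-- The first order part of a symmetry without second order part is a Killing vector. -/
theorem killing_one {V : Smooth U} {S B : Op U} (hS : S ∈ diffOp U 1) (hB : B ∈ diffOp U 1)
    (hc : S * (laplaceBeltrami + mulOp V) = (laplaceBeltrami + mulOp V) * S + B) (i j : Fin 4) :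
    E i (sym1 S j) + coord i * sym1 S j + (E j (sym1 S i) + coord j * sym1 S i) = 0 := by
  have hl : ∀ i, ad (coord i) S = mulOp (sym1 S i) := fun i => eq_mulOp_of_mem_zero (ad_mem _ hS)
  obtain ⟨K, hK⟩ : ∃ K : Fin 4 → Op U, ∀ i, ad (coord i) (laplaceBeltrami + mulOp V) = K i :=
    ⟨_, fun _ => rfl⟩
  have hK1 : ∀ i h, K i h = 2 * E i h - 3 * (coord i * h) := fun i h => by
    rw [← hK, ad_H_apply]
  have hK2 : ∀ i j, ad (coord j) (K i) = mulOp ((2 : ℂ) • E i (coord j)) := fun i j => by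
    rw [← hK, ad_ad_H]
  -- Two commutators with coordinates extract the second order part of [S, H]; the term B, of order
  -- one, is destroyed by them.
  have h := congrArg (fun A => ad (coord j) (ad (coord i) A) 1) hc
  rw [ad_add, ad_add, ad_of_mem_zero (coord j) (ad_mem (coord i) hB), add_zero] at h
  simp only [ad_mul, ad_add (U := U) _ (_ * _), hK, hK2, hl, ad_mulOp, zero_mul,
    mul_zero, zero_add, add_zero] at h
  have h2 := sum_mul_E_E_coord _ (sum_sym1_mul_coord hS) i j
  have h0 : ∀ i, E i (1 : Smooth U) = 0 := fun i => (derE i).map_one_eq_zero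
  simp only [LinearMap.add_apply, Module.End.mul_apply, mulOp_apply, mul_one, hK1, h0] at h
  rw [apply_of_mem_diffOp_one hS ((2 : ℂ) • _)] at h
  simp only [Algebra.smul_def, map_ofNat, E_two_mul, mul_left_comm _ (2 : Smooth U),
    ← Finset.mul_sum, h2] at h
  exact eq_zero_of_two_mul (by linear_combination -h)

/-- The second order part of a symmetry is a Killing tensor. -/
theorem killing_two {V : Smooth U} {S : Op U} (hS : S ∈ diffOp U 2)
    (hc : Commute S (laplaceBeltrami + mulOp V)) (i j c : Fin 4) :
    E c (sym2 S i j) + E i (sym2 S j c) + E j (sym2 S c i) +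
      2 * (coord c * sym2 S i j + coord i * sym2 S j c + coord j * sym2 S c i) = 0 := by
  have h1 : ∀ i, ad (coord i) S ∈ diffOp U 1 := fun i => ad_mem _ hS
  have hl : ∀ i j, ad (coord i) (ad (coord j) S) = mulOp (sym2 S i j) := fun i j =>
    eq_mulOp_of_mem_zero (ad_mem _ (h1 j))
  obtain ⟨K, hK⟩ : ∃ K : Fin 4 → Op U, ∀ i, ad (coord i) (laplaceBeltrami + mulOp V) = K i :=
    ⟨_, fun _ => rfl⟩
  have hK1 : ∀ i h, K i h = 2 * E i h - 3 * (coord i * h) := fun i h => by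
    rw [← hK, ad_H_apply]
  have hK2 : ∀ i j, ad (coord j) (K i) = mulOp ((2 : ℂ) • E i (coord j)) := fun i j => by
    rw [← hK, ad_ad_H]
  -- Three commutators extract the third order part of [S, H], in which the potential no longer
  -- appears.
  have h := congrArg (fun A => ad (coord c) (ad (coord j) (ad (coord i) A)) 1) hc.eq
  simp only [ad_mul, ad_add (U := U) _ (_ * _), ad_add (U := U) _ (_ + _), hK, hK2, hl,
    ad_mulOp, zero_mul, mul_zero, zero_add, add_zero] at h
  have h2 : ∀ i j c, ∑ a, sym1 (ad (coord c) S) a * E a (E i (coord j)) =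
      -(sym2 S i c * coord j + sym2 S j c * coord i) := fun i j c =>
    sum_mul_E_E_coord _ (sum_sym1_mul_coord (h1 c)) i j
  have h0 : ∀ i, E i (1 : Smooth U) = 0 := fun i => (derE i).map_one_eq_zero
  simp only [LinearMap.add_apply, Module.End.mul_apply, mulOp_apply, mul_one, hK1, h0] at h
  simp only [apply_of_mem_diffOp_one (h1 _) ((2 : ℂ) • _)] at h
  simp only [Algebra.smul_def, map_ofNat, E_two_mul, mul_left_comm _ (2 : Smooth U),
    ← Finset.mul_sum, h2] at h
  rw [sym2_comm S c i, sym2_comm S c j, sym2_comm S j i] at h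
  rw [sym2_comm S c i]
  exact eq_zero_of_two_mul (by linear_combination -h)

/-! ### Killing tensors are quadratic -/

/-- The partial derivative of the extension of a function to the cone, homogeneous of degree `c`,
restricted to the sphere. -/
def gradE (c : ℂ) (i : Fin 4) (f : Smooth U) : Smooth U := E i f + c • (coord i * f)

theorem gradE_add (c : ℂ) (i : Fin 4) (f g : Smooth U) :
    gradE c i (f + g) = gradE c i f + gradE c i g := by
  simp only [gradE, map_add, mul_add, smul_add]; abel

theorem gradE_zero (c : ℂ) (i : Fin 4) : gradE c i (0 : Smooth U) = 0 := by
  simp only [gradE, map_zero, mul_zero, smul_zero, add_zero]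

/-- Ambient partial derivatives commute. A derivative lowers the degree by one, whence d = c + 1. -/
theorem gradE_comm {c d : ℂ} (h : d = c + 1) (i j : Fin 4) (f : Smooth U) :
    gradE c i (gradE d j f) = gradE c j (gradE d i f) := by
  subst h
  simp only [gradE, map_add, map_smul, E_mul]
  simp only [Algebra.smul_def, map_add, map_one]
  linear_combination E_comm i j f + (algebraMap ℂ (Smooth U) c + 1) * f * E_coord_symm i j

/-- Euler's identity for a function of degree c. -/
theorem sum_coord_mul_gradE (c : ℂ) (f : Smooth U) : ∑ i, coord i * gradE c i f = c • f := by
  have h : ∀ i, coord i * gradE c i f = coord i * E i f + c • (coord i ^ 2 * f) := fun i => by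
    simp only [gradE, Algebra.smul_def]; ring
  simp only [h, Finset.sum_add_distrib, sum_coord_mul_E, ← Finset.smul_sum, ← Finset.sum_mul,
    sum_coord_sq, one_mul, zero_add]

theorem isPreconnected_cone (hU : IsPreconnected (U : Set S3)) : IsPreconnected (cone U) := by
  have h : cone U = (fun z : ℝ × E4 => z.1 • z.2) '' (Set.Ioi 0 ×ˢ (Subtype.val '' (U : Set S3))) := by
    ext x
    constructor
    · intro hx
      refine ⟨(‖x‖, (conePoint hx : E4)), ⟨norm_pos_iff.2 (ne_zero_of_mem_cone hx), ?_⟩,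
        norm_smul_conePoint hx⟩
      exact ⟨_, (conePoint hx).2, rfl⟩
    · rintro ⟨⟨c, y⟩, ⟨hc, p, hp, rfl⟩, rfl⟩
      exact smul_mem_cone (coe_mem_cone ⟨p, hp⟩) hc
  rw [h]
  refine (isPreconnected_Ioi.prod (hU.image _ continuous_subtype_val.continuousOn)).image _ ?_
  exact (continuous_fst.smul continuous_snd).continuousOn

theorem exists_eq_smul_one (hU : IsPreconnected (U : Set S3)) {f : Smooth U}
    (h : ∀ i, E i f = 0) : ∃ c : ℂ, f = c • 1 := by
  have hd : Set.EqOn (fderiv ℝ (radialExt f.1)) 0 (cone U) := by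
    intro x hx
    have hx0 : (‖x‖ : ℂ) ≠ 0 := by simpa using ne_zero_of_mem_cone hx
    have h1 : ∀ i, fderiv ℝ (radialExt f.1) x (ev i) = 0 := fun i => by
      have h2 := radialExt_E i f hx
      rw [h i, radialExt_eq_conePoint _ hx] at h2
      exact (mul_eq_zero.1 h2.symm).resolve_left hx0
    ext v
    rw [eq_sum_ev v, map_sum]
    simp [h1]
  obtain ⟨c, hc⟩ := (isOpen_cone U).exists_is_const_of_fderiv_eq_zero (isPreconnected_cone hU)
    (fun x hx => (differentiableAt_radialExt' f hx).differentiableWithinAt) hd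
  refine ⟨c, ?_⟩
  apply Subtype.ext; funext p
  have h1 := hc p (coe_mem_cone p)
  rw [radialExt_coe] at h1
  change f.1 p = c * 1
  rw [h1, mul_one]

/-- Applied to the third derivatives ∂_a ∂_b ∂_c k_ij of a Killing tensor. Symmetry in (i, j) and in
(a, b, c) together with the cyclic identity leaves ten linear relations among ten unknowns, and only
the zero solution. -/
theorem eq_zero_of_symm_of_cyclic {ι : Type*} {W : ι → ι → ι → ι → ι → ℂ}
    (h1 : ∀ i j a b c, W i j a b c = W j i a b c) (h2 : ∀ i j a b c, W i j a b c = W i j b a c)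
    (h3 : ∀ i j a b c, W i j a b c = W i j a c b)
    (h : ∀ i j a b c, W i j a b c + W j a i b c + W a i j b c = 0) (i j a b c : ι) :
    W i j a b c = 0 := by
  have e1 := h i j a b c
  have e2 := h i j b a c
  have e3 := h i j c a b
  have e4 := h i a b j c
  have e5 := h i a c j b
  have e6 := h i b c j a
  have e7 := h j a b i c
  have e8 := h j a c i b
  have e9 := h j b c i a
  have e10 := h a b c i j
  simp only [h1, h2, h3] at *
  linear_combination (1 / 3 : ℂ) * (e1 + e2 + e3) - (1 / 6 : ℂ) * (e4 + e5 + e6 + e7 + e8 + e9) +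
    (1 / 3 : ℂ) * e10

/-- The algebraic symmetries of the coefficients of a quadratic Killing tensor. -/
structure IsKilling (T : Fin 4 → Fin 4 → Fin 4 → Fin 4 → ℂ) : Prop where
  symm_left : ∀ i j a b, T i j a b = T j i a b
  symm_right : ∀ i j a b, T i j a b = T i j b a
  cyclic : ∀ i j a b, T i j a b + T j a i b + T a i j b = 0

/-- Pair symmetry follows from the cyclic identity, as for curvature tensors. -/
theorem IsKilling.pair {T : Fin 4 → Fin 4 → Fin 4 → Fin 4 → ℂ} (h : IsKilling T)
    (i j a b : Fin 4) : T i j a b = T a b i j := by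
  linear_combination (1 / 2 : ℂ) * (h.cyclic i j a b + h.cyclic i j b a - h.cyclic a b i j -
    h.cyclic a b j i + h.symm_right i j a b - h.symm_right a b i j - h.symm_left a i j b -
    h.symm_left b i j a + h.symm_left b j a i + h.symm_right b i a j + h.symm_right i a b j +
    h.symm_right j a b i + h.symm_left b i j a + h.symm_right j b a i)

/-- Extended to the cone with degree 2, the components satisfy the flat Killing equation. Their
third derivatives vanish, so the second derivatives are constants on a connected set. Euler's
identity in degrees 1 and 2 recovers k_ij from them, with the factor 1/(1·2). -/
theorem exists_isKilling (hU : IsConnected (U : Set S3)) {k : Fin 4 → Fin 4 → Smooth U}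
    (hs : ∀ i j, k i j = k j i) (hk : ∀ i j c, E c (k i j) + E i (k j c) + E j (k c i) +
      2 * (coord c * k i j + coord i * k j c + coord j * k c i) = 0) :
    ∃ T, IsKilling T ∧ (∀ i j a b, gradE 1 b (gradE 2 a (k i j)) = T i j a b • 1) ∧
      ∀ i j, k i j = (1 / 2 : ℂ) • ∑ a, ∑ b, T i j a b • (coord a * coord b) := by
  have hg : ∀ i j c, gradE 2 c (k i j) + gradE 2 i (k j c) + gradE 2 j (k c i) = 0 :=
    fun i j c => by
      rw [← hk i j c]
      simp only [gradE, Algebra.smul_def, map_ofNat]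
      ring
  set F : Fin 4 → Fin 4 → Fin 4 → Fin 4 → Smooth U := fun i j a b => gradE 1 b (gradE 2 a (k i j))
    with hF
  have F1 : ∀ i j a b, F i j a b = F j i a b := fun i j a b => by simp only [hF, hs i j]
  have F2 : ∀ i j a b, F i j a b = F i j b a := fun i j a b => gradE_comm (by norm_num) _ _ _
  have F3 : ∀ i j a b, F i j a b + F j a i b + F a i j b = 0 := fun i j a b => by
    simp only [hF, ← gradE_add, hg, gradE_zero]
  have hE : ∀ i j a b c, E c (F i j a b) = 0 := fun i j a b c => by
    have G : ∀ i j a b c, E c (F i j a b) = E b (F i j a c) := fun i j a b c => by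
      have h := gradE_comm (c := 0) (d := 1) (by norm_num) c b (gradE 2 a (k i j))
      simpa only [gradE, zero_smul, add_zero, hF] using h
    apply Subtype.ext; funext p
    refine eq_zero_of_symm_of_cyclic (W := fun i j a b c => (E c (F i j a b)).1 p)
      (fun i j a b c => ?_) (fun i j a b c => ?_) (fun i j a b c => ?_) (fun i j a b c => ?_)
      i j a b c
    · simp only [F1 i j]
    · simp only [F2 i j a b]
    · simp only [G i j a b c]
    · have h := congrArg (fun f => (E c f).1 p) (F3 i j a b)
      simp only [map_add, map_zero] at h
      exact h
  choose T hT using fun i j a b => exists_eq_smul_one hU.isPreconnected (hE i j a b)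
  obtain ⟨p, hp⟩ := hU.nonempty
  have hTp : ∀ i j a b, T i j a b = (F i j a b).1 ⟨p, hp⟩ := fun i j a b => by
    rw [hT]; exact (mul_one _).symm
  refine ⟨T, ⟨fun i j a b => ?_, fun i j a b => ?_, fun i j a b => ?_⟩, hT, fun i j => ?_⟩
  · rw [hTp, F1, ← hTp]
  · rw [hTp, F2, ← hTp]
  · simp only [hTp]
    exact congrArg (fun f : Smooth U => f.1 ⟨p, hp⟩) (F3 i j a b)
  · have e : ∀ a b, T i j a b • (coord a * coord b : Smooth U) = coord a * (coord b * F i j a b) :=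
      fun a b => by rw [hT i j a b, Algebra.mul_smul_comm, mul_one, Algebra.mul_smul_comm]
    simp only [e, ← Finset.mul_sum, hF, sum_coord_mul_gradE, one_smul, smul_smul]
    norm_num

/-! ### The general form of a symmetry -/

/-- The second order operator with a given quadratic Killing tensor. -/
def killingOp2 (T : Fin 4 → Fin 4 → Fin 4 → Fin 4 → ℂ) : Op U :=
  (1 / 12 : ℂ) • ∑ i, ∑ j, ∑ a, ∑ b, T i j a b • (J a i * J b j : Op U)

/-- The first order operator with a given Killing vector. -/
def killingOp1 (A : Fin 4 → Fin 4 → ℂ) : Op U :=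
  (1 / 2 : ℂ) • ∑ a, ∑ j, A a j • (J a j : Op U)

theorem killingOp2_mem (T : Fin 4 → Fin 4 → Fin 4 → Fin 4 → ℂ) :
    (killingOp2 T : Op U) ∈ diffOp U 2 :=
  Submodule.smul_mem _ _ (sum_mem_diffOp _ fun _ _ => sum_mem_diffOp _ fun _ _ =>
    sum_mem_diffOp _ fun _ _ => sum_mem_diffOp _ fun _ _ => Submodule.smul_mem _ _ (JJ_mem _ _ _ _))

theorem killingOp1_mem (A : Fin 4 → Fin 4 → ℂ) : (killingOp1 A : Op U) ∈ diffOp U 1 :=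
  Submodule.smul_mem _ _ (sum_mem_diffOp _ fun _ _ => sum_mem_diffOp _ fun _ _ =>
    Submodule.smul_mem _ _ (J_mem _ _))

theorem op_commute_sum {ι : Type*} (s : Finset ι) {A : ι → Op U} {B : Op U}
    (h : ∀ i ∈ s, Commute (A i) B) : Commute (∑ i ∈ s, A i) B := Commute.sum_left s A B h

theorem op_commute_smul {A B : Op U} (h : Commute A B) (c : ℂ) : Commute (c • A) B := h.smul_left c

theorem killingOp2_commute (T : Fin 4 → Fin 4 → Fin 4 → Fin 4 → ℂ) :
    Commute (killingOp2 T : Op U) laplaceBeltrami :=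
  op_commute_smul (op_commute_sum _ fun _ _ => op_commute_sum _ fun _ _ => op_commute_sum _
    fun _ _ => op_commute_sum _ fun _ _ => op_commute_smul ((J_commute_laplaceBeltrami
      (U := U) _ _).mul_left (J_commute_laplaceBeltrami (U := U) _ _)) _) _

theorem killingOp1_commute (A : Fin 4 → Fin 4 → ℂ) :
    Commute (killingOp1 A : Op U) laplaceBeltrami :=
  op_commute_smul (op_commute_sum _ fun _ _ => op_commute_sum _ fun _ _ =>
    op_commute_smul (J_commute_laplaceBeltrami (U := U) _ _) _) _

theorem sym2_sum {ι : Type*} (s : Finset ι) (A : ι → Op U) (i j : Fin 4) :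
    sym2 (∑ m ∈ s, A m) i j = ∑ m ∈ s, sym2 (A m) i j := by
  classical
  induction s using Finset.induction_on with
  | empty =>
    simp only [Finset.sum_empty]
    rw [sym2, ad_of_mem_zero _ (ad_mem _ (zero_mem _))]; rfl
  | insert m s hm ih => rw [Finset.sum_insert hm, Finset.sum_insert hm, sym2_add, ih]

theorem sym1_sum {ι : Type*} (s : Finset ι) (A : ι → Op U) (i : Fin 4) :
    sym1 (∑ m ∈ s, A m) i = ∑ m ∈ s, sym1 (A m) i := by
  classical
  induction s using Finset.induction_on with
  | empty =>
    simp only [Finset.sum_empty]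
    rw [sym1, ad_of_mem_zero _ (zero_mem _)]; rfl
  | insert m s hm ih => rw [Finset.sum_insert hm, Finset.sum_insert hm, sym1_add, ih]

theorem sym2_J_mul_J (a i b j k l : Fin 4) : sym2 (J a i * J b j : Op U) k l =
    J a i (coord k) * J b j (coord l) + J a i (coord l) * J b j (coord k) := by
  rw [sym2, ad_mul, ad_add, ad_mul, ad_mul]
  simp only [ad_J, ad_mulOp, zero_mul, mul_zero, zero_add, add_zero, LinearMap.add_apply,
    Module.End.mul_apply, mulOp_apply, mul_one]
  ring

/-- The product expands into four contractions. The first and last equal S = ∑ T_klab s_a s_b, and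
each mixed one equals -S/2 by the cyclic identity, so the total is 3S. Symmetrization over k and l
gives 6S, which explains the normalization 1/12 of `killingOp2`. -/
theorem two_mul_contraction {C : Type*} [CommRing C] {T : Fin 4 → Fin 4 → Fin 4 → Fin 4 → C}
    (hl : ∀ i j a b, T i j a b = T j i a b) (hr : ∀ i j a b, T i j a b = T i j b a)
    (hp : ∀ i j a b, T i j a b = T a b i j)
    (hc : ∀ i j a b, T i j a b + T j a i b + T a i j b = 0) (s : Fin 4 → C) (k l : Fin 4) :
    2 * ∑ i, ∑ j, ∑ a, ∑ b, T i j a b *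
      (((if i = k then s a else 0) - (if a = k then s i else 0)) *
      ((if j = l then s b else 0) - (if b = l then s j else 0))) =
    6 * ∑ a, ∑ b, T k l a b * (s a * s b) := by
  have h1 : ∑ i, ∑ j, ∑ a, ∑ b, T i j a b *
      (((if i = k then s a else 0) - (if a = k then s i else 0)) *
      ((if j = l then s b else 0) - (if b = l then s j else 0))) =
      ∑ a, ∑ b, T k l a b * (s a * s b) - ∑ j, ∑ a, T k j a l * (s a * s j) -
      ∑ i, ∑ b, T i l k b * (s i * s b) + ∑ i, ∑ j, T i j k l * (s i * s j) := by
    have e : ∀ i j a b, T i j a b * (((if i = k then s a else 0) - (if a = k then s i else 0)) *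
        ((if j = l then s b else 0) - (if b = l then s j else 0))) =
        (if i = k then if j = l then T i j a b * (s a * s b) else 0 else 0) -
        (if i = k then if b = l then T i j a b * (s a * s j) else 0 else 0) -
        (if a = k then if j = l then T i j a b * (s i * s b) else 0 else 0) +
        (if a = k then if b = l then T i j a b * (s i * s j) else 0 else 0) := fun i j a b => by
      split_ifs <;> ring
    simp only [e, Finset.sum_add_distrib, Finset.sum_sub_distrib, Finset.sum_ite_irrel,
      Finset.sum_const_zero, Finset.sum_ite_eq', Finset.mem_univ, if_true]
  have h2 : ∀ k l, 2 * ∑ j, ∑ a, T k j a l * (s a * s j) =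
      -∑ a, ∑ b, T k l a b * (s a * s b) := fun k l => by
    have e : ∀ a j, T k j a l * (s a * s j) + T k a j l * (s j * s a) +
        T k l a j * (s a * s j) = 0 := fun a j => by
      rw [hp k l a j]
      linear_combination (s a * s j) * (hc k j a l + hl k a j l + hl a j k l)
    have e2 := Finset.sum_congr (s₁ := Finset.univ) rfl fun j _ =>
      Finset.sum_congr (s₁ := Finset.univ) rfl fun a _ => e a j
    simp only [Finset.sum_add_distrib, Finset.sum_const_zero] at e2
    rw [Finset.sum_comm (f := fun j a => T k a j l * (s j * s a)),
      Finset.sum_comm (f := fun j a => T k l a j * (s a * s j))] at e2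
    linear_combination e2
  have h3 : ∑ i, ∑ b, T i l k b * (s i * s b) = ∑ j, ∑ a, T l j a k * (s a * s j) := by
    refine Finset.sum_congr rfl fun j _ => Finset.sum_congr rfl fun a _ => ?_
    rw [hl, hr l j k a]; ring
  have h4 : ∑ i, ∑ j, T i j k l * (s i * s j) = ∑ a, ∑ b, T k l a b * (s a * s b) :=
    Finset.sum_congr rfl fun i _ => Finset.sum_congr rfl fun j _ => by rw [hp]
  have h5 : ∑ a, ∑ b, T l k a b * (s a * s b) = ∑ a, ∑ b, T k l a b * (s a * s b) :=
    Finset.sum_congr rfl fun i _ => Finset.sum_congr rfl fun j _ => by rw [hl]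
  rw [h1, h3, h4]
  linear_combination -h2 k l - h2 l k + h5

theorem sym2_killingOp2 {T : Fin 4 → Fin 4 → Fin 4 → Fin 4 → ℂ} (hT : IsKilling T)
    (k l : Fin 4) : sym2 (killingOp2 T : Op U) k l =
      (1 / 2 : ℂ) • ∑ a, ∑ b, T k l a b • (coord a * coord b) := by
  have h := two_mul_contraction (T := fun i j a b => algebraMap ℂ (Smooth U) (T i j a b))
    (fun i j a b => congrArg _ (hT.symm_left i j a b))
    (fun i j a b => congrArg _ (hT.symm_right i j a b)) (fun i j a b => congrArg _ (hT.pair i j a b))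
    (fun i j a b => by rw [← map_add, ← map_add, hT.cyclic, map_zero]) coord
  have h1 := h k l
  have h2 := h l k
  simp only [hT.symm_left l k] at h2
  simp only [killingOp2, sym2_smul, sym2_sum, sym2_J_mul_J, J_coord, mul_ite, mul_one, mul_zero,
    smul_add, Finset.sum_add_distrib]
  simp only [Algebra.smul_def]
  have hc' : (6 : Smooth U) * algebraMap ℂ (Smooth U) (1 / 12) = algebraMap ℂ (Smooth U) (1 / 2) := by
    rw [← map_ofNat (algebraMap ℂ (Smooth U)) 6, ← map_mul]; norm_num
  refine sub_eq_zero.1 (eq_zero_of_two_mul ?_)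
  set X : Smooth U := ∑ a, ∑ b, algebraMap ℂ (Smooth U) (T k l a b) * (coord a * coord b)
  linear_combination algebraMap ℂ (Smooth U) (1 / 12) * (h1 + h2) + 2 * X * hc'

theorem sym1_killingOp1 {A : Fin 4 → Fin 4 → ℂ} (hA : ∀ i j, A i j = -A j i) (k : Fin 4) :
    sym1 (killingOp1 A : Op U) k = ∑ a, A a k • coord a := by
  have e : ∀ a j, sym1 (A a j • (J a j : Op U)) k =
      (if j = k then A a j • coord a else 0) - (if a = k then A a j • coord j else 0) := fun a j => by
    rw [sym1_smul, sym1, ad_J, mulOp_apply, mul_one, J_coord]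
    split_ifs <;> simp only [mul_one, mul_zero, smul_sub, smul_zero]
  simp only [killingOp1, sym1_smul, sym1_sum, e, Finset.sum_sub_distrib, Finset.sum_ite_irrel,
      Finset.sum_const_zero, Finset.sum_ite_eq', Finset.mem_univ, if_true]
  simp only [hA k, neg_smul, Finset.sum_neg_distrib, sub_neg_eq_add, ← two_smul ℂ, smul_smul]
  norm_num

/-- With l_j of degree 1, ∂_c ∂_i l_j is symmetric in c, i and antisymmetric in i, j, hence zero.
The first derivatives are then constants, and Euler's identity gives l_j. -/
theorem exists_killing_vector (hU : IsConnected (U : Set S3)) {l : Fin 4 → Smooth U}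
    (hl : ∀ i j, E i (l j) + coord i * l j + (E j (l i) + coord j * l i) = 0) :
    ∃ A : Fin 4 → Fin 4 → ℂ, (∀ i j, A i j = -A j i) ∧ ∀ j, l j = ∑ a, A a j • coord a := by
  have h1 : ∀ i j, gradE 1 i (l j) = (-1 : ℂ) • gradE 1 j (l i) := fun i j => by
    have h := hl i j
    simp only [gradE, one_smul, neg_smul]
    linear_combination h
  have h2 : ∀ c i j, E c (gradE 1 i (l j)) = E i (gradE 1 c (l j)) := fun c i j => by
    have h := gradE_comm (c := 0) (d := 1) (by norm_num) c i (l j)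
    simpa only [gradE, zero_smul, add_zero] using h
  have h3 : ∀ i j c, E c (gradE 1 i (l j)) = 0 := fun i j c => by
    have e1 : E c (gradE 1 i (l j)) = (-1 : ℂ) • E c (gradE 1 i (l j)) := by
      conv_lhs => rw [h2, h1, map_smul, h2, h1, map_smul, h2, h1 j, map_smul, smul_smul, smul_smul]
      norm_num
    refine eq_zero_of_two_mul ?_
    rw [neg_one_smul] at e1
    linear_combination e1
  choose A hA using fun i j => exists_eq_smul_one hU.isPreconnected (h3 i j)
  obtain ⟨p, hp⟩ := hU.nonempty
  have hAp : ∀ i j, A i j = (gradE 1 i (l j)).1 ⟨p, hp⟩ := fun i j => by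
    rw [hA]; exact (mul_one _).symm
  refine ⟨A, fun i j => ?_, fun j => ?_⟩
  · rw [hAp, hAp, h1]
    exact neg_one_mul _
  · have e : ∀ a, A a j • (coord a : Smooth U) = coord a * gradE 1 a (l j) := fun a => by
      rw [hA a j, Algebra.mul_smul_comm, mul_one]
    simp only [e, sum_coord_mul_gradE, one_smul]

/-- A symmetry of `Δ_S + V` of order at most two is the sum of the operators of a quadratic
Killing tensor and of a Killing vector and of a function. -/
theorem exists_symmetry_form (hU : IsConnected (U : Set S3)) {V : Smooth U} {S : Op U}
    (hS : S ∈ diffOp U 2) (hc : Commute S (laplaceBeltrami + mulOp V)) :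
    ∃ T A g, IsKilling T ∧ (∀ i j, A i j = -A j i) ∧
      (∀ i j a b, gradE 1 b (gradE 2 a (sym2 S i j)) = T i j a b • 1) ∧
      S = killingOp2 T + killingOp1 A + mulOp g := by
  obtain ⟨T, hT, hTk, hk⟩ := exists_isKilling hU (sym2_comm S) (killing_two hS hc)
  have h1 : S - killingOp2 T ∈ diffOp U 1 := by
    have e1 := sub_sum_sym2_mem hS
    have e2 := sub_sum_sym2_mem (killingOp2_mem (U := U) T)
    have e3 := op_sub_mem e1 e2
    simp only [sym2_killingOp2 hT, ← hk] at e3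
    convert e3 using 1
    apply LinearMap.ext; intro h
    simp only [LinearMap.sub_apply]
    abel
  obtain ⟨S', hS'⟩ : ∃ S', S' = S - killingOp2 T := ⟨_, rfl⟩
  rw [← hS'] at h1
  have hS2 : S = S' + killingOp2 T := by
    rw [hS']; apply LinearMap.ext; intro h
    simp only [LinearMap.sub_apply, LinearMap.add_apply]; abel
  -- The quadratic part commutes with Δ, so the remainder S' fails to commute with H only by
  -- -[killingOp2 T, V], an operator of order one.
  have h2 := killing_one (V := V) h1 (B := (-1 : ℂ) • ad V (killingOp2 T))
    (Submodule.smul_mem _ _ (ad_mem V (killingOp2_mem T))) (by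
      have e1 := hc.eq
      have e2 := (killingOp2_commute (U := U) T).eq
      rw [hS2] at e1
      apply LinearMap.ext; intro h
      have e3 := LinearMap.congr_fun e1 h
      have e4 := LinearMap.congr_fun e2 h
      simp only [LinearMap.add_apply, LinearMap.smul_apply, Module.End.mul_apply,
        mulOp_apply, ad_apply, neg_one_smul, mul_add] at e3 e4 ⊢
      linear_combination e3 - e4)
  obtain ⟨A, hA, hl⟩ := exists_killing_vector hU h2
  refine ⟨T, A, (S' - killingOp1 A : Op U) 1, hT, hA, hTk, ?_⟩
  have h3 : S' - killingOp1 A = mulOp ((S' - killingOp1 A : Op U) 1) := by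
    have h4 := eq_of_mem_diffOp_one (op_sub_mem h1 (killingOp1_mem (U := U) A))
    have h5 : ∀ i, sym1 (S' - killingOp1 A) i = 0 := fun i => by
      rw [op_sub_eq, sym1_add, sym1_smul, sym1_killingOp1 hA, hl, neg_one_smul, add_neg_cancel]
    simp only [h5, map_zero, zero_mul, Finset.sum_const_zero, add_zero] at h4
    exact h4
  rw [← h3, hS2]
  apply LinearMap.ext; intro h
  simp only [LinearMap.sub_apply, LinearMap.add_apply]
  abel

/-- The Bertrand-Darboux equation: the first order part of [killingOp2 T, V] = [Δ, g] up to a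
function. The Killing vector contributes only the function [killingOp1 A, V], which a further
commutator with s_i removes. -/
theorem two_mul_E_of_commute {V g : Smooth U} {T : Fin 4 → Fin 4 → Fin 4 → Fin 4 → ℂ}
    {A : Fin 4 → Fin 4 → ℂ} (hT : IsKilling T)
    (hc : Commute (killingOp2 T + killingOp1 A + mulOp g) (laplaceBeltrami + mulOp V))
    (i : Fin 4) :
    2 * E i g = ∑ a, (1 / 2 : ℂ) • (∑ c, ∑ d, T i a c d • (coord c * coord d)) * E a V := by
  have e1 := (killingOp1_commute (U := U) A).eq
  have e2 := (killingOp2_commute (U := U) T).eq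
  have h : ad V (killingOp2 T) + ad V (killingOp1 A) = ad g (laplaceBeltrami + mulOp V : Op U) := by
    have e3 := hc.eq
    apply LinearMap.ext; intro h
    have e3 := LinearMap.congr_fun e3 h
    have e4 := LinearMap.congr_fun e1 h
    have e5 := LinearMap.congr_fun e2 h
    simp only [LinearMap.add_apply, Module.End.mul_apply,
        mulOp_apply, ad_apply, mul_add] at e3 e4 e5 ⊢
    linear_combination e3 - e4 - e5
  have h1 := congrArg (fun B => ad (coord i) B 1) h
  simp only [ad_add (U := U) _ (ad _ _)] at h1
  rw [ad_of_mem_zero _ (ad_mem V (killingOp1_mem (U := U) A)), add_zero, ad_comm,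
    ad_eq_of_mem_one V (ad_mem _ (killingOp2_mem T)), ad_comm, mulOp_apply, mul_one] at h1
  have h2 : ∀ a, sym1 (ad (coord i) (killingOp2 T : Op U)) a =
      (1 / 2 : ℂ) • (∑ c, ∑ d, T i a c d • (coord c * coord d)) := fun a => by
    rw [← sym2_killingOp2 hT, sym2_comm]; rfl
  simp only [h2] at h1
  rw [h1, ad_apply, ad_H_apply, ad_H_apply, E_mul, mul_one]
  have h0 : E i (1 : Smooth U) = 0 := (derE i).map_one_eq_zero
  rw [h0]
  ring

/-- Apply the commutation relation to the constant function 1. -/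
theorem killingOp1_apply_of_commute {V g : Smooth U} {c : ℂ} {A : Fin 4 → Fin 4 → ℂ}
    (hg : g = c • 1) (hc : Commute (killingOp1 A + mulOp g) (laplaceBeltrami + mulOp V)) :
    (killingOp1 A : Op U) V = 0 := by
  have h0 : ∀ j k, J j k (1 : Smooth U) = 0 := fun j k => by
    have h : ∀ i, E i (1 : Smooth U) = 0 := fun i => (derE i).map_one_eq_zero
    rw [J_eq, h, h, mul_zero, mul_zero, sub_zero]
  have h1 : (killingOp1 A : Op U) 1 = 0 := by
    simp only [killingOp1, LinearMap.smul_apply, LinearMap.sum_apply, h0, smul_zero,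
      Finset.sum_const_zero]
  have h2 : (laplaceBeltrami : Op U) 1 = 0 := by
    simp only [laplaceBeltrami, pow_two, LinearMap.add_apply, Module.End.mul_apply, h0, map_zero,
      add_zero]
  have e := LinearMap.congr_fun hc.eq 1
  simp only [LinearMap.add_apply, Module.End.mul_apply, mulOp_apply, h1, h2, mul_one,
    zero_add] at e
  have h3 : (laplaceBeltrami : Op U) g = 0 := by rw [hg, map_smul, h2, smul_zero]
  linear_combination e + h3

/-! ### The integrability conditions -/

/-- The components of the quadratic Killing tensor with coefficients `T`, restricted to the
sphere. -/
def quad (T : Fin 4 → Fin 4 → Fin 4 → Fin 4 → ℂ) (i j : Fin 4) : Smooth U :=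
  (1 / 2 : ℂ) • ∑ a, ∑ b, T i j a b • (coord a * coord b)

/-- The derivatives of the components of the quadratic Killing tensor with coefficients `T`. -/
def dquad (T : Fin 4 → Fin 4 → Fin 4 → Fin 4 → ℂ) (i j c : Fin 4) : Smooth U :=
  ∑ b, T i j c b • coord b

section
variable {T : Fin 4 → Fin 4 → Fin 4 → Fin 4 → ℂ}

theorem E_quad (hT : IsKilling T) (i j c : Fin 4) :
    E c (quad T i j : Smooth U) = dquad T i j c - 2 * coord c * quad T i j := by
  have e : ∀ a b, E c (T i j a b • (coord a * coord b) : Smooth U) =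
      (if c = b then T i j a b • coord a else 0) + (if c = a then T i j a b • coord b else 0) -
        2 * coord c * T i j a b • (coord a * coord b) := fun a b => by
    rw [map_smul, E_mul, E_coord, E_coord]
    split_ifs <;> simp only [Algebra.smul_def] <;> ring
  have h1 : ∑ a, T i j a c • (coord a : Smooth U) = dquad T i j c :=
    Finset.sum_congr rfl fun a _ => by rw [hT.symm_right]
  simp only [quad, map_smul, map_sum, e, Finset.sum_sub_distrib, Finset.sum_add_distrib,
    Finset.sum_ite_irrel, Finset.sum_const_zero, Finset.sum_ite_eq, Finset.mem_univ, if_true, h1,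
    ← Finset.mul_sum]
  have h2 : ∑ b, T i j c b • (coord b : Smooth U) = dquad T i j c := rfl
  rw [h2, ← two_smul ℂ (dquad T i j c), smul_sub, smul_smul, Algebra.mul_smul_comm]
  norm_num

theorem sum_quad_mul_coord (hT : IsKilling T) (i : Fin 4) :
    ∑ a, quad T i a * (coord a : Smooth U) = 0 := by
  rw [← sum_sym1_mul_coord (ad_mem (coord i) (killingOp2_mem (U := U) T))]
  refine Finset.sum_congr rfl fun a _ => ?_
  rw [quad, ← sym2_killingOp2 hT, sym2_comm]; rfl

theorem E_inv_cube_mul (hT : IsKilling T) {c : ℂ} {t : Smooth U} {m : Fin 4}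
    (ht : c = 0 ∨ coord m * t = 1) (i j : Fin 4) :
    E i (c • (t ^ 3 * quad T j m)) = coord i * c • (t ^ 3 * quad T j m) +
      c • (t ^ 3 * dquad T j m i) - if i = m then (3 * c) • (t ^ 4 * quad T j m) else 0 := by
  rcases ht with rfl | ht
  · simp
  · have h1 : E i (t ^ 3 * quad T j m) = 3 * t ^ 2 * E i t * quad T j m +
        t ^ 3 * E i (quad T j m) := by
      simp only [pow_succ, pow_zero, one_mul, E_mul]; ring
    rw [map_smul, h1, E_of_mul_eq_one i ht, E_coord, E_quad hT]
    split_ifs <;> simp only [Algebra.smul_def, map_mul, map_ofNat] <;>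
    linear_combination (3 * algebraMap ℂ (Smooth U) c * coord i * t ^ 3 * quad T j m) * ht

theorem E_rinv_cube_mul (hU : U ≤ region2) (hT : IsKilling T) (i j : Fin 4) :
    E i (rinv hU ^ 3 * quad T j 3) = coord i * (rinv hU ^ 3 * quad T j 3) +
      rinv hU ^ 3 * dquad T j 3 i -
      3 * rinv hU ^ 5 * (coord i - if i = 3 then coord 3 else 0) * quad T j 3 := by
  have h1 : E i (rinv hU ^ 3 * quad T j 3) = 3 * rinv hU ^ 2 * E i (rinv hU) * quad T j 3 +
      rinv hU ^ 3 * E i (quad T j 3) := by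
    simp only [pow_succ, pow_zero, one_mul, E_mul]; ring
  have h2 := rinv_sq hU
  rw [h1, E_rinv, E_coord, E_quad hT]
  split_ifs with h
  · subst h
    linear_combination (3 * coord 3 * rinv hU ^ 3 * quad T j 3) * h2
  · linear_combination (3 * coord i * rinv hU ^ 3 * quad T j 3) * h2

/-- The potential `β s₄ / ρ + ∑ α_m / s_m² + γ`. -/
def pot (hU : U ≤ region2) (t : Fin 4 → Smooth U) (β γ : ℂ) (α : Fin 4 → ℂ) : Smooth U :=
  β • (coord 3 * rinv hU) + ∑ m, α m • t m ^ 2 + γ • 1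

variable {hU : U ≤ region2} {t : Fin 4 → Smooth U} {β γ : ℂ} {α : Fin 4 → ℂ}

/-- The disjunction in `ht` covers both systems: where a parameter vanishes, no reciprocal is
required and `t m` is arbitrary. -/
theorem E_pot (ht : ∀ m, α m = 0 ∨ coord m * t m = 1) (i : Fin 4) :
    E i (pot hU t β γ α) = β • (rinv hU ^ 3 * E i (coord 3)) -
      ∑ m, (2 * α m) • (t m ^ 3 * E i (coord m)) := by
  have h1 : ∀ m, E i (α m • t m ^ 2) = -((2 * α m) • (t m ^ 3 * E i (coord m))) := fun m => by
    rcases ht m with h | h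
    · simp [h]
    · rw [map_smul, pow_two, E_mul, E_of_mul_eq_one i h]
      simp only [Algebra.smul_def, map_mul, map_ofNat]; ring
  have h2 : E i (coord 3 * rinv hU) = rinv hU ^ 3 * E i (coord 3) := by
    rw [E_mul, E_rinv]
    linear_combination (-rinv hU * E i (coord 3)) * rinv_sq hU
  have h3 : E i (1 : Smooth U) = 0 := (derE i).map_one_eq_zero
  simp only [pot, map_add, map_sum, map_smul, h3, smul_zero, add_zero, h1, Finset.sum_neg_distrib]
  rw [← map_smul, map_smul, h2, ← sub_eq_add_neg]

theorem sum_mul_E_pot (ht : ∀ m, α m = 0 ∨ coord m * t m = 1) (l : Fin 4 → Smooth U)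
    (hl : ∑ a, l a * coord a = 0) : ∑ a, l a * E a (pot hU t β γ α) =
      β • (rinv hU ^ 3 * l 3) - ∑ m, (2 * α m) • (t m ^ 3 * l m) := by
  have h := sum_mul_E_coord l hl
  have h1 : ∀ (c : ℂ) (f : Smooth U) m, ∑ a, l a * c • (f * E a (coord m)) =
      c • (f * l m) := fun c f m => by
    rw [← h m, Finset.mul_sum, Finset.smul_sum]
    refine Finset.sum_congr rfl fun a _ => ?_
    rw [Algebra.mul_smul_comm]; congr 1; ring
  simp only [E_pot ht, mul_sub, Finset.sum_sub_distrib, h1, Finset.mul_sum]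
  rw [Finset.sum_comm]
  simp only [h1]

/-- The derivative of the right hand side of the equation for the potential term of a symmetry. -/
def obstruction (hU : U ≤ region2) (t : Fin 4 → Smooth U) (β : ℂ) (α : Fin 4 → ℂ)
    (T : Fin 4 → Fin 4 → Fin 4 → Fin 4 → ℂ) (i j : Fin 4) : Smooth U :=
  β • (rinv hU ^ 3 * dquad T j 3 i -
      3 * rinv hU ^ 5 * (coord i - if i = 3 then coord 3 else 0) * quad T j 3) -
    (∑ m, (2 * α m) • (t m ^ 3 * dquad T j m i) - (6 * α i) • (t i ^ 4 * quad T j i))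

/-- By [E_i, E_j] = s_i E_j - s_j E_i the expression E_i E_j g - s_i E_j g is symmetric in i, j;
`obstruction` is twice this expression, computed from the right hand side. -/
theorem obstruction_symm (ht : ∀ m, α m = 0 ∨ coord m * t m = 1) (hT : IsKilling T) {g : Smooth U}
    (hg : ∀ i, 2 * E i g = ∑ a, quad T i a * E a (pot hU t β γ α)) (i j : Fin 4) :
    obstruction hU t β α T i j = obstruction hU t β α T j i := by
  have h1 : ∀ i j, E i (2 * E j g) = coord i * (2 * E j g) + obstruction hU t β α T i j :=
    fun i j => by
      have ht' : ∀ m, 2 * α m = 0 ∨ coord m * t m = 1 := fun m =>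
        (ht m).imp_left fun h => by rw [h, mul_zero]
      rw [hg, sum_mul_E_pot ht (fun a => quad T j a) (sum_quad_mul_coord hT j), map_sub, map_sum, map_smul, E_rinv_cube_mul hU hT]
      simp only [fun m => E_inv_cube_mul hT (ht' m) i j, Finset.sum_sub_distrib,
        Finset.sum_add_distrib, Finset.sum_ite_eq, Finset.mem_univ, if_true, ← Finset.mul_sum,
        obstruction, smul_sub, smul_add]
      simp only [← mul_assoc (3 : ℂ) 2]
      norm_num
      simp only [Algebra.smul_def]
      ring
  have h2 := h1 i j
  have h3 := h1 j i
  rw [E_two_mul] at h2 h3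
  linear_combination h3 - h2 + 2 * E_comm i j g

end

/-! ### Analytic continuation of the integrability conditions -/

/-- The function `√(x₁² + x₂² + x₃²)` on `ℝ⁴`. -/
def rad (x : E4) : ℝ := √(x 0 ^ 2 + x 1 ^ 2 + x 2 ^ 2)

theorem rad_smul {c : ℝ} (hc : 0 < c) (x : E4) : rad (c • x) = c * rad x := by
  have e : (c • x) 0 ^ 2 + (c • x) 1 ^ 2 + (c • x) 2 ^ 2 = c ^ 2 * (x 0 ^ 2 + x 1 ^ 2 + x 2 ^ 2) := by
    simp only [PiLp.smul_apply, smul_eq_mul]; ring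
  rw [rad, e, Real.sqrt_mul (sq_nonneg c), Real.sqrt_sq hc.le, rad]

/-- A homogeneous analytic relation between the coordinates and the radius which holds on `U`
holds on a half space. -/
theorem eq_zero_of_eq_zero_on {P : (Fin 4 → ℂ) → ℂ → ℂ} {n : ℕ}
    (hP : ContDiff ℝ ω fun z : (Fin 4 → ℂ) × ℂ => P z.1 z.2)
    (hh : ∀ c v R, P (fun i => c * v i) (c * R) = c ^ n * P v R)
    (h : ∀ p : U, P (fun i => ((p : E4) i : ℂ)) (rad p) = 0) (hU : U ≤ region2)
    (p : U) {x : E4} (hx : 0 < (p : E4) 0 * x 0 + (p : E4) 1 * x 1) : P (fun i => (x i : ℂ)) (rad x) = 0 := by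
  -- This half space is convex, contains p and avoids the plane x₁ = x₂ = 0, so the radius is
  -- analytic on it. Both coordinates of p being nonzero, it meets the hyperplanes x₁ = 0 and x₂ =
  -- 0.
  set W : Set E4 := {x | 0 < (p : E4) 0 * x 0 + (p : E4) 1 * x 1} with hW
  have hWo : IsOpen W := isOpen_lt continuous_const (by fun_prop)
  have hWc : IsPreconnected W := by
    refine Convex.isPreconnected ?_
    intro x hx y hy a b ha hb hab
    simp only [hW, Set.mem_ofPred_eq, PiLp.add_apply, PiLp.smul_apply, smul_eq_mul] at *
    rcases ha.lt_or_eq with ha | ha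
    · have h1 := mul_pos ha hx
      have h2 := mul_nonneg hb hy.le
      linarith
    · have hb1 : b = 1 := by linarith
      subst ha hb1
      linarith
  have hf : ContDiffOn ℝ ω (fun x : E4 => P (fun i => (x i : ℂ)) (rad x)) W := by
    intro x hx
    have hx0 : x 0 ^ 2 + x 1 ^ 2 + x 2 ^ 2 ≠ 0 := by
      intro h0
      have h1 : x 0 = 0 := by nlinarith [sq_nonneg (x 0), sq_nonneg (x 1), sq_nonneg (x 2)]
      have h2 : x 1 = 0 := by nlinarith [sq_nonneg (x 0), sq_nonneg (x 1), sq_nonneg (x 2)]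
      simp [hW, h1, h2] at hx
    have h0 : ContDiff ℝ ω (fun x : E4 => x 0 ^ 2 + x 1 ^ 2 + x 2 ^ 2) := by fun_prop
    have h1 : ContDiffAt ℝ ω (fun x : E4 => (rad x : ℂ)) x :=
      Complex.ofRealCLM.contDiff.contDiffAt.comp x (h0.contDiffAt.sqrt hx0)
    have h2 : ContDiff ℝ ω (fun x : E4 => fun i => (x i : ℂ)) :=
      contDiff_pi.2 fun i => Complex.ofRealCLM.contDiff.comp (by fun_prop)
    exact (hP.contDiffAt.comp x (h2.contDiffAt.prodMk h1)).contDiffWithinAt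
  have ha : AnalyticOnNhd ℝ (fun x : E4 => P (fun i => (x i : ℂ)) (rad x)) W :=
    (IsOpen.analyticOn_iff_analyticOnNhd hWo).1
      ((contDiffOn_omega_iff_analyticOn (IsOpen.uniqueDiffOn hWo)).1 hf)
  have hpW : (p : E4) ∈ W := by
    have h0 : (p : E4) 0 ≠ 0 := (hU p.2).1
    change 0 < (p : E4) 0 * (p : E4) 0 + (p : E4) 1 * (p : E4) 1
    exact add_pos_of_pos_of_nonneg (mul_self_pos.2 h0) (mul_self_nonneg _)
  refine ha.eqOn_zero_of_preconnected_of_eventuallyEq_zero hWc hpW ?_ hx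
  -- Homogeneity carries the vanishing on U to the open cone over U.
  filter_upwards [(isOpen_cone U).mem_nhds (coe_mem_cone p)] with y hy
  have hy0 : 0 < ‖y‖ := norm_pos_iff.2 (ne_zero_of_mem_cone hy)
  have h1 := hh (‖y‖ : ℂ) (fun i => ((conePoint hy : E4) i : ℂ)) (rad (conePoint hy))
  rw [h, mul_zero] at h1
  have e : y = ‖y‖ • (conePoint hy : E4) := (norm_smul_conePoint hy).symm
  have e1 : (fun i => (y i : ℂ)) = fun i => (‖y‖ : ℂ) * ((conePoint hy : E4) i : ℂ) := by
    funext i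
    conv_lhs => rw [e]
    simp
  have e2 : (rad y : ℂ) = (‖y‖ : ℂ) * (rad (conePoint hy) : ℂ) := by
    conv_lhs => rw [e, rad_smul hy0]
    simp
  change P (fun i => (y i : ℂ)) (rad y) = 0
  rw [e1, e2, h1]

section
variable {T : Fin 4 → Fin 4 → Fin 4 → Fin 4 → ℂ}

/-- The components of the quadratic Killing tensor with coefficients `T`. -/
def quadC (T : Fin 4 → Fin 4 → Fin 4 → Fin 4 → ℂ) (i j : Fin 4) (v : Fin 4 → ℂ) : ℂ :=
  1 / 2 * ∑ a, ∑ b, T i j a b * (v a * v b)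

/-- The derivatives of the components of the quadratic Killing tensor with coefficients `T`. -/
def dquadC (T : Fin 4 → Fin 4 → Fin 4 → Fin 4 → ℂ) (i j c : Fin 4) (v : Fin 4 → ℂ) : ℂ :=
  ∑ b, T i j c b * v b

/-- `v₁ v₂ v₃ / v_m` for `m ≤ 3`. -/
def cofac (m : Fin 4) (v : Fin 4 → ℂ) : ℂ := ![v 1 * v 2, v 0 * v 2, v 0 * v 1, 0] m

/-- The integrability condition, multiplied by `(v₁ v₂ v₃)⁴ R⁵`. -/
def obsC (β : ℂ) (α : Fin 4 → ℂ) (T : Fin 4 → Fin 4 → Fin 4 → Fin 4 → ℂ) (i j : Fin 4)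
    (v : Fin 4 → ℂ) (R : ℂ) : ℂ :=
  β * (v 0 * v 1 * v 2) ^ 4 * (R ^ 2 * dquadC T j 3 i v -
      3 * (v i - if i = 3 then v 3 else 0) * quadC T j 3 v) -
    R ^ 5 * (∑ m, 2 * α m * (cofac m v ^ 4 * v m) * dquadC T j m i v -
      6 * α i * cofac i v ^ 4 * quadC T j i v)

theorem quadC_smul (i j : Fin 4) (c : ℂ) (v : Fin 4 → ℂ) :
    quadC T i j (fun i => c * v i) = c ^ 2 * quadC T i j v := by
  simp only [quadC, Finset.mul_sum]
  exact Finset.sum_congr rfl fun a _ => Finset.sum_congr rfl fun b _ => by ring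

theorem dquadC_smul (i j k : Fin 4) (c : ℂ) (v : Fin 4 → ℂ) :
    dquadC T i j k (fun i => c * v i) = c * dquadC T i j k v := by
  simp only [dquadC, Finset.mul_sum]
  exact Finset.sum_congr rfl fun b _ => by ring

theorem cofac_smul (m : Fin 4) (c : ℂ) (v : Fin 4 → ℂ) :
    cofac m (fun i => c * v i) = c ^ 2 * cofac m v := by
  fin_cases m <;> simp [cofac] <;> ring

/-- Degree count: 12 + 3 in the Coulomb term, 5 + 9 + 1 and 5 + 8 + 2 in the polar terms. -/
theorem obsC_smul (β : ℂ) (α : Fin 4 → ℂ) (i j : Fin 4) (c : ℂ) (v : Fin 4 → ℂ) (R : ℂ) :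
    obsC β α T i j (fun i => c * v i) (c * R) = c ^ 15 * obsC β α T i j v R := by
  have e : ∀ m, 2 * α m * ((c ^ 2 * cofac m v) ^ 4 * (c * v m)) * (c * dquadC T j m i v) =
      c ^ 10 * (2 * α m * (cofac m v ^ 4 * v m) * dquadC T j m i v) := fun m => by ring
  simp only [obsC, quadC_smul, dquadC_smul, cofac_smul, e, ← Finset.mul_sum]
  split_ifs <;> ring

theorem contDiff_cofac (m : Fin 4) : ContDiff ℝ ω fun z : (Fin 4 → ℂ) × ℂ => cofac m z.1 := by
  fin_cases m <;> simp only [cofac] <;> simp <;> fun_prop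

theorem contDiff_obsC (β : ℂ) (α : Fin 4 → ℂ) (i j : Fin 4) :
    ContDiff ℝ ω fun z : (Fin 4 → ℂ) × ℂ => obsC β α T i j z.1 z.2 := by
  have h := fun m => contDiff_cofac m
  unfold obsC quadC dquadC
  split_ifs <;> fun_prop

theorem coord_prod_mul {α : Fin 4 → ℂ} {t : Fin 4 → Smooth U} (h3 : α 3 = 0)
    (ht : ∀ m, α m = 0 ∨ coord m * t m = 1) (m : Fin 4) (p : U) :
    α m = 0 ∨ ((p : E4) 0 : ℂ) * ((p : E4) 1 : ℂ) * ((p : E4) 2 : ℂ) * (t m).1 p =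
      cofac m (fun i => ((p : E4) i : ℂ)) ∧ ((p : E4) m : ℂ) * (t m).1 p = 1 := by
  rcases ht m with h | h
  · exact .inl h
  · have h1 : ((p : E4) m : ℂ) * (t m).1 p = 1 := congrArg (fun f : Smooth U => f.1 p) h
    rcases eq_or_ne m 3 with rfl | hm
    · exact .inl h3
    · refine .inr ⟨?_, h1⟩
      fin_cases m
      · simp [cofac] at h1 ⊢; linear_combination ((p : E4) 1 : ℂ) * ((p : E4) 2 : ℂ) * h1
      · simp [cofac] at h1 ⊢; linear_combination ((p : E4) 0 : ℂ) * ((p : E4) 2 : ℂ) * h1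
      · simp [cofac] at h1 ⊢; linear_combination ((p : E4) 0 : ℂ) * ((p : E4) 1 : ℂ) * h1
      · exact absurd rfl hm

/-- Evaluation at a point. -/
def evalAt (p : U) : Smooth U →ₐ[ℂ] ℂ := (Pi.evalAlgHom ℂ (fun _ : U => ℂ) p).comp (Smooth U).val

theorem evalAt_apply (p : U) (f : Smooth U) : evalAt p f = f.1 p := rfl

theorem evalAt_coord (p : U) (i : Fin 4) : evalAt p (coord i) = ((p : E4) i : ℂ) := rfl

theorem quad_apply (i j : Fin 4) (p : U) :
    (quad T i j : Smooth U).1 p = quadC T i j fun i => ((p : E4) i : ℂ) := by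
  rw [← evalAt_apply]
  simp only [quad, quadC, map_smul, map_sum, map_mul, evalAt_coord, smul_eq_mul]

theorem dquad_apply (i j c : Fin 4) (p : U) :
    (dquad T i j c : Smooth U).1 p = dquadC T i j c fun i => ((p : E4) i : ℂ) := by
  rw [← evalAt_apply]
  simp only [dquad, dquadC, map_smul, map_sum, evalAt_coord, smul_eq_mul]

/-- Multiplication by (s₁s₂s₃)⁴ turns s_m⁻³ and s_m⁻⁴ into `cofac m ^ 4 * s_m` and `cofac m ^ 4`,
which are defined on the singular hyperplanes too. -/
theorem obsC_coord {hU : U ≤ region2} {t : Fin 4 → Smooth U} {α : Fin 4 → ℂ} (h3 : α 3 = 0)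
    (ht : ∀ m, α m = 0 ∨ coord m * t m = 1) (β : ℂ) (i j : Fin 4) (p : U) :
    obsC β α T i j (fun i => ((p : E4) i : ℂ)) (rad p) =
      (((p : E4) 0 : ℂ) * ((p : E4) 1 : ℂ) * ((p : E4) 2 : ℂ)) ^ 4 * (rad p : ℂ) ^ 5 *
        (obstruction hU t β α T i j).1 p := by
  have hR : (rad p : ℂ) * (rinv hU).1 p = 1 :=
    congrArg (fun f : Smooth U => f.1 p) (radius_mul_rinv hU)
  have ho : (obstruction hU t β α T i j).1 p =
      β * ((rinv hU).1 p ^ 3 * (dquad T j 3 i : Smooth U).1 p - 3 * (rinv hU).1 p ^ 5 *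
        (((p : E4) i : ℂ) - if i = 3 then ((p : E4) 3 : ℂ) else 0) * (quad T j 3 : Smooth U).1 p) -
      (∑ m, (2 * α m) * ((t m).1 p ^ 3 * (dquad T j m i : Smooth U).1 p) -
        (6 * α i) * ((t i).1 p ^ 4 * (quad T j i : Smooth U).1 p)) := by
    simp only [← evalAt_apply]
    simp only [obstruction, map_sub, map_smul, map_sum, map_mul, map_pow, map_ofNat, evalAt_coord,
      smul_eq_mul, apply_ite (evalAt p), map_zero]
  rw [ho]
  simp only [quad_apply, dquad_apply]
  set X := ((p : E4) 0 : ℂ) * ((p : E4) 1 : ℂ) * ((p : E4) 2 : ℂ) with hX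
  have e1 : ∀ m, 2 * α m * (cofac m (fun i => ((p : E4) i : ℂ)) ^ 4 * ((p : E4) m : ℂ)) =
      X ^ 4 * (2 * α m * (t m).1 p ^ 3) := fun m => by
    rcases coord_prod_mul h3 ht m p with h | ⟨h, h'⟩
    · simp [h]
    · rw [← h]; linear_combination (2 * α m * X ^ 4 * (t m).1 p ^ 3) * h'
  have e2 : 6 * α i * cofac i (fun i => ((p : E4) i : ℂ)) ^ 4 =
      X ^ 4 * (6 * α i * (t i).1 p ^ 4) := by
    rcases coord_prod_mul h3 ht i p with h | ⟨h, h'⟩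
    · simp [h]
    · rw [← h]; ring
  have e3 : ∀ m (d : ℂ), X ^ 4 * (2 * α m * (t m).1 p ^ 3) * d =
      X ^ 4 * (2 * α m * ((t m).1 p ^ 3 * d)) := fun m d => by ring
  have hR3 : (rad p : ℂ) ^ 5 * (rinv hU).1 p ^ 3 = (rad p : ℂ) ^ 2 := by
    linear_combination (rad p : ℂ) ^ 2 * (((rad p : ℂ) * (rinv hU).1 p) ^ 2 +
      (rad p : ℂ) * (rinv hU).1 p + 1) * hR
  have hR5 : (rad p : ℂ) ^ 5 * (rinv hU).1 p ^ 5 = 1 := by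
    rw [← mul_pow, hR, one_pow]
  simp only [obsC, e1, e2, e3, ← Finset.mul_sum]
  linear_combination (-β * X ^ 4 * dquadC T j 3 i fun i => ((p : E4) i : ℂ)) * hR3 +
    3 * β * X ^ 4 * (((p : E4) i : ℂ) - if i = 3 then ((p : E4) 3 : ℂ) else 0) *
      (quadC T j 3 fun i => ((p : E4) i : ℂ)) * hR5

theorem obsC_symm {hU : U ≤ region2} {t : Fin 4 → Smooth U} {α : Fin 4 → ℂ} {β γ : ℂ}
    (h3 : α 3 = 0) (ht : ∀ m, α m = 0 ∨ coord m * t m = 1) (hT : IsKilling T) {g : Smooth U}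
    (hg : ∀ i, 2 * E i g = ∑ a, quad T i a * E a (pot hU t β γ α)) (p : U) (i j : Fin 4) {x : E4}
    (hx : 0 < (p : E4) 0 * x 0 + (p : E4) 1 * x 1) :
    obsC β α T i j (fun i => (x i : ℂ)) (rad x) = obsC β α T j i (fun i => (x i : ℂ)) (rad x) := by
  refine sub_eq_zero.1 (eq_zero_of_eq_zero_on
    (P := fun v R => obsC β α T i j v R - obsC β α T j i v R) (n := 15)
    ((contDiff_obsC β α i j).sub (contDiff_obsC β α j i)) (fun c v R => ?_) (fun p => ?_) hU p hx)
  · simp only [obsC_smul]; ring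
  · simp only [obsC_coord (hU := hU) h3 ht, obstruction_symm (γ := γ) ht hT hg i j, sub_self]

end

/-! ### The integrability conditions force the Killing tensor -/

/-- The value z = 0 is excluded because the cofactor at the hyperplane under consideration vanishes
there; six points with z ≠ 0 suffice. -/
theorem coeff_eq_zero {a b c d e f : ℂ}
    (h : ∀ z w : ℝ, z ≠ 0 → a + b * z + c * w + d * z ^ 2 + e * (z * w) + f * w ^ 2 = 0) :
    a = 0 ∧ b = 0 ∧ c = 0 ∧ d = 0 ∧ e = 0 ∧ f = 0 := by
  have h1 := h 1 0 one_ne_zero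
  have h2 := h (-1) 0 (by norm_num)
  have h3 := h 2 0 two_ne_zero
  have h4 := h 1 1 one_ne_zero
  have h5 := h 1 (-1) one_ne_zero
  have h6 := h 2 1 two_ne_zero
  push_cast at h1 h2 h3 h4 h5 h6
  have hb : b = 0 := by linear_combination (1 / 2 : ℂ) * h1 - (1 / 2 : ℂ) * h2
  have hd : d = 0 := by linear_combination (1 / 3 : ℂ) * h3 - (1 / 3 : ℂ) * h1 - (1 / 3 : ℂ) * hb
  have ha : a = 0 := by linear_combination h1 - hb - hd
  have hf : f = 0 := by
    linear_combination (1 / 2 : ℂ) * h4 + (1 / 2 : ℂ) * h5 - ha - hb - hd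
  have he : e = 0 := by linear_combination h6 - h4 - hb - 3 * hd
  have hc : c = 0 := by linear_combination h4 - ha - hb - hd - he - hf
  exact ⟨ha, hb, hc, hd, he, hf⟩

namespace IsKilling

variable {T : Fin 4 → Fin 4 → Fin 4 → Fin 4 → ℂ}

theorem triple (hT : IsKilling T) (k m : Fin 4) : T k k k m = 0 := by
  linear_combination (1 / 3 : ℂ) * hT.cyclic k k k m

theorem polar (hT : IsKilling T) (k l m : Fin 4) : T k l k m = -(1 / 2) * T k k l m := by
  linear_combination (1 / 2 : ℂ) * (hT.cyclic k l k m + hT.symm_left k l k m)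

/-- A component with a repeated index reduces to one of the form T_kklm. If all four indices are
distinct, one of them is 0 and the symmetries move it to the front. -/
theorem eq_zero_of_diag (hT : IsKilling T) (hd : ∀ k l m, T k k l m = 0)
    (h0 : ∀ j a b, j ≠ 0 → a ≠ 0 → b ≠ 0 → T 0 j a b = 0) (i j a b : Fin 4) : T i j a b = 0 := by
  have h1 : ∀ k l m, T k l k m = 0 := fun k l m => by rw [hT.polar, hd, mul_zero]
  rcases eq_or_ne i j with rfl | h12
  · exact hd _ _ _
  rcases eq_or_ne i a with rfl | h13
  · exact h1 _ _ _
  rcases eq_or_ne i b with rfl | h14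
  · rw [hT.symm_right, h1]
  rcases eq_or_ne j a with rfl | h23
  · rw [hT.symm_left, h1]
  rcases eq_or_ne j b with rfl | h24
  · rw [hT.symm_left, hT.symm_right, h1]
  rcases eq_or_ne a b with rfl | h34
  · rw [hT.pair, hd]
  have h : i = 0 ∨ j = 0 ∨ a = 0 ∨ b = 0 := by omega
  rcases h with rfl | rfl | rfl | rfl
  · exact h0 _ _ _ h12.symm h13.symm h14.symm
  · rw [hT.symm_left]; exact h0 _ _ _ h12 h23.symm h24.symm
  · rw [hT.pair]; exact h0 _ _ _ h34.symm h13 h23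
  · rw [hT.pair, hT.symm_left]; exact h0 _ _ _ h34 h14 h24

theorem quadC_eq (hT : IsKilling T) (i j : Fin 4) (v : Fin 4 → ℂ) : quadC T i j v =
    1 / 2 * (T i j 0 0 * v 0 ^ 2 + T i j 1 1 * v 1 ^ 2 + T i j 2 2 * v 2 ^ 2 + T i j 3 3 * v 3 ^ 2) +
    T i j 0 1 * (v 0 * v 1) + T i j 0 2 * (v 0 * v 2) + T i j 0 3 * (v 0 * v 3) +
    T i j 1 2 * (v 1 * v 2) + T i j 1 3 * (v 1 * v 3) + T i j 2 3 * (v 2 * v 3) := by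
  simp only [quadC, Fin.sum_univ_four, hT.symm_right i j 1 0, hT.symm_right i j 2 0,
    hT.symm_right i j 3 0, hT.symm_right i j 2 1, hT.symm_right i j 3 1, hT.symm_right i j 3 2]
  ring

theorem rad_ne {x : E4} {P Q : ℝ} (h : 0 < P * x 0 + Q * x 1) : (rad x : ℂ) ≠ 0 := by
  refine Complex.ofReal_ne_zero.2 (Real.sqrt_pos.2 ?_).ne'
  have h1 : x 0 ≠ 0 ∨ x 1 ≠ 0 := by
    by_contra! h1
    simp [h1.1, h1.2] at h
  rcases h1 with h1 | h1 <;> positivity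

/-- The integrability condition at the hyperplane `x_r = 0`. -/
theorem quadC_eq_zero {r j : Fin 4} (hr : r ≠ 3) (hj : j ≠ r) {β : ℂ} {α : Fin 4 → ℂ}
    (hα : α r ≠ 0) {v : Fin 4 → ℂ} {R : ℂ} (hR : R ≠ 0) (hv : v r = 0) (hc : cofac r v ≠ 0)
    (h : obsC β α T r j v R = obsC β α T j r v R) : quadC T j r v = 0 := by
  -- On v_r = 0 the Coulomb term and all cofactors except that of r vanish, so only the fourth order
  -- pole at v_r survives.
  have h1 : v 0 * v 1 * v 2 = 0 := by fin_cases r <;> simp_all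
  have h2 : ∀ m, m ≠ r → cofac m v = 0 := fun m hm => by
    fin_cases r <;> fin_cases m <;> simp_all [cofac]
  have h3 : ∀ m, cofac m v ^ 4 * v m = 0 := fun m => by
    rcases eq_or_ne m r with rfl | hm
    · rw [hv, mul_zero]
    · rw [h2 m hm]; ring
  simp only [obsC, h1, h2 j hj, h3, zero_pow (four_ne_zero), mul_zero, zero_mul, zero_sub,
    Finset.sum_const_zero, sub_self, sub_neg_eq_add, mul_neg, zero_add] at h
  simpa [hR, hα, hc] using h

theorem ofReal_vec (a b c d : ℝ) : (fun i => (((!₂[a, b, c, d] : E4) i : ℝ) : ℂ)) =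
    ![(a : ℂ), (b : ℂ), (c : ℂ), (d : ℂ)] := by
  funext i; fin_cases i <;> simp

section
variable {β : ℂ} {α : Fin 4 → ℂ} {P Q : ℝ}

/-- The points (0, Q, z, w) lie in the half space and on the singular hyperplane. There k_j0
vanishes as a polynomial in z and w, and its coefficients are the components in question. -/
theorem eq_zero_of_zero (hT : IsKilling T) (h0 : α 0 ≠ 0) (hQ : Q ≠ 0)
    (h : ∀ i j, ∀ x : E4, 0 < P * x 0 + Q * x 1 →
      obsC β α T i j (fun i => (x i : ℂ)) (rad x) = obsC β α T j i (fun i => (x i : ℂ)) (rad x))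
    {j a b : Fin 4} (hj : j ≠ 0) (ha : a ≠ 0) (hb : b ≠ 0) : T 0 j a b = 0 := by
  have hc : (Q : ℂ) ≠ 0 := Complex.ofReal_ne_zero.2 hQ
  have h2 := coeff_eq_zero (a := 1 / 2 * T j 0 1 1 * Q ^ 2) (b := T j 0 1 2 * Q)
    (c := T j 0 1 3 * Q) (d := 1 / 2 * T j 0 2 2) (e := T j 0 2 3) (f := 1 / 2 * T j 0 3 3)
    fun z w hz => by
      have hW : 0 < P * (!₂[0, Q, z, w] : E4) 0 + Q * (!₂[0, Q, z, w] : E4) 1 := by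
        simp [mul_self_pos.2 hQ]
      have h2 := h 0 j _ hW
      rw [ofReal_vec] at h2
      have h3 := quadC_eq_zero (by decide) hj h0 (rad_ne hW) (by simp) (by simp [cofac, hQ, hz]) h2
      rw [← h3, quadC_eq hT]
      simp
      ring
  simp only [mul_eq_zero, pow_eq_zero_iff, hc, one_div, inv_eq_zero, OfNat.ofNat_ne_zero, false_or,
    or_false, ne_eq, not_false_eq_true] at h2
  rw [hT.symm_left]
  fin_cases a <;> fin_cases b <;> first | exact absurd rfl ha | exact absurd rfl hb | skip
  all_goals first | (simp; tauto) | (rw [hT.symm_right]; simp; tauto)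

theorem eq_zero_of_one (hT : IsKilling T) (h1 : α 1 ≠ 0) (hP : P ≠ 0)
    (h : ∀ i j, ∀ x : E4, 0 < P * x 0 + Q * x 1 →
      obsC β α T i j (fun i => (x i : ℂ)) (rad x) = obsC β α T j i (fun i => (x i : ℂ)) (rad x))
    {j a b : Fin 4} (hj : j ≠ 1) (ha : a ≠ 1) (hb : b ≠ 1) : T 1 j a b = 0 := by
  have hc : (P : ℂ) ≠ 0 := Complex.ofReal_ne_zero.2 hP
  have h2 := coeff_eq_zero (a := 1 / 2 * T j 1 0 0 * P ^ 2) (b := T j 1 0 2 * P)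
    (c := T j 1 0 3 * P) (d := 1 / 2 * T j 1 2 2) (e := T j 1 2 3) (f := 1 / 2 * T j 1 3 3)
    fun z w hz => by
      have hW : 0 < P * (!₂[P, 0, z, w] : E4) 0 + Q * (!₂[P, 0, z, w] : E4) 1 := by
        simp [mul_self_pos.2 hP]
      have h2 := h 1 j _ hW
      rw [ofReal_vec] at h2
      have h3 := quadC_eq_zero (by decide) hj h1 (rad_ne hW) (by simp) (by simp [cofac, hP, hz]) h2
      rw [← h3, quadC_eq hT]
      simp
      ring
  simp only [mul_eq_zero, pow_eq_zero_iff, hc, one_div, inv_eq_zero, OfNat.ofNat_ne_zero, false_or,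
    or_false, ne_eq, not_false_eq_true] at h2
  rw [hT.symm_left]
  fin_cases a <;> fin_cases b <;> first | exact absurd rfl ha | exact absurd rfl hb | skip
  all_goals first | (simp; tauto) | (rw [hT.symm_right]; simp; tauto)

/-- A Killing tensor satisfying the integrability conditions and a normalization vanishes. -/
theorem eq_zero_of_obsC (hT : IsKilling T) (hβ : β ≠ 0) (hα0 : α 0 ≠ 0) (hα1 : α 1 ≠ 0)
    (hP : P ≠ 0) (hQ : Q ≠ 0)
    (h : ∀ i j, ∀ x : E4, 0 < P * x 0 + Q * x 1 →
      obsC β α T i j (fun i => (x i : ℂ)) (rad x) = obsC β α T j i (fun i => (x i : ℂ)) (rad x))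
    (n01 : T 0 0 1 1 = 0) (n02 : T 0 0 2 2 = 0) (n12 : T 1 1 2 2 = 0) (n23 : T 2 2 3 3 = 0)
    (n : α 2 ≠ 0 ∨ T 1 1 2 3 = 0) (i j a b : Fin 4) : T i j a b = 0 := by
  have h0 : ∀ j a b, j ≠ 0 → a ≠ 0 → b ≠ 0 → T 0 j a b = 0 := fun j a b hj ha hb =>
    eq_zero_of_zero hT hα0 hQ h hj ha hb
  have h0' : ∀ j a b, j ≠ 0 → a ≠ 0 → b ≠ 0 → T j 0 a b = 0 := fun j a b hj ha hb => by
    rw [hT.symm_left, h0 j a b hj ha hb]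
  have h1 : ∀ j a b, j ≠ 1 → a ≠ 1 → b ≠ 1 → T 1 j a b = 0 := fun j a b hj ha hb =>
    eq_zero_of_one hT hα1 hP h hj ha hb
  have h1' : ∀ j a b, j ≠ 1 → a ≠ 1 → b ≠ 1 → T j 1 a b = 0 := fun j a b hj ha hb => by
    rw [hT.symm_left, h1 j a b hj ha hb]
  have p : ∀ k l m, k ≠ l → T k l k m = -(1 / 2) * T k k l m := fun k l m _ => hT.polar k l m
  have p' : ∀ k l m, k ≠ l → T k l m k = -(1 / 2) * T k k l m := fun k l m h => by
    rw [hT.symm_right, p k l m h]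
  have s0 : ∀ j a b, j ≠ 0 → a ≠ 0 → b ≠ 0 → T a b 0 j = 0 := fun j a b hj ha hb => by
    rw [hT.pair, h0 j a b hj ha hb]
  have s1 : ∀ j a b, j ≠ 1 → a ≠ 1 → b ≠ 1 → T a b 1 j = 0 := fun j a b hj ha hb => by
    rw [hT.pair, h1 j a b hj ha hb]
  have d0 : ∀ k m, k ≠ 0 → m ≠ 0 → T k k 0 m = 0 := fun k m hk hm => by
    linear_combination 2 * hT.polar k 0 m - 2 * h0' k k m hk hk hm
  have d1 : ∀ k m, k ≠ 1 → m ≠ 1 → T k k 1 m = 0 := fun k m hk hm => by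
    linear_combination 2 * hT.polar k 1 m - 2 * h1' k k m hk hk hm
  have d0' : ∀ k m, k ≠ 0 → m ≠ 0 → T k k m 0 = 0 := fun k m hk hm => by
    rw [hT.symm_right, d0 k m hk hm]
  have d1' : ∀ k m, k ≠ 1 → m ≠ 1 → T k k m 1 = 0 := fun k m hk hm => by
    rw [hT.symm_right, d1 k m hk hm]
  have t : ∀ k m, T k k m k = 0 := fun k m => by rw [hT.symm_right, hT.triple]
  have n10 : T 1 1 0 0 = 0 := by rw [hT.pair, n01]
  have n20 : T 2 2 0 0 = 0 := by rw [hT.pair, n02]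
  have n21 : T 2 2 1 1 = 0 := by rw [hT.pair, n12]
  have n32 : T 3 3 2 2 = 0 := by rw [hT.pair, n23]
  have r3 : ∀ k, T k k 3 2 = T k k 2 3 := fun k => hT.symm_right k k 3 2
  have r0 : ∀ k, T 2 3 k k = T k k 2 3 := fun k => hT.pair 2 3 k k
  have r1 : ∀ k, T 3 2 k k = T k k 2 3 := fun k => by rw [hT.symm_left, r0]
  have hPc : (P : ℂ) ≠ 0 := Complex.ofReal_ne_zero.2 hP
  have hQc : (Q : ℂ) ≠ 0 := Complex.ofReal_ne_zero.2 hQ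
  have hW : ∀ z w, 0 < P * (!₂[P, Q, z, w] : E4) 0 + Q * (!₂[P, Q, z, w] : E4) 1 := fun z w => by
    simp only [Matrix.cons_val_zero, Matrix.cons_val_one]
    exact add_pos (mul_self_pos.2 hP) (mul_self_pos.2 hQ)
  have q03 : ∀ v, quadC T 0 3 v = -(1 / 2) * (T 0 0 3 3 * (v 0 * v 3) + T 0 0 2 3 * (v 0 * v 2)) :=
    fun v => by
      rw [quadC_eq hT]
      simp (disch := decide) only [h0, p, t, r3, d1']
      ring
  have q13 : ∀ v, quadC T 1 3 v = -(1 / 2) * (T 1 1 3 3 * (v 1 * v 3) + T 1 1 2 3 * (v 1 * v 2)) :=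
    fun v => by
      rw [quadC_eq hT]
      simp (disch := decide) only [s0, h1, p, t, r3]
      ring
  have q01 : ∀ v, quadC T 0 1 v = 0 := fun v => by
    rw [quadC_eq hT]
    simp (disch := decide) [h0, h1', p, n01]
  have q10 : ∀ v, quadC T 1 0 v = 0 := fun v => by
    rw [← q01 v, quadC, quadC]; simp only [hT.symm_left 0 1]
  -- With the components found so far, the condition for the indices 0, 1 reduces to v₀ k₁₃ = v₁
  -- k₀₃.
  have H : ∀ z w : ℝ, z ≠ 0 → (T 1 1 3 3 - T 0 0 3 3) * w + (T 1 1 2 3 - T 0 0 2 3) * z = 0 :=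
    fun z w hz => by
      have e := h 0 1 _ (hW z w)
      have hz' : (z : ℂ) ≠ 0 := Complex.ofReal_ne_zero.2 hz
      rw [ofReal_vec] at e
      simp (disch := decide) [obsC, Fin.sum_univ_four, cofac, q03, q13, q01, q10, dquadC, h0, h1, p',
        s0, s1, d0', d1', n01, n10] at e
      simp only [hβ, hP, hQ, hz, or_false] at e
      have e' : ((P : ℂ) * Q) * ((T 1 1 3 3 - T 0 0 3 3) * w + (T 1 1 2 3 - T 0 0 2 3) * z) = 0 := by
        linear_combination (2 / 3 : ℂ) * e
      exact (mul_eq_zero.1 e').resolve_left (mul_ne_zero hPc hQc)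
  have H1 := H 1 0 one_ne_zero
  have H2 := H 1 1 one_ne_zero
  push_cast at H1 H2
  -- A pole at x₃ = 0 supplies this through k₀₂ on that hyperplane. Without the pole it has to be
  -- imposed, and it is then the component carried by the additional symmetry L.
  have c0 : T 0 0 2 3 = 0 := by
    rcases n with n | n
    · have e := h 2 0 _ (hW 0 1)
      rw [ofReal_vec] at e
      have e2 := quadC_eq_zero (by decide) (by decide) n (rad_ne (hW 0 1)) (by simp)
        (by simp [cofac, hP, hQ]) e
      rw [quadC_eq hT] at e2
      simpa (disch := decide) [h0, p, t, d1', n02, hP] using e2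
    · linear_combination n - H1
  have c1 : T 1 1 2 3 = 0 := by linear_combination H1 + c0
  have e01 : T 1 1 3 3 = T 0 0 3 3 := by linear_combination H2 - H1
  -- Now k₀₂ = k₂₃ = 0, and the condition for the indices 0, 2 leaves only the Coulomb term with
  -- k₀₃.
  have e0 : T 0 0 3 3 = 0 := by
    have e := h 0 2 _ (hW 1 1)
    rw [ofReal_vec] at e
    have q23 : ∀ v, quadC T 2 3 v = 0 := fun v => by
      rw [quadC_eq hT]
      simp (disch := decide) [s0, s1, p, t, r0, c0, c1, n23]
    have q02 : ∀ v, quadC T 0 2 v = 0 := fun v => by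
      rw [quadC_eq hT]
      simp (disch := decide) [h0, p, t, d1', n02, c0]
    have q20 : ∀ v, quadC T 2 0 v = 0 := fun v => by
      rw [← q02 v, quadC, quadC]; simp only [hT.symm_left 0 2]
    simp (disch := decide) [obsC, Fin.sum_univ_four, cofac, q03, q23, q02, q20, dquadC, h0, h1', p',
      hT.symm_left 2 0, p, s0, d0', d1', t, n02, n20, r3, r0, c0, hβ, hP, hQ] at e
    exact e
  refine hT.eq_zero_of_diag (fun k l m => ?_) h0 i j a b
  have e30 : T 3 3 0 0 = 0 := by rw [hT.pair, e0]
  have e31 : T 3 3 1 1 = 0 := by rw [hT.pair, e01, e0]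
  fin_cases k <;> fin_cases l <;> fin_cases m <;>
    simp (disch := decide) [d0, d1, d0', d1', hT.triple, t, n01, n02, n12, n23, n10, n20, n21, n32,
      r3, c0, c1, e0, e01, e30, e31]

end

end IsKilling

/-! ### First order symmetries -/

/-- The components of the Killing vector with coefficients `A`. -/
def linC (A : Fin 4 → Fin 4 → ℂ) (m : Fin 4) (v : Fin 4 → ℂ) : ℂ := ∑ a, A a m * v a

/-- The condition on a first order symmetry, multiplied by `(v₁ v₂ v₃)³ R³`. -/
def vecObsC (β : ℂ) (α : Fin 4 → ℂ) (A : Fin 4 → Fin 4 → ℂ) (v : Fin 4 → ℂ) (R : ℂ) : ℂ :=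
  β * (v 0 * v 1 * v 2) ^ 3 * linC A 3 v - R ^ 3 * ∑ m, 2 * α m * (cofac m v ^ 3 * linC A m v)

theorem vecObsC_smul (β : ℂ) (α : Fin 4 → ℂ) (A : Fin 4 → Fin 4 → ℂ) (c : ℂ) (v : Fin 4 → ℂ)
    (R : ℂ) : vecObsC β α A (fun i => c * v i) (c * R) = c ^ 10 * vecObsC β α A v R := by
  have e1 : ∀ m, linC A m (fun i => c * v i) = c * linC A m v := fun m => by
    simp only [linC, Finset.mul_sum]
    exact Finset.sum_congr rfl fun b _ => by ring
  have e : ∀ m, 2 * α m * ((c ^ 2 * cofac m v) ^ 3 * (c * linC A m v)) =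
      c ^ 7 * (2 * α m * (cofac m v ^ 3 * linC A m v)) := fun m => by ring
  simp only [vecObsC, e1, cofac_smul, e, ← Finset.mul_sum]
  ring

theorem contDiff_vecObsC (β : ℂ) (α : Fin 4 → ℂ) (A : Fin 4 → Fin 4 → ℂ) :
    ContDiff ℝ ω fun z : (Fin 4 → ℂ) × ℂ => vecObsC β α A z.1 z.2 := by
  have h := fun m => contDiff_cofac m
  unfold vecObsC linC
  fun_prop

section
variable {hU : U ≤ region2} {t : Fin 4 → Smooth U} {α : Fin 4 → ℂ} {β γ : ℂ}
  {A : Fin 4 → Fin 4 → ℂ}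

theorem vecObsC_coord (h3 : α 3 = 0) (ht : ∀ m, α m = 0 ∨ coord m * t m = 1)
    (hA : ∀ i j, A i j = -A j i) (h : (killingOp1 A : Op U) (pot hU t β γ α) = 0) (p : U) :
    vecObsC β α A (fun i => ((p : E4) i : ℂ)) (rad p) = 0 := by
  have hs := sum_sym1_mul_coord (killingOp1_mem (U := U) A)
  have h1 : (killingOp1 A : Op U) 1 = 0 := by
    have h : ∀ i, E i (1 : Smooth U) = 0 := fun i => (derE i).map_one_eq_zero
    simp only [killingOp1, LinearMap.smul_apply, LinearMap.sum_apply, J_eq, h, mul_zero, sub_self,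
      smul_zero, Finset.sum_const_zero]
  rw [apply_of_mem_diffOp_one (killingOp1_mem A), h1, zero_mul, zero_add, sum_mul_E_pot ht _ hs] at h
  have h2 := congrArg (evalAt p) h
  simp only [sym1_killingOp1 hA, map_sub, map_smul, map_sum, map_mul, map_pow, evalAt_coord,
    smul_eq_mul, map_zero] at h2
  have hR : (rad p : ℂ) * (rinv hU).1 p = 1 :=
    congrArg (fun f : Smooth U => f.1 p) (radius_mul_rinv hU)
  have hR3 : (rad p : ℂ) ^ 3 * (rinv hU).1 p ^ 3 = 1 := by rw [← mul_pow, hR, one_pow]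
  set X := ((p : E4) 0 : ℂ) * ((p : E4) 1 : ℂ) * ((p : E4) 2 : ℂ) with hX
  have e1 : ∀ m (d : ℂ), 2 * α m * (cofac m (fun i => ((p : E4) i : ℂ)) ^ 3 * d) =
      X ^ 3 * (2 * α m * ((t m).1 p ^ 3 * d)) := fun m d => by
    rcases coord_prod_mul h3 ht m p with h | ⟨h, -⟩
    · simp [h]
    · rw [← h]; ring
  simp only [vecObsC, e1, ← Finset.mul_sum]
  simp only [evalAt_apply] at h2
  simp only [linC]
  linear_combination X ^ 3 * (rad p : ℂ) ^ 3 * h2 -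
    β * X ^ 3 * (∑ a, A a 3 * ((p : E4) a : ℂ)) * hR3

/-- The poles on x₁ = 0 and x₂ = 0 kill the components A_a0 and A_a1. The last one, A_23, is killed
by the Coulomb term at (P, Q, 1, 0). -/
theorem killing_vector_eq_zero (hne : (U : Set S3).Nonempty) (h3 : α 3 = 0)
    (ht : ∀ m, α m = 0 ∨ coord m * t m = 1) (hβ : β ≠ 0) (hα0 : α 0 ≠ 0) (hα1 : α 1 ≠ 0)
    (hA : ∀ i j, A i j = -A j i) (h : (killingOp1 A : Op U) (pot hU t β γ α) = 0) (i j : Fin 4) :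
    A i j = 0 := by
  obtain ⟨p, hp⟩ := hne
  set P := (p : E4) 0 with hPd
  set Q := (p : E4) 1 with hQd
  have hP : P ≠ 0 := (hU hp).1
  have hQ : Q ≠ 0 := (hU hp).2
  have hPc : (P : ℂ) ≠ 0 := Complex.ofReal_ne_zero.2 hP
  have hQc : (Q : ℂ) ≠ 0 := Complex.ofReal_ne_zero.2 hQ
  have key : ∀ x : E4, 0 < P * x 0 + Q * x 1 →
      vecObsC β α A (fun i => (x i : ℂ)) (rad x) = 0 := fun x hx =>
    eq_zero_of_eq_zero_on (contDiff_vecObsC β α A) (fun c v R => vecObsC_smul β α A c v R)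
      (vecObsC_coord h3 ht hA h) hU ⟨p, hp⟩ hx
  have c0 := coeff_eq_zero (a := A 1 0 * Q) (b := A 2 0) (c := A 3 0) (d := 0) (e := 0) (f := 0)
    fun z w hz => by
      have hW : 0 < P * (!₂[0, Q, z, w] : E4) 0 + Q * (!₂[0, Q, z, w] : E4) 1 := by
        simp [mul_self_pos.2 hQ]
      have e := key _ hW
      have hR := IsKilling.rad_ne hW
      rw [IsKilling.ofReal_vec] at e
      simp [vecObsC, linC, cofac, Fin.sum_univ_four, hα0, hQ, hz] at e
      rcases e with e | e
      · exact absurd (by rw [e, Complex.ofReal_zero]) hR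
      · linear_combination e
  have c1 := coeff_eq_zero (a := A 0 1 * P) (b := A 2 1) (c := A 3 1) (d := 0) (e := 0) (f := 0)
    fun z w hz => by
      have hW : 0 < P * (!₂[P, 0, z, w] : E4) 0 + Q * (!₂[P, 0, z, w] : E4) 1 := by
        simp [mul_self_pos.2 hP]
      have e := key _ hW
      have hR := IsKilling.rad_ne hW
      rw [IsKilling.ofReal_vec] at e
      simp [vecObsC, linC, cofac, Fin.sum_univ_four, hα1, hP, hz] at e
      rcases e with e | e
      · exact absurd (by rw [e, Complex.ofReal_zero]) hR
      · linear_combination e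
  have d : ∀ i, A i i = 0 := fun i => by
    linear_combination (1 / 2 : ℂ) * hA i i
  have a10 : A 1 0 = 0 := by simpa [hQ] using c0.1
  have c2 : A 2 3 = 0 := by
    have hW : 0 < P * (!₂[P, Q, 1, 0] : E4) 0 + Q * (!₂[P, Q, 1, 0] : E4) 1 := by
      simp only [Matrix.cons_val_zero, Matrix.cons_val_one]
      exact add_pos (mul_self_pos.2 hP) (mul_self_pos.2 hQ)
    have e := key _ hW
    rw [IsKilling.ofReal_vec] at e
    simp [vecObsC, linC, cofac, Fin.sum_univ_four, hβ, hP, hQ, d, a10, c0, c1, hA 0, hA 1 2, hA 1 3] at e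
    exact e
  have hlt : ∀ i j, j < i → A i j = 0 := fun i j hij => by
    fin_cases i <;> fin_cases j <;> simp [a10, c0, c1] at hij ⊢
    rw [hA, c2, neg_zero]
  rcases lt_trichotomy i j with hij | rfl | hij
  · rw [hA, hlt j i hij, neg_zero]
  · exact d i
  · exact hlt i j hij

end

/-! ### The components of the Killing tensor of a second order operator -/

/-- The second derivatives of the components of the symbol of a second order operator. If the
operator commutes with the Laplacian, these are the components of its Killing tensor. -/
def tens (i j a b : Fin 4) : Op U →ₗ[ℂ] Smooth U where
  toFun S := gradE 1 b (gradE 2 a (sym2 S i j))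
  map_add' S R := by rw [sym2_add, gradE_add, gradE_add]
  map_smul' c S := by
    have h : ∀ (d : ℂ) i (f : Smooth U), gradE d i (c • f) = c • gradE d i f := fun d i f => by
      rw [gradE, gradE, map_smul, smul_add, Algebra.mul_smul_comm, smul_comm]
    rw [sym2_smul, h, h]; rfl

theorem tens_mulOp (f : Smooth U) (i j a b : Fin 4) : tens i j a b (mulOp f) = 0 := by
  have h : sym2 (mulOp f) i j = 0 := by rw [sym2, ad_mulOp, ad]; simp
  change gradE 1 b (gradE 2 a (sym2 (mulOp f) i j)) = 0
  rw [h, gradE_zero, gradE_zero]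

/-- The derivatives of the components of the rotation `J k l`. -/
def rotC (k l i c : Fin 4) : ℤ :=
  (if l = i ∧ c = k then 1 else 0) - if k = i ∧ c = l then 1 else 0

theorem gradE_J_coord (k l i c : Fin 4) : gradE 1 c (J k l (coord i) : Smooth U) =
    (rotC k l i c : ℂ) • 1 := by
  have h : ∀ c k, E c (coord k : Smooth U) + coord c * coord k = if c = k then 1 else 0 :=
    fun c k => by rw [E_coord, sub_add_cancel]
  have e : (J k l (coord i) : Smooth U) =
      (if l = i then coord k else 0) - if k = i then coord l else 0 := by
    rw [J_eq, E_coord, E_coord]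
    split_ifs <;> ring
  rw [gradE, e, one_smul, rotC, Int.cast_sub, Int.cast_ite, Int.cast_ite, Int.cast_one, Int.cast_zero]
  by_cases h1 : l = i <;> by_cases h2 : k = i <;>
    simp only [h1, h2, if_true, if_false, true_and, false_and, map_sub, map_zero, mul_sub, mul_zero,
      sub_zero, zero_sub, add_zero, sub_smul, neg_smul, zero_smul, ite_smul, one_smul, map_neg]
  · rw [← h c i]; ring
  · rw [← h c k]
  · rw [← h c l]; ring

theorem gradE_gradE_mul {f g : Smooth U} {u v : Fin 4 → ℂ} (hf : ∀ c, gradE 1 c f = u c • 1)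
    (hg : ∀ c, gradE 1 c g = v c • 1) (a b : Fin 4) :
    gradE 1 b (gradE 2 a (f * g)) = (u a * v b + u b * v a) • 1 := by
  have e : gradE 2 a (f * g) = v a • f + u a • g := by
    have h1 : gradE 2 a (f * g) = f * gradE 1 a g + g * gradE 1 a f := by
      simp only [gradE, E_mul, Algebra.smul_def, map_one, map_ofNat]; ring
    rw [h1, hf, hg, Algebra.mul_smul_comm, Algebra.mul_smul_comm, mul_one, mul_one]
  have h2 : ∀ (c : ℂ) (f : Smooth U), gradE 1 b (c • f) = c • gradE 1 b f := fun c f => by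
    rw [gradE, gradE, map_smul, smul_add, Algebra.mul_smul_comm, smul_comm]
  rw [e, gradE_add, h2, h2, hf, hg, smul_smul, smul_smul, ← add_smul]
  congr 1; ring

/-- The components of the Killing tensor of the product of the rotations `J k l` and `J m n`. -/
def rotMulC (k l m n i j a b : Fin 4) : ℤ :=
  rotC k l i a * rotC m n j b + rotC k l i b * rotC m n j a +
    (rotC k l j a * rotC m n i b + rotC k l j b * rotC m n i a)

theorem tens_J_mul_J (k l m n i j a b : Fin 4) : tens i j a b (J k l * J m n : Op U) =
    (rotMulC k l m n i j a b : ℂ) • 1 := by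
  change gradE 1 b (gradE 2 a (sym2 (J k l * J m n) i j)) = _
  have h := fun k l i c => gradE_J_coord (U := U) k l i c
  rw [sym2_J_mul_J, gradE_add, gradE_add, gradE_gradE_mul (h _ _ _) (h _ _ _),
    gradE_gradE_mul (h _ _ _) (h _ _ _), ← add_smul, rotMulC]
  push_cast; rfl

section
variable {hU : U ≤ region2} {t : Fin 4 → Smooth U} {β γ : ℂ} {α : Fin 4 → ℂ}

/-- A symmetry whose Killing tensor is normalized is a constant. -/
theorem exists_eq_smul_one_of_tens (hc : IsConnected (U : Set S3)) (h3 : α 3 = 0)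
    (ht : ∀ m, α m = 0 ∨ coord m * t m = 1) (hβ : β ≠ 0) (hα0 : α 0 ≠ 0) (hα1 : α 1 ≠ 0)
    {S : Op U} (hS : S ∈ diffOp U 2) (hH : Commute S (laplaceBeltrami + mulOp (pot hU t β γ α)))
    (n01 : tens 0 0 1 1 S = 0) (n02 : tens 0 0 2 2 S = 0) (n12 : tens 1 1 2 2 S = 0)
    (n23 : tens 2 2 3 3 S = 0) (n : α 2 ≠ 0 ∨ tens 1 1 2 3 S = 0) : ∃ c : ℂ, S = c • (1 : Op U) := by
  obtain ⟨T, A, g, hT, hA, hTS, rfl⟩ := exists_symmetry_form hc hS hH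
  obtain ⟨p, hp⟩ := hc.nonempty
  have hz : ∀ {i j a b}, tens i j a b (killingOp2 T + killingOp1 A + mulOp g : Op U) = 0 →
      T i j a b = 0 := fun {i j a b} h => by
    have e := congrArg (evalAt ⟨p, hp⟩) ((hTS i j a b).symm.trans h)
    rwa [map_smul, map_one, map_zero, smul_eq_mul, mul_one] at e
  have hg := two_mul_E_of_commute hT hH
  have hT0 : T = 0 := by
    funext i j a b
    exact hT.eq_zero_of_obsC hβ hα0 hα1 (hU hp).1 (hU hp).2
      (fun i j x hx => obsC_symm h3 ht hT hg ⟨p, hp⟩ i j hx) (hz n01) (hz n02) (hz n12) (hz n23)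
      (n.imp_right fun h => hz h) i j a b
  subst hT0
  have hK : (killingOp2 0 : Op U) = 0 := by simp [killingOp2]
  -- Without a Killing tensor the gradient of g vanishes. The Killing vector must then annihilate
  -- the potential, which forces it to be zero.
  obtain ⟨c, hgc⟩ := exists_eq_smul_one hc.isPreconnected fun i => eq_zero_of_two_mul (by
    rw [hg i]; simp)
  rw [hK, zero_add] at hH ⊢
  have hA0 : A = 0 := by
    funext i j
    exact killing_vector_eq_zero hc.nonempty h3 ht hβ hα0 hα1 hA
      (killingOp1_apply_of_commute hgc hH) i j
  subst hA0
  refine ⟨c, ?_⟩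
  have hK : (killingOp1 0 : Op U) = 0 := by simp [killingOp1]
  rw [hK, zero_add, hgc]
  apply LinearMap.ext; intro f
  rw [mulOp_apply, Algebra.smul_mul_assoc, one_mul]; rfl

/-- A symmetry whose normalized components agree with those of a linear combination of given
symmetries is, up to a constant, this combination. -/
theorem mem_of_tens_eq {H : Op U} (hH : H = laplaceBeltrami + mulOp (pot hU t β γ α))
    (hc : IsConnected (U : Set S3)) (h3 : α 3 = 0) (ht : ∀ m, α m = 0 ∨ coord m * t m = 1)
    (hβ : β ≠ 0) (hα0 : α 0 ≠ 0) (hα1 : α 1 ≠ 0) {ι : Type*} [Fintype ι] {A : ι → Op U}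
    {τ : ι → Fin 4 → Fin 4 → Fin 4 → Fin 4 → ℤ} (hA : ∀ m, A m ∈ diffOp U 2)
    (hAH : ∀ m, Commute (A m) H) (hτ : ∀ m i j a b, tens i j a b (A m) = (τ m i j a b : ℂ) • 1)
    {S : Op U} (hS : S ∈ diffOp U 2) (hSH : Commute S H)
    (hx : ∀ T : Fin 4 → Fin 4 → Fin 4 → Fin 4 → ℂ, ∃ x : ι → ℂ,
      ∑ m, x m * τ m 0 0 1 1 = T 0 0 1 1 ∧ ∑ m, x m * τ m 0 0 2 2 = T 0 0 2 2 ∧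
      ∑ m, x m * τ m 1 1 2 2 = T 1 1 2 2 ∧ ∑ m, x m * τ m 2 2 3 3 = T 2 2 3 3 ∧
      (α 2 ≠ 0 ∨ ∑ m, x m * τ m 1 1 2 3 = T 1 1 2 3))
    {W : Submodule ℂ (Op U)} (h1 : 1 ∈ W) (hW : ∀ m, A m ∈ W) : S ∈ W := by
  subst hH
  obtain ⟨T, -, -, -, -, hT, -⟩ := exists_symmetry_form hc hS hSH
  obtain ⟨x, n01, n02, n12, n23, n⟩ := hx T
  set R : Op U := ∑ m, x m • A m with hR
  have hRS : R ∈ diffOp U 2 := sum_mem_diffOp _ fun m _ => Submodule.smul_mem _ _ (hA m)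
  have hRH : Commute R _ := op_commute_sum _ fun m _ => op_commute_smul (hAH m) (x m)
  have e : ∀ {i j a b}, ∑ m, x m * τ m i j a b = T i j a b →
      tens i j a b (S + (-1 : ℂ) • R) = 0 := fun {i j a b} h => by
    have h4 : tens i j a b S = T i j a b • 1 := hT i j a b
    have h5 : tens i j a b R = T i j a b • 1 := by
      rw [hR, map_sum, ← h, Finset.sum_smul]
      exact Finset.sum_congr rfl fun m _ => by rw [map_smul, hτ, smul_smul]
    rw [map_add, map_smul, h4, h5, neg_one_smul, add_neg_cancel]
  obtain ⟨c, h⟩ := exists_eq_smul_one_of_tens hc h3 ht hβ hα0 hα1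
    (Submodule.add_mem _ hS (Submodule.smul_mem _ (-1) hRS)) (hSH.add_left (op_commute_smul hRH (-1)))
    (e n01) (e n02) (e n12) (e n23) (n.imp_right e)
  have h2 : S = c • (1 : Op U) + R := by
    rw [← h]
    apply LinearMap.ext; intro f
    rw [LinearMap.add_apply, LinearMap.add_apply, LinearMap.smul_apply, neg_one_smul,
      neg_add_cancel_right]
  rw [h2]
  exact W.add_mem (W.smul_mem c h1) (W.sum_mem fun m _ => W.smul_mem _ (hW m))

end

theorem tens_J_sq (k l i j a b : Fin 4) : tens i j a b (J k l ^ 2 : Op U) =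
    (rotMulC k l k l i j a b : ℂ) • 1 := by
  rw [pow_two, tens_J_mul_J]

theorem tens_Hext (hU : U ≤ region3) (a : Fin 5 → ℂ) (i j c d : Fin 4) :
    tens i j c d (Hext hU a) = tens i j c d laplaceBeltrami := by
  rw [Hext, map_add, tens_mulOp, add_zero]

theorem tens_L12 (hU : U ≤ region3) (a : Fin 5 → ℂ) (i j c d : Fin 4) :
    tens i j c d (L12 hU a) = tens i j c d (J 0 1 ^ 2) := by
  rw [L12, map_add, tens_mulOp, add_zero]

theorem tens_L13 (hU : U ≤ region3) (a : Fin 5 → ℂ) (i j c d : Fin 4) :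
    tens i j c d (L13 hU a) = tens i j c d (J 0 2 ^ 2) := by
  rw [L13, map_add, tens_mulOp, add_zero]

theorem tens_L23 (hU : U ≤ region3) (a : Fin 5 → ℂ) (i j c d : Fin 4) :
    tens i j c d (L23 hU a) = tens i j c d (J 1 2 ^ 2) := by
  rw [L23, map_add, tens_mulOp, add_zero]

theorem tens_Hcoul (hU : U ≤ region2) (b : Fin 4 → ℂ) (i j c d : Fin 4) :
    tens i j c d (Hcoul hU b) = tens i j c d laplaceBeltrami := by
  rw [Hcoul, map_add, tens_mulOp, add_zero]

theorem tens_Lc12 (hU : U ≤ region2) (b : Fin 4 → ℂ) (i j c d : Fin 4) :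
    tens i j c d (Lc12 hU b) = tens i j c d (J 0 1 ^ 2) := by
  rw [Lc12, map_add, tens_mulOp, add_zero]

theorem tens_Lc13 (hU : U ≤ region2) (b : Fin 4 → ℂ) (i j c d : Fin 4) :
    tens i j c d (Lc13 hU b) = tens i j c d (J 0 2 ^ 2) := by
  rw [Lc13, map_add, tens_mulOp, add_zero]

theorem tens_Lc23 (hU : U ≤ region2) (b : Fin 4 → ℂ) (i j c d : Fin 4) :
    tens i j c d (Lc23 hU b) = tens i j c d (J 1 2 ^ 2) := by
  rw [Lc23, map_add, tens_mulOp, add_zero]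

theorem tens_Lc (hU : U ≤ region2) (b : Fin 4 → ℂ) (i j c d : Fin 4) :
    tens i j c d (Lc hU b) = tens i j c d (lrlOp 2 1 0) := by
  rw [Lc_eq, map_add, tens_mulOp, add_zero]

/-- The components of the Killing tensor of the Laplacian. -/
def lapC (i j a b : Fin 4) : ℤ :=
  rotMulC 0 1 0 1 i j a b + rotMulC 0 2 0 2 i j a b + rotMulC 0 3 0 3 i j a b +
    rotMulC 1 2 1 2 i j a b + rotMulC 1 3 1 3 i j a b + rotMulC 2 3 2 3 i j a b

theorem tens_laplaceBeltrami (i j a b : Fin 4) :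
    tens i j a b (laplaceBeltrami : Op U) = (lapC i j a b : ℂ) • 1 := by
  rw [laplaceBeltrami]
  simp only [map_add, tens_J_sq, ← add_smul]
  rw [lapC]; push_cast; rfl

/-- The components of the Killing tensor of `lrlOp 2 1 0`. -/
def lrlC (i j a b : Fin 4) : ℤ :=
  rotMulC 1 2 3 1 i j a b + rotMulC 3 1 1 2 i j a b +
    (rotMulC 0 2 3 0 i j a b + rotMulC 3 0 0 2 i j a b)

theorem tens_lrlOp (i j a b : Fin 4) :
    tens i j a b (lrlOp 2 1 0 : Op U) = (lrlC i j a b : ℂ) • 1 := by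
  rw [lrlOp, symm, symm]
  simp only [map_add, tens_J_mul_J, ← add_smul]
  rw [lrlC]; push_cast; rfl

/-- The second order symmetries of the system with potential `Hext`. -/
theorem mem_span_of_commute_Hext (hU : U ≤ region3) (hc : IsConnected (U : Set S3)) (a : Fin 5 → ℂ)
    (h0 : a 0 ≠ 0) (h1 : a 1 ≠ 0) (h2 : a 2 ≠ 0) (h3 : a 3 ≠ 0) {S : Op U}
    (hS : S ∈ diffOp U 2) (hH : Commute S (Hext hU a)) :
    S ∈ Submodule.span ℂ {(1 : Op U), Hext hU a, L12 hU a, L13 hU a, L23 hU a} := by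
  have hV : Hext hU a = laplaceBeltrami + mulOp (pot (hU.trans region3_le)
      ![inv1 (hU.trans region3_le), inv2 (hU.trans region3_le), inv3 hU, 0] (a 0) (a 4)
      ![a 1, a 2, a 3, 0]) := by
    rw [Hext, pot, Fin.sum_univ_four]
    simp [add_assoc]
  refine mem_of_tens_eq (A := ![Hext hU a, L12 hU a, L13 hU a, L23 hU a])
    (τ := ![lapC, rotMulC 0 1 0 1, rotMulC 0 2 0 2, rotMulC 1 2 1 2]) hV hc rfl ?_ h0 h1 h2 ?_ ?_ ?_
    hS hH (fun T => ?_) (Submodule.subset_span (.inl rfl)) ?_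
  · intro m
    fin_cases m
    · exact .inr (coord0_mul_inv1 (hU.trans region3_le))
    · exact .inr (coord1_mul_inv2 (hU.trans region3_le))
    · exact .inr (coord2_mul_inv3 hU)
    · exact .inl rfl
  · intro m
    fin_cases m
    exacts [Hext_mem hU a, L12_mem hU a, L13_mem hU a, L23_mem hU a]
  · intro m
    fin_cases m
    exacts [Commute.refl _, L12_commute hU a, L13_commute hU a, L23_commute hU a]
  · intro m i j c d
    fin_cases m
    exacts [(tens_Hext hU a i j c d).trans (tens_laplaceBeltrami i j c d),
      (tens_L12 hU a i j c d).trans (tens_J_sq 0 1 i j c d),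
      (tens_L13 hU a i j c d).trans (tens_J_sq 0 2 i j c d),
      (tens_L23 hU a i j c d).trans (tens_J_sq 1 2 i j c d)]
  -- J_kl² has the component 4 at (k, k, l, l), so the Laplacian has 4 at all four normalized
  -- places. The place (2, 2, 3, 3) is seen by the Hamiltonian alone and fixes its coefficient.
  · refine ⟨fun m => 1 / 4 * ![T 2 2 3 3, T 0 0 1 1 - T 2 2 3 3, T 0 0 2 2 - T 2 2 3 3,
      T 1 1 2 2 - T 2 2 3 3] m, ?_, ?_, ?_, ?_, .inl h3⟩ <;>
    simp [Fin.sum_univ_succ, lapC, rotMulC, rotC] <;> ring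
  · intro m
    refine Submodule.subset_span (.inr ?_)
    fin_cases m
    exacts [.inl rfl, .inr (.inl rfl), .inr (.inr (.inl rfl)), .inr (.inr (.inr rfl))]

/-- The second order symmetries of the system with potential `Hcoul`. -/
theorem mem_span_of_commute_Hcoul (hU : U ≤ region2) (hc : IsConnected (U : Set S3)) (b : Fin 4 → ℂ)
    (h0 : b 0 ≠ 0) (h1 : b 1 ≠ 0) (h2 : b 2 ≠ 0) {S : Op U}
    (hS : S ∈ diffOp U 2) (hH : Commute S (Hcoul hU b)) :
    S ∈ Submodule.span ℂ
      {(1 : Op U), Hcoul hU b, Lc12 hU b, Lc13 hU b, Lc23 hU b, Lc hU b} := by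
  have hV : Hcoul hU b = laplaceBeltrami + mulOp (pot hU ![inv1 hU, inv2 hU, 0, 0] (b 0) (b 3)
      ![b 1, b 2, 0, 0]) := by
    rw [Hcoul, pot, Fin.sum_univ_four]
    simp [add_assoc]
  refine mem_of_tens_eq (A := ![Hcoul hU b, Lc12 hU b, Lc13 hU b, Lc23 hU b, Lc hU b])
    (τ := ![lapC, rotMulC 0 1 0 1, rotMulC 0 2 0 2, rotMulC 1 2 1 2, lrlC]) hV hc rfl ?_ h0 h1 h2
    ?_ ?_ ?_ hS hH (fun T => ?_) (Submodule.subset_span (.inl rfl)) ?_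
  · intro m
    fin_cases m
    exacts [.inr (coord0_mul_inv1 hU), .inr (coord1_mul_inv2 hU), .inl rfl, .inl rfl]
  · intro m
    fin_cases m
    exacts [Hcoul_mem hU b, Lc12_mem hU b, Lc13_mem hU b, Lc23_mem hU b, Lc_mem hU b]
  · intro m
    fin_cases m
    exacts [Commute.refl _, Lc12_commute hU b, Lc13_commute hU b, Lc23_commute hU b,
      Lc_commute hU b]
  · intro m i j c d
    fin_cases m
    exacts [(tens_Hcoul hU b i j c d).trans (tens_laplaceBeltrami i j c d),
      (tens_Lc12 hU b i j c d).trans (tens_J_sq 0 1 i j c d),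
      (tens_Lc13 hU b i j c d).trans (tens_J_sq 0 2 i j c d),
      (tens_Lc23 hU b i j c d).trans (tens_J_sq 1 2 i j c d),
      (tens_Lc hU b i j c d).trans (tens_lrlOp i j c d)]
  -- The operator L has the component -4 at (1, 1, 2, 3) and 0 at the other four places, while the
  -- other operators vanish at (1, 1, 2, 3).
  · refine ⟨fun m => 1 / 4 * ![T 2 2 3 3, T 0 0 1 1 - T 2 2 3 3, T 0 0 2 2 - T 2 2 3 3,
      T 1 1 2 2 - T 2 2 3 3, -T 1 1 2 3] m, ?_, ?_, ?_, ?_, .inr ?_⟩ <;>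
    simp [Fin.sum_univ_succ, lapC, rotMulC, rotC, lrlC] <;> ring
  · intro m
    refine Submodule.subset_span (.inr ?_)
    fin_cases m
    exacts [.inl rfl, .inr (.inl rfl), .inr (.inr (.inl rfl)), .inr (.inr (.inr (.inl rfl))),
      .inr (.inr (.inr (.inr rfl)))]

end CoulombSphere

end

theorem mainTheorem4 :
    -- the extended system is 4th order superintegrable with the given symmetries
    (∀ (U : TopologicalSpace.Opens S3) (hU : U ≤ region3) (a : Fin 5 → ℂ),
      IsSuperintegrable 4 (Hext hU a) ![2, 2, 2, 2, 4]
        ![Hext hU a, L12 hU a, L13 hU a, L23 hU a, K1 hU a] ∧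
      IsSuperintegrable 4 (Hext hU a) ![2, 2, 2, 2, 4]
        ![Hext hU a, L12 hU a, L13 hU a, L23 hU a, K3 hU a] ∧
      ((U : Set S3).Nonempty → LinearIndependent ℂ
        ![(1 : Op U), Hext hU a, L12 hU a, L13 hU a, L23 hU a, K1 hU a, K3 hU a]) ∧
      (IsConnected (U : Set S3) → a 0 ≠ 0 → a 1 ≠ 0 → a 2 ≠ 0 → a 3 ≠ 0 →
        ∀ S ∈ diffOp U 2, Commute S (Hext hU a) →
          S ∈ Submodule.span ℂ {(1 : Op U), Hext hU a, L12 hU a, L13 hU a, L23 hU a})) ∧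
    -- it extends the system `Hcoul`
    (∀ (U : TopologicalSpace.Opens S3) (hU : U ≤ region3) (b : Fin 4 → ℂ),
      Hext hU ![b 0, b 1, b 2, 0, b 3] = Hcoul (hU.trans region3_le) b ∧
      L12 hU ![b 0, b 1, b 2, 0, b 3] = Lc12 (hU.trans region3_le) b ∧
      L13 hU ![b 0, b 1, b 2, 0, b 3] = Lc13 (hU.trans region3_le) b ∧
      L23 hU ![b 0, b 1, b 2, 0, b 3] = Lc23 (hU.trans region3_le) b ∧
      K1 hU ![b 0, b 1, b 2, 0, b 3] = -(Lc (hU.trans region3_le) b ^ 2)) ∧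
    -- the system `Hcoul` is semidegenerate
    (∀ (U : TopologicalSpace.Opens S3) (hU : U ≤ region2),
      (IsConnected (U : Set S3) → IsSemidegenerate (potential3 hU)) ∧
      ∀ b : Fin 4 → ℂ,
        IsSuperintegrable 2 (Hcoul hU b) ![2, 2, 2, 2, 2]
          ![Hcoul hU b, Lc12 hU b, Lc13 hU b, Lc23 hU b, Lc hU b] ∧
        (IsConnected (U : Set S3) → b 0 ≠ 0 → b 1 ≠ 0 → b 2 ≠ 0 →
          ∀ S ∈ diffOp U 2, Commute S (Hcoul hU b) →
            S ∈ Submodule.span ℂ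
              {(1 : Op U), Hcoul hU b, Lc12 hU b, Lc13 hU b, Lc23 hU b, Lc hU b})) ∧
    -- it is Stäckel equivalent to the flat system
    (Set.MapsTo stereo {x : E3 | ∀ i, x i ≠ 0} (region3 : Set S3) ∧
      Set.MapsTo stereoInv (region3 : Set S3) {x : E3 | ∀ i, x i ≠ 0} ∧
      Set.InvOn stereoInv stereo {x : E3 | ∀ i, x i ≠ 0} (region3 : Set S3) ∧
      ∀ (U : TopologicalSpace.Opens S3) (hU : U ≤ region3) (a : Fin 5 → ℂ) (f : Smooth U)
        (x : E3) (hx : stereo x ∈ U),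
        stackel confFactor (Hflat ![a 0, a 1, a 2, a 3, a 4 + 3 / 4]) (pullback f) x =
          (Hext hU a f).1 ⟨stereo x, hx⟩) := by
  exact ⟨fun U hU a => ⟨isSuperintegrable_K1 hU a, isSuperintegrable_K3 hU a,
      linearIndependent_symmetries hU a,
      fun hc h0 h1 h2 h3 _ hS hH => mem_span_of_commute_Hext hU hc a h0 h1 h2 h3 hS hH⟩,
    fun U hU b => ⟨Hext_eq_Hcoul hU b, L12_eq_Lc12 hU b, L13_eq_Lc13 hU b, L23_eq_Lc23 hU b,
      K1_eq_neg_Lc_sq hU b⟩,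
    fun U hU => ⟨fun hc => isSemidegenerate_of_symmetries_mem_span hU
        fun b h0 h1 h2 _ hS hH => mem_span_of_commute_Hcoul hU hc b h0 h1 h2 hS hH,
      fun b => ⟨isSuperintegrable_Lc hU b,
        fun hc h0 h1 h2 _ hS hH => mem_span_of_commute_Hcoul hU hc b h0 h1 h2 hS hH⟩⟩,
    mapsTo_stereo, mapsTo_stereoInv, invOn_stereo, fun U hU a f x hx => stackel_Hflat hU a f hx⟩
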